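/- Let $\zeta\ge 2$ and $d$ be natural numbers, let $\mathbb{S}^{\zeta-1}\subset\mathbb{R}^\zeta$ be the unit sphere with its surface measure, and let $\mathbb{MS}(\zeta,d)=(\mathbb{S}^{\zeta-1})^d$ carry the uniform measure, i.e. the product of the surface measures; write $\mathbf{x}=(\mathbf{x}^{(1)},\dots,\mathbf{x}^{(d)})$ for its points, and $|\mathbb{S}^{\zeta-2}|$ for the area of $\mathbb{S}^{\zeta-2}$ ($|\mathbb{S}^0|=2$). For each $k\ge 0$ let $Y_{k1},\dots,Y_{kN(\zeta,k)}$ be an orthonormal basis in $L^2(\mathbb{S}^{\zeta-1})$ of the space of spherical harmonics of frequency $k$, that is, of restrictions to $\mathbb{S}^{\zeta-1}$ of harmonic homogeneous polynomials of degree $k$; $N(\zeta,k)$ is the dimension of that space. For $\mathbf{k}\in\mathbb{N}^d$ and $\mathbf{j}$ with $j_i\in\{1,\dots,N(\zeta,k_i)\}$ define the SH-product $Y_{\mathbf{k},\mathbf{j}}(\mathbf{x})=\prod_{i=1}^d Y_{k_ij_i}(\mathbf{x}^{(i)})$. Let $w(t)=(1-t^2)^{(\zeta-3)/2}$ and let $Q_k$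 be the Gegenbauer polynomials given by $Q_0=1$, $Q_1=t$, $(k+\zeta-1)Q_{k+2}=(2k+\zeta)\,t\,Q_{k+1}-(k+1)Q_k$. Let $K:\mathbb{MS}(\zeta,d)\times\mathbb{MS}(\zeta,d)\to\mathbb{R}$ be a multi-dot product kernel, $K(\mathbf{x},\mathbf{z})=\kappa(\langle\mathbf{x}^{(1)},\mathbf{z}^{(1)}\rangle,\dots,\langle\mathbf{x}^{(d)},\mathbf{z}^{(d)}\rangle)$, where $\kappa(\mathbf{t})\prod_i w(t_i)$ is integrable on $[-1,1]^d$, and put $$\lambda_{\mathbf{k}}=|\mathbb{S}^{\zeta-2}|^d\int_{[-1,1]^d}\kappa(\mathbf{t})\prod_{i=1}^d Q_{k_i}(t_i)\,(1-t_i^2)^{\frac{\zeta-3}{2}}\,d\mathbf{t}.$$ Then: 1. $\deg Q_k=k$, $Q_k(1)=1$, and the $Q_k$ are orthogonal on $[-1,1]$ with respect to the weight $w$. 2. The SH-products form a complete orthonormal system in $L^2(\mathbb{MS}(\zeta,d))$. 3. Every SH-product is an eigenfunction of $K$, with an eigenvalue that depends only on the frequency vector $\mathbf{k}$: for every $\mathbf{x}$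 the function $\mathbf{z}\mapsto K(\mathbf{x},\mathbf{z})Y_{\mathbf{k},\mathbf{j}}(\mathbf{z})$ is integrable and $\int K(\mathbf{x},\mathbf{z})Y_{\mathbf{k},\mathbf{j}}(\mathbf{z})\,d\mathbf{z}=\lambda_{\mathbf{k}}Y_{\mathbf{k},\mathbf{j}}(\mathbf{x})$. 4. There are no others: if $0\ne f\in L^2(\mathbb{MS}(\zeta,d))$ and $\int K(\mathbf{x},\mathbf{z})f(\mathbf{z})\,d\mathbf{z}=\mu f(\mathbf{x})$ for almost every $\mathbf{x}$, then $\mu=\lambda_{\mathbf{k}}$ for some $\mathbf{k}$, and $f$ is orthogonal to every $Y_{\mathbf{k},\mathbf{j}}$ with $\lambda_{\mathbf{k}}\neq\mu$. 5. If moreover $\kappa(\mathbf{t})^2\prod_i w(t_i)$ is integrable on $[-1,1]^d$, then $K$ is in $L^2(\mathbb{MS}(\zeta,d)\times\mathbb{MS}(\zeta,d))$ and $$K(\mathbf{x},\mathbf{z})=\sum_{\mathbf{k},\mathbf{j}}\lambda_{\mathbf{k}}Y_{\mathbf{k},\mathbf{j}}(\mathbf{x})Y_{\mathbf{k},\mathbf{j}}(\mathbf{z})$$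 with unconditional convergence in that space. 6. If $\kappa$ is continuous on $[-1,1]^d$ and $K$ is symmetric positive semidefinite, or if $\kappa$ is the sum of a power series $\sum_{\mathbf{n}\ge 0}b_{\mathbf{n}}\mathbf{t}^{\mathbf{n}}$ with real coefficients that converges unconditionally at every point of $[-1,1]^d$, then this decomposition converges unconditionally and uniformly on $\mathbb{MS}(\zeta,d)\times\mathbb{MS}(\zeta,d)$ (in particular at every point). -/

import Mathlib

open MeasureTheory

noncomputable section

namespace MultiDot

/-- The unit sphere `S^{n-1}` of `ℝ^n` (Euclidean norm). -/
abbrev Sph (n : ℕ) : Type := Metric.sphere (0 : EuclideanSpace ℝ (Fin n)) 1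

/-- The surface measure on `S^{n-1}`. -/
def surf (n : ℕ) : Measure (Sph n) :=
  (volume : Measure (EuclideanSpace ℝ (Fin n))).toSphere

/-- The surface area `|S^{n-1}|` of the unit sphere of `ℝ^n`. -/
def area (n : ℕ) : ℝ := (surf n).real Set.univ

/-- The multisphere `MS(ζ, d) = S^{ζ-1} × ⋯ × S^{ζ-1}` (`d` factors). -/
abbrev MS (ζ d : ℕ) : Type := Fin d → Sph ζ

/-- The uniform measure on the multisphere: the product of the surface measures. -/
def unif (ζ d : ℕ) : Measure (MS ζ d) :=
  haveI : IsFiniteMeasure (surf ζ) :=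
    inferInstanceAs (IsFiniteMeasure (volume : Measure (EuclideanSpace ℝ (Fin ζ))).toSphere)
  Measure.pi fun _ => surf ζ

/-- The vector `t = (⟨x⁽¹⁾, z⁽¹⁾⟩, …, ⟨x⁽ᵈ⁾, z⁽ᵈ⁾⟩)` of pixelwise dot products. -/
def dots {ζ d : ℕ} (x z : MS ζ d) : Fin d → ℝ :=
  fun i => inner ℝ (x i : EuclideanSpace ℝ (Fin ζ)) (z i : EuclideanSpace ℝ (Fin ζ))

/-- The cube `[-1, 1]^d`. -/
def cube (d : ℕ) : Set (Fin d → ℝ) := Set.Icc (fun _ => -1) (fun _ => 1)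

/-- `K` is the multi-dot product kernel with profile `κ`; only the values of `κ` on the cube
matter. -/
def IsMultiDot {ζ d : ℕ} (K : MS ζ d → MS ζ d → ℝ) (κ : (Fin d → ℝ) → ℝ) : Prop :=
  ∀ x z, K x z = κ (dots x z)

/-! ### Spherical harmonics -/

/-- The Laplacian on polynomials in `n` variables. -/
def polyLaplacian (n : ℕ) : MvPolynomial (Fin n) ℝ →ₗ[ℝ] MvPolynomial (Fin n) ℝ :=
  ∑ i : Fin n, (MvPolynomial.pderiv i).toLinearMap ∘ₗ (MvPolynomial.pderiv i).toLinearMap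

/-- Restriction of polynomials to the unit sphere. -/
def restrictSph (n : ℕ) : MvPolynomial (Fin n) ℝ →ₗ[ℝ] (Sph n → ℝ) where
  toFun p := fun x => MvPolynomial.eval (fun i => (x : EuclideanSpace ℝ (Fin n)) i) p
  map_add' p q := by ext x; simp
  map_smul' c p := by ext x; simp [MvPolynomial.smul_eval]

/-- The space of spherical harmonics of frequency `k` on `S^{n-1}`: restrictions to the sphere of
the harmonic homogeneous polynomials of degree `k`. -/
def sphHarm (n k : ℕ) : Submodule ℝ (Sph n → ℝ) :=
  (MvPolynomial.homogeneousSubmodule (Fin n) ℝ k ⊓ LinearMap.ker (polyLaplacian n)).map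
    (restrictSph n)

/-- The number `N(n, k)` of spherical harmonics of frequency `k` on `S^{n-1}`. -/
def numHarm (n k : ℕ) : ℕ := Module.finrank ℝ (sphHarm n k)

/-- For each frequency `k`, the functions `Y k j`, `j ∈ [N(n, k)]`, are an orthonormal basis of the
spherical harmonics of frequency `k` (they are orthonormal, and as many as the dimension). -/
structure IsSHBasis (n : ℕ) (Y : (k : ℕ) → Fin (numHarm n k) → Sph n → ℝ) : Prop where
  mem : ∀ k j, Y k j ∈ sphHarm n k
  orthonormal : ∀ k j j', ∫ x, Y k j x * Y k j' x ∂(surf n) = if j = j' then 1 else 0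

/-- The index set of the SH-products: frequency vectors `k ∈ ℕ^d` with phases
`j_i ∈ [N(ζ, k_i)]`. -/
abbrev SHIndex (ζ d : ℕ) : Type := (k : Fin d → ℕ) × ((i : Fin d) → Fin (numHarm ζ (k i)))

/-- The SH-product `Y_{k,j}(x) = ∏ i, Y_{k_i j_i}(x⁽ⁱ⁾)`. -/
def shProd {ζ d : ℕ} (Y : (k : ℕ) → Fin (numHarm ζ k) → Sph ζ → ℝ) (p : SHIndex ζ d)
    (x : MS ζ d) : ℝ :=
  ∏ i, Y (p.1 i) (p.2 i) (x i)

/-! ### Gegenbauer polynomials and eigenvalues -/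

/-- The Gegenbauer polynomials `Q_k` of dimension `n`, normalized by `Q_k(1) = 1`, through the
recurrence `(k + n - 1) Q_{k+2} = (2k + n) t Q_{k+1} - (k + 1) Q_k`. -/
def gegenbauer (n : ℕ) : ℕ → Polynomial ℝ
  | 0 => 1
  | 1 => Polynomial.X
  | k + 2 =>
      Polynomial.C (((k : ℝ) + n - 1)⁻¹) *
        (Polynomial.C (2 * (k : ℝ) + n) * Polynomial.X * gegenbauer n (k + 1)
          - Polynomial.C ((k : ℝ) + 1) * gegenbauer n k)

/-- The weight `(1 - t²)^{(n-3)/2}`. -/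
def weight (n : ℕ) (t : ℝ) : ℝ := (1 - t ^ 2) ^ (((n : ℝ) - 3) / 2)

/-- `λ_k = |S^{ζ-2}|^d ∫_{[-1,1]^d} κ(t) ∏ i, Q_{k_i}(t_i) (1 - t_i²)^{(ζ-3)/2} dt`. -/
def eigval (ζ : ℕ) {d : ℕ} (κ : (Fin d → ℝ) → ℝ) (k : Fin d → ℕ) : ℝ :=
  area (ζ - 1) ^ d *
    ∫ t in cube d, κ t * ∏ i, ((gegenbauer ζ (k i)).eval (t i) * weight ζ (t i))

/-- The nonzero function `f` is an eigenfunction, with eigenvalue `μ`, of the integral operator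
`f ↦ ∫ K(·, z) f(z) dz` with respect to the uniform measure on the multisphere. -/
def IsEigenfunction {ζ d : ℕ} (K : MS ζ d → MS ζ d → ℝ) (μ : ℝ) (f : MS ζ d → ℝ) : Prop :=
  f ≠ 0 ∧ ∀ x, Integrable (fun z => K x z * f z) (unif ζ d) ∧
    ∫ z, K x z * f z ∂(unif ζ d) = μ * f x

/-- `κ` is the sum of a power series that converges (unconditionally) on all of `[-1, 1]^d`. -/
def IsPowerSeriesOnCube {d : ℕ} (κ : (Fin d → ℝ) → ℝ) : Prop :=
  ∃ b : (Fin d → ℕ) → ℝ, ∀ t ∈ cube d, HasSum (fun n => b n * ∏ i, t i ^ n i) (κ t)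

end MultiDot

end

/-! ### Polar coordinates and the distribution of one dot product -/

noncomputable section

namespace MultiDot

open Set Real

/-! On a single sphere everything rests on one integration by parts. Integrating the derivative of
p(y) exp(-|y|²) and passing to polar coordinates gives ∫ ∂_i p = (m + n - 1) ∫ z_i p over the
sphere, for p homogeneous of degree m (`sphInt_pderiv`). Combined with Euler's identity it shows
that harmonics of different frequencies are orthogonal and, by induction on the power, that z ↦
⟨x,z⟩^m integrates harmonics of frequency k to multiples of themselves at x (Funk–Hecke). The
multiple is found by testing on the zonal harmonic with pole x, whose restriction is Q_k(⟨x,z⟩).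
Orthogonality also yields the splitting p = h + |z|² q with h harmonic, so harmonics span all
polynomials on the sphere, and Stone–Weierstrass makes the SH-products complete.

For fixed x the vector of dot products has the law ∏ |S^{ζ-2}| w(t_i) dt_i on the cube, whatever x
is (`map_dots_unif`). Hence Funk–Hecke passes from polynomials to every integrable κ by density in
L¹. By Fubini the operator T of the kernel satisfies ⟨Tf, Y⟩ = λ⟨f, Y⟩ for every integrable f, so an
eigenfunction for μ has nonzero coefficients only where λ = μ. Parseval for K(x,·), integrated in x,
says that the λ² add up to ‖K‖², which is the expansion in L².

For uniform convergence, the addition theorem makes the sum of Y² over the phases of one frequency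
vector a constant, `sumSq`. The inequality 2|ab| ≤ a² + b² then reduces the claim to summability of
|λ_k| `sumSq` (`summable_termCM`); the uniform limit is K because the L² limit is K and both are
continuous. In the positive semidefinite case λ ≥ 0 and the partial sums on the diagonal are bounded
by max κ, as in Mercer's theorem. In the power series case every t^m is a convex combination of
Gegenbauer polynomials, which bounds the sum by ∑ |b_n|. -/

instance isFiniteMeasure_surf (n : ℕ) : IsFiniteMeasure (surf n) :=
  inferInstanceAs (IsFiniteMeasure (volume : Measure (EuclideanSpace ℝ (Fin n))).toSphere)

instance isOpenPosMeasure_surf (n : ℕ) : (surf n).IsOpenPosMeasure :=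
  inferInstanceAs ((volume : Measure (EuclideanSpace ℝ (Fin n))).toSphere.IsOpenPosMeasure)

instance isFiniteMeasure_unif (ζ d : ℕ) : IsFiniteMeasure (unif ζ d) :=
  inferInstanceAs (IsFiniteMeasure (Measure.pi fun _ : Fin d => surf ζ))

instance isOpenPosMeasure_unif (ζ d : ℕ) : (unif ζ d).IsOpenPosMeasure :=
  Measure.pi.isOpenPosMeasure (fun _ : Fin d => surf ζ)

theorem unif_eq_pi (ζ d : ℕ) : unif ζ d = Measure.pi fun _ : Fin d => surf ζ := rfl

theorem surf_univ (n : ℕ) : surf n univ = ENNReal.ofReal (area n) := by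
  simp [area]

theorem area_pos {n : ℕ} (hn : 1 ≤ n) : 0 < area n := by
  have : Nonempty (Fin n) := ⟨⟨0, hn⟩⟩
  have h : surf n univ ≠ 0 := by
    rw [Measure.measure_univ_ne_zero]
    exact Measure.toSphere_ne_zero _
  exact ENNReal.toReal_pos h (measure_ne_top _ _)

/-- Integration in polar coordinates. -/
theorem lintegral_polar {n : ℕ} (hn : 1 ≤ n) {F : EuclideanSpace ℝ (Fin n) → ENNReal}
    (hF : Measurable F) :
    ∫⁻ y, F y = ∫⁻ σ, ∫⁻ r in Ioi (0 : ℝ), ENNReal.ofReal (r ^ (n - 1)) *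
      F (r • (σ : EuclideanSpace ℝ (Fin n))) ∂volume ∂(surf n) := by
  have : Nonempty (Fin n) := ⟨⟨0, hn⟩⟩
  let E := EuclideanSpace ℝ (Fin n)
  have h1 : ∫⁻ y, F y = ∫⁻ x : ({(0 : E)}ᶜ : Set E), F x ∂((volume : Measure E).comap (↑)) := by
    rw [lintegral_subtype_comap (measurableSet_singleton _).compl, restrict_compl_singleton]
  have h2 := ((volume : Measure E).measurePreserving_homeomorphUnitSphereProd).lintegral_comp_emb
    (Homeomorph.measurableEmbedding _)
    (fun p => F ((p.2 : ℝ) • (p.1 : E)))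
  have h3 : ∀ x : ({(0 : E)}ᶜ : Set E),
      F (((homeomorphUnitSphereProd E x).2 : ℝ) • ((homeomorphUnitSphereProd E x).1 : E)) = F x := by
    intro x
    have := (homeomorphUnitSphereProd E).symm_apply_apply x
    conv_rhs => rw [← this]
    rfl
  rw [h1, ← lintegral_congr h3, h2, lintegral_prod]
  · refine lintegral_congr fun σ => ?_
    rw [Measure.volumeIoiPow, lintegral_withDensity_eq_lintegral_mul]
    · have : Module.finrank ℝ E = n := by simp [E]
      rw [this]
      exact lintegral_subtype_comap measurableSet_Ioi
        (fun r => ENNReal.ofReal (r ^ (n - 1)) * F (r • (σ : E)))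
    · fun_prop
    · fun_prop
  · fun_prop

/-- The substitution `t = cos θ`. -/
theorem lintegral_sin_pow_comp_cos {m : ℕ} (hm : 1 ≤ m) (φ : ℝ → ENNReal) :
    ∫⁻ θ in Ioo 0 π, ENNReal.ofReal (sin θ ^ (m - 1)) * φ (cos θ) =
      ∫⁻ t in Icc (-1 : ℝ) 1, ENNReal.ofReal (weight (m + 1) t) * φ t := by
  have himg : cos '' Ioo 0 π = Ioo (-1) 1 := by
    apply Subset.antisymm
    · rintro _ ⟨θ, hθ, rfl⟩
      constructor
      · simpa using Real.cos_lt_cos_of_nonneg_of_le_pi hθ.1.le le_rfl hθ.2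
      · simpa using Real.cos_lt_cos_of_nonneg_of_le_pi le_rfl hθ.2.le hθ.1
    · intro t ht
      refine ⟨arccos t, ⟨arccos_pos.2 ht.2, ?_⟩, cos_arccos ht.1.le ht.2.le⟩
      refine lt_of_le_of_ne (arccos_le_pi _) fun h => ?_
      have := cos_arccos ht.1.le ht.2.le
      rw [h, cos_pi] at this
      linarith [ht.1]
  rw [setLIntegral_congr Ioo_ae_eq_Icc.symm, ← himg,
    lintegral_image_eq_lintegral_abs_deriv_mul (f := cos) (f' := fun x => - sin x) measurableSet_Ioo
    (fun x _ => (hasDerivAt_cos x).hasDerivWithinAt)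
    (injOn_cos.mono Ioo_subset_Icc_self)]
  refine setLIntegral_congr_fun measurableSet_Ioo fun θ hθ => ?_
  have hs : 0 < sin θ := sin_pos_of_pos_of_lt_pi hθ.1 hθ.2
  rw [← mul_assoc, ← ENNReal.ofReal_mul (abs_nonneg _), abs_neg, abs_of_pos hs]
  congr 2
  -- The weight at cos θ is sin θ to the power m - 2; the Jacobian sin θ raises it to m - 1.
  have h1 : 1 - cos θ ^ 2 = sin θ ^ (2 : ℝ) := by
    rw [Real.rpow_two, Real.sin_sq]
  rw [weight, h1, ← Real.rpow_mul hs.le]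
  nth_rewrite 2 [← Real.rpow_one (sin θ)]
  rw [← Real.rpow_add hs, ← Real.rpow_natCast]
  congr 1
  push_cast [Nat.cast_sub hm]
  ring

/-- Here s stands for the coordinate along the pole and ρ for the norm of the orthogonal part. In
polar coordinates of the half-plane ρ > 0 the quotient is cos θ and the root is r, so the integral
separates. -/
theorem lintegral_halfplane_polar {m : ℕ} (hm : 1 ≤ m) {φ g : ℝ → ENNReal}
    (hφ : Measurable φ) (hg : Measurable g) :
    ∫⁻ s : ℝ, ∫⁻ ρ in Ioi (0 : ℝ), ENNReal.ofReal (ρ ^ (m - 1)) *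
      (φ (s / √(s ^ 2 + ρ ^ 2)) * g (√(s ^ 2 + ρ ^ 2))) =
    (∫⁻ r in Ioi (0 : ℝ), ENNReal.ofReal (r ^ m) * g r) *
      ∫⁻ t in Icc (-1 : ℝ) 1, ENNReal.ofReal (weight (m + 1) t) * φ t := by
  -- The integrand is extended by zero to ρ ≤ 0, since the polar change of variables covers the
  -- whole plane; angles θ ≤ 0 then contribute nothing.
  set G : ℝ × ℝ → ENNReal := fun p => (Ioi (0 : ℝ)).indicator (fun ρ =>
    ENNReal.ofReal (ρ ^ (m - 1)) *
      (φ (p.1 / √(p.1 ^ 2 + ρ ^ 2)) * g (√(p.1 ^ 2 + ρ ^ 2)))) p.2 with hG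
  have hGm : Measurable G := by
    have : G = (Prod.snd ⁻¹' (Ioi (0 : ℝ))).indicator (fun p : ℝ × ℝ =>
        ENNReal.ofReal (p.2 ^ (m - 1)) *
      (φ (p.1 / √(p.1 ^ 2 + p.2 ^ 2)) * g (√(p.1 ^ 2 + p.2 ^ 2)))) := by
      ext p; simp [hG, indicator]
    rw [this]
    refine Measurable.indicator ?_ (measurable_snd measurableSet_Ioi)
    fun_prop
  have h1 : ∫⁻ s : ℝ, ∫⁻ ρ in Ioi (0 : ℝ), ENNReal.ofReal (ρ ^ (m - 1)) *
      (φ (s / √(s ^ 2 + ρ ^ 2)) * g (√(s ^ 2 + ρ ^ 2))) = ∫⁻ p : ℝ × ℝ, G p := by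
    rw [Measure.volume_eq_prod, lintegral_prod _ hGm.aemeasurable]
    refine lintegral_congr fun s => ?_
    rw [← lintegral_indicator measurableSet_Ioi]
  rw [h1, ← lintegral_comp_polarCoord_symm, polarCoord_target, ← lintegral_sin_pow_comp_cos hm,
    ← lintegral_indicator measurableSet_Ioi, ← lintegral_indicator measurableSet_Ioo,
    ← lintegral_prod_mul]
  · rw [← lintegral_indicator (measurableSet_Ioi.prod measurableSet_Ioo), Measure.volume_eq_prod]
    refine lintegral_congr fun p => ?_
    obtain ⟨r, θ⟩ := p
    by_cases hr : 0 < r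
    swap
    · simp [indicator, hr]
    by_cases hθ : θ ∈ Ioo (-π) π
    swap
    · have : ¬ θ ∈ Ioo 0 π := fun h => hθ ⟨by linarith [h.1, pi_pos], h.2⟩
      simp [indicator, this, hr, hθ]
    by_cases hθ0 : 0 < θ
    · have hs : 0 < sin θ := sin_pos_of_pos_of_lt_pi hθ0 hθ.2
      have hrs : 0 < r * sin θ := mul_pos hr hs
      have hsq : √((r * cos θ) ^ 2 + (r * sin θ) ^ 2) = r := by
        rw [mul_pow, mul_pow, ← mul_add, add_comm, sin_sq_add_cos_sq, mul_one, sqrt_sq hr.le]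
      have hθ1 : θ ∈ Ioo 0 π := ⟨hθ0, hθ.2⟩
      rw [indicator_of_mem (show (r, θ) ∈ Ioi 0 ×ˢ Ioo (-π) π from ⟨hr, hθ⟩)]
      simp only [hG, polarCoord_symm_apply, indicator_of_mem (show r * sin θ ∈ Ioi 0 from hrs), hsq,
        indicator_of_mem (show r ∈ Ioi 0 from hr), indicator_of_mem hθ1, smul_eq_mul]
      rw [mul_div_cancel_left₀ _ hr.ne', mul_pow, ENNReal.ofReal_mul (by positivity)]
      have : r ^ m = r * r ^ (m - 1) := by
        rw [← pow_succ']; congr 1; omega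
      rw [this, ENNReal.ofReal_mul hr.le]
      ring
    · have hθ1 : ¬ θ ∈ Ioo 0 π := fun h => hθ0 h.1
      have hs : sin θ ≤ 0 := sin_nonpos_of_nonpos_of_neg_pi_le (not_lt.1 hθ0) hθ.1.le
      have hrs : ¬ r * sin θ ∈ Ioi (0 : ℝ) := by
        simp only [mem_Ioi, not_lt]
        exact mul_nonpos_of_nonneg_of_nonpos hr.le hs
      rw [indicator_of_mem (show (r, θ) ∈ Ioi 0 ×ˢ Ioo (-π) π from ⟨hr, hθ⟩)]
      simp only [hG, polarCoord_symm_apply, indicator_of_notMem hrs, indicator_of_notMem hθ1]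
      simp
  · refine (Measurable.indicator ?_ measurableSet_Ioi).aemeasurable
    fun_prop
  · refine (Measurable.indicator ?_ measurableSet_Ioo).aemeasurable
    fun_prop

theorem lintegral_euclideanSpace_succ {m : ℕ} {F : EuclideanSpace ℝ (Fin (m + 1)) → ENNReal}
    (hF : Measurable F) :
    ∫⁻ u, F u = ∫⁻ s : ℝ, ∫⁻ v : EuclideanSpace ℝ (Fin m),
      F (WithLp.toLp 2 (Fin.cons s v.ofLp)) := by
  rw [← (EuclideanSpace.volume_preserving_symm_measurableEquiv_toLp (Fin (m + 1))).symm.lintegral_comp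
    hF, ← (volume_preserving_piFinSuccAbove (fun _ : Fin (m + 1) => ℝ) 0).symm.lintegral_comp
      (by fun_prop), Measure.volume_eq_prod, lintegral_prod _ (by fun_prop)]
  refine lintegral_congr fun s => ?_
  rw [← (EuclideanSpace.volume_preserving_symm_measurableEquiv_toLp (Fin m)).lintegral_comp
    (by fun_prop)]
  refine lintegral_congr fun v => ?_
  congr 1
  ext i
  refine Fin.cases ?_ (fun i => ?_) i <;> simp [MeasurableEquiv.piFinSuccAbove]

/-- The distribution of a linear coordinate on the sphere. -/
theorem lintegral_comp_inner_sphere {m : ℕ} (hm : 1 ≤ m) (x : Sph (m + 1)) {φ : ℝ → ENNReal}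
    (hφ : Measurable φ) :
    ∫⁻ z, φ (inner ℝ (x : EuclideanSpace ℝ (Fin (m + 1))) (z : EuclideanSpace ℝ (Fin (m + 1))))
      ∂(surf (m + 1)) =
    ENNReal.ofReal (area m) *
      ∫⁻ t in Icc (-1 : ℝ) 1, ENNReal.ofReal (weight (m + 1) t) * φ t := by
  set E := EuclideanSpace ℝ (Fin (m + 1))
  -- A radial cutoff turns the sphere integral into one over the whole space. Its radial integral
  -- `I` is finite and nonzero, so it can be cancelled at the end.
  set g : ℝ → ENNReal := (Iio (1 : ℝ)).indicator 1 with hg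
  have hgm : Measurable g := measurable_one.indicator measurableSet_Iio
  set I := ∫⁻ r in Ioi (0 : ℝ), ENNReal.ofReal (r ^ m) * g r with hI
  have hIv : I = ENNReal.ofReal (1 / (m + 1)) := by
    have : I = ∫⁻ r in Ioc (0 : ℝ) 1, ENNReal.ofReal (r ^ m) := by
      rw [setLIntegral_congr Ioo_ae_eq_Ioc.symm, hI, ← lintegral_indicator measurableSet_Ioi,
        ← lintegral_indicator measurableSet_Ioo]
      refine lintegral_congr fun r => ?_
      by_cases h0 : 0 < r <;> by_cases h1 : r < 1 <;> simp [hg, indicator, h0, h1]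
    rw [this, ← ofReal_integral_eq_lintegral_ofReal, ← intervalIntegral.integral_of_le zero_le_one]
    · simp
    · exact (intervalIntegral.intervalIntegrable_pow m).1
    · filter_upwards [ae_restrict_mem measurableSet_Ioc] with r hr
      exact pow_nonneg hr.1.le _
  have hI0 : I ≠ 0 := by
    rw [hIv]; simp; positivity
  have hIt : I ≠ ⊤ := by rw [hIv]; exact ENNReal.ofReal_ne_top
  have hx : ‖(x : E)‖ = 1 := by simp
  have hpol : ∫⁻ y : E, φ (inner ℝ (x : E) y / ‖y‖) * g ‖y‖ =
      (∫⁻ z, φ (inner ℝ (x : E) (z : E)) ∂(surf (m + 1))) * I := by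
    rw [lintegral_polar (by omega) (by fun_prop), ← lintegral_mul_const _ (by fun_prop)]
    refine lintegral_congr fun σ => ?_
    rw [hI, ← lintegral_const_mul _ (by fun_prop)]
    refine setLIntegral_congr_fun measurableSet_Ioi fun r hr => ?_
    have hr : 0 < r := hr
    have hσ : ‖(σ : E)‖ = 1 := by simp
    beta_reduce
    rw [norm_smul, hσ, mul_one, Real.norm_of_nonneg hr.le, inner_smul_right,
      mul_div_cancel_left₀ _ hr.ne', Nat.add_sub_cancel]
    ring
  -- Lebesgue measure is rotation invariant, so the pole may be taken to be the first basis vector.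
  obtain ⟨b, hb⟩ : ∃ b : OrthonormalBasis (Fin (m + 1)) ℝ E, b 0 = x := by
    obtain ⟨b, hb⟩ := Orthonormal.exists_orthonormalBasis_extension_of_card_eq (𝕜 := ℝ)
      (E := E) (ι := Fin (m + 1)) (by simp [E]) (v := fun _ => (x : E)) (s := {0})
      ⟨fun i => by simp [domRestrict, hx], fun i j hij => (hij (Subsingleton.elim _ _)).elim⟩
    exact ⟨b, hb 0 rfl⟩
  have hrot : ∫⁻ y : E, φ (inner ℝ (x : E) y / ‖y‖) * g ‖y‖ =
      ∫⁻ u : E, φ (u 0 / ‖u‖) * g ‖u‖ := by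
    rw [← b.measurePreserving_repr.lintegral_comp (f := fun u : E => φ (u 0 / ‖u‖) * g ‖u‖)
      (by fun_prop)]
    refine lintegral_congr fun y => ?_
    rw [LinearIsometryEquiv.norm_map, OrthonormalBasis.repr_apply_apply, hb]
  have hsplit : ∫⁻ u : E, φ (u 0 / ‖u‖) * g ‖u‖ =
      ENNReal.ofReal (area m) * (I * ∫⁻ t in Icc (-1 : ℝ) 1,
        ENNReal.ofReal (weight (m + 1) t) * φ t) := by
    rw [lintegral_euclideanSpace_succ (by fun_prop), hI, ← lintegral_halfplane_polar hm hφ hgm,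
      ← lintegral_const_mul']
    swap
    · exact ENNReal.ofReal_ne_top
    refine lintegral_congr fun s => ?_
    have hn : ∀ v : EuclideanSpace ℝ (Fin m),
        ‖(WithLp.toLp 2 (Fin.cons s v.ofLp : Fin (m + 1) → ℝ) : E)‖ = √(s ^ 2 + ‖v‖ ^ 2) := by
      intro v
      rw [EuclideanSpace.norm_eq, EuclideanSpace.norm_sq_eq, Fin.sum_univ_succ]
      simp
    simp only [hn]
    rw [lintegral_polar hm (by fun_prop)]
    rw [← surf_univ, mul_comm, ← lintegral_const]
    refine lintegral_congr fun σ => ?_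
    refine setLIntegral_congr_fun measurableSet_Ioi fun r hr => ?_
    have hr : 0 < r := hr
    have hσ : ‖(σ : EuclideanSpace ℝ (Fin m))‖ = 1 := by simp
    beta_reduce
    rw [norm_smul, hσ, mul_one, Real.norm_of_nonneg hr.le]
    simp
  rw [hrot, hsplit] at hpol
  have h2 : (∫⁻ z, φ (inner ℝ (x : E) (z : E)) ∂(surf (m + 1))) * I =
      (ENNReal.ofReal (area m) * ∫⁻ t in Icc (-1 : ℝ) 1,
        ENNReal.ofReal (weight (m + 1) t) * φ t) * I := by
    rw [← hpol]; ring
  exact (ENNReal.mul_left_inj hI0 hIt).1 h2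

end MultiDot

end

/-! ### Integrals of polynomials over the sphere -/

noncomputable section

namespace MultiDot

open Set Real MvPolynomial

theorem restrictSph_apply {n : ℕ} (p : MvPolynomial (Fin n) ℝ) (x : Sph n) :
    restrictSph n p x = eval (x : EuclideanSpace ℝ (Fin n)).ofLp p := rfl

theorem continuous_eval_ofLp {n : ℕ} (p : MvPolynomial (Fin n) ℝ) :
    Continuous fun y : EuclideanSpace ℝ (Fin n) => eval y.ofLp p :=
  (MvPolynomial.continuous_eval p).comp (PiLp.continuous_ofLp 2 _)

theorem continuous_restrictSph {n : ℕ} (p : MvPolynomial (Fin n) ℝ) :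
    Continuous (restrictSph n p) :=
  (continuous_eval_ofLp p).comp continuous_subtype_val

theorem integrable_of_continuous_sph {n : ℕ} {f : Sph n → ℝ} (hf : Continuous f) :
    Integrable f (surf n) :=
  hf.integrable_of_hasCompactSupport (HasCompactSupport.of_compactSpace f)

theorem integrable_restrictSph {n : ℕ} (p : MvPolynomial (Fin n) ℝ) :
    Integrable (restrictSph n p) (surf n) :=
  integrable_of_continuous_sph (continuous_restrictSph p)

/-- The integral of a polynomial over the sphere. -/
def sphInt (n : ℕ) : MvPolynomial (Fin n) ℝ →ₗ[ℝ] ℝ where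
  toFun p := ∫ x, restrictSph n p x ∂(surf n)
  map_add' p q := by
    simp only [map_add, Pi.add_apply]
    exact integral_add (integrable_restrictSph p) (integrable_restrictSph q)
  map_smul' c p := by
    simp only [map_smul, Pi.smul_apply, RingHom.id_apply]
    exact integral_smul c _

theorem sphInt_apply {n : ℕ} (p : MvPolynomial (Fin n) ℝ) :
    sphInt n p = ∫ x, restrictSph n p x ∂(surf n) := rfl

theorem eval_smul_of_isHomogeneous {n m : ℕ} {p : MvPolynomial (Fin n) ℝ} (hp : p.IsHomogeneous m)
    (r : ℝ) (y : Fin n → ℝ) : eval (r • y) p = r ^ m * eval y p := by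
  rw [eval_eq', eval_eq', Finset.mul_sum]
  refine Finset.sum_congr rfl fun a ha => ?_
  have hd : ∑ i, a i = m := by
    have := hp (mem_support_iff.1 ha)
    rw [Finsupp.weight_apply, Finsupp.sum_fintype _ _ (by simp)] at this
    simpa using this
  simp only [Pi.smul_apply, smul_eq_mul, mul_pow, Finset.prod_mul_distrib]
  rw [Finset.prod_pow_eq_pow_sum, hd]
  ring

/-- The integral of a homogeneous function times a radial one. -/
theorem integral_homogeneous_mul_radial {n : ℕ} (hn : 1 ≤ n) {m : ℕ}
    {p : MvPolynomial (Fin n) ℝ} (hp : p.IsHomogeneous m) (g : ℝ → ℝ) :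
    ∫ y : EuclideanSpace ℝ (Fin n), eval y.ofLp p * g ‖y‖ =
      sphInt n p * ∫ r in Ioi (0 : ℝ), r ^ (m + n - 1) * g r := by
  have : Nonempty (Fin n) := ⟨⟨0, hn⟩⟩
  let E := EuclideanSpace ℝ (Fin n)
  have hE : Module.finrank ℝ E = n := by simp [E]
  calc
    ∫ y : E, eval y.ofLp p * g ‖y‖
      = ∫ x : ({(0 : E)}ᶜ : Set E), eval (x : E).ofLp p * g ‖(x : E)‖ ∂((volume : Measure E).comap (↑)) := by
      rw [integral_subtype_comap (measurableSet_singleton _).compl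
        fun x : E => eval x.ofLp p * g (‖x‖), restrict_compl_singleton]
    _ = ∫ x : Metric.sphere (0 : E) 1 × Ioi (0 : ℝ), restrictSph n p x.1 * (x.2.1 ^ m * g x.2)
          ∂((volume : Measure E).toSphere.prod (.volumeIoiPow (Module.finrank ℝ E - 1))) := by
      rw [← (volume : Measure E).measurePreserving_homeomorphUnitSphereProd.integral_comp
        (Homeomorph.measurableEmbedding _)]
      refine integral_congr_ae (Filter.Eventually.of_forall fun x => ?_)
      have hx : (x : E).ofLp = ‖(x : E)‖ •
          (((homeomorphUnitSphereProd E x).1 : E)).ofLp := by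
        have h : (x : E) ≠ 0 := x.2
        have h0 : ‖(x : E)‖ ≠ 0 := norm_ne_zero_iff.2 h
        ext i
        simp only [Pi.smul_apply, smul_eq_mul, homeomorphUnitSphereProd_apply_fst_coe]
        exact (mul_inv_cancel_left₀ h0 _).symm
      have h2 : ((homeomorphUnitSphereProd E x).2 : ℝ) = ‖(x : E)‖ := by simp
      beta_reduce
      rw [restrictSph_apply, h2]
      conv_lhs => rw [hx, eval_smul_of_isHomogeneous hp]
      ring
    _ = sphInt n p * ∫ x : Ioi (0 : ℝ), (x.1 ^ m * g x) ∂.volumeIoiPow (Module.finrank ℝ E - 1) :=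
      integral_prod_mul (restrictSph n p) (fun r : Ioi (0 : ℝ) => r.1 ^ m * g r)
    _ = _ := by
      rw [hE]
      congr 1
      simp only [Measure.volumeIoiPow, ENNReal.ofReal]
      rw [integral_withDensity_eq_integral_smul,
        integral_subtype_comap measurableSet_Ioi
          fun a ↦ Real.toNNReal (a ^ (n - 1)) • (a ^ m * g a),
        setIntegral_congr_fun measurableSet_Ioi fun x hx ↦ ?_]
      · rw [NNReal.smul_def, Real.coe_toNNReal _ (pow_nonneg hx.out.le _), smul_eq_mul, ← mul_assoc,
          ← pow_add]
        congr 2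
        omega
      · exact (measurable_subtype_coe.pow_const _).real_toNNReal

theorem integral_pow_mul_exp_neg_sq (a : ℕ) :
    ∫ r in Ioi (0 : ℝ), r ^ a * exp (-r ^ 2) = 1 / 2 * Gamma ((a + 1) / 2) := by
  have := integral_rpow_mul_exp_neg_rpow (p := 2) (q := a) (by norm_num)
    (by have : (0 : ℝ) ≤ a := a.cast_nonneg
        linarith)
  rw [← this]
  refine setIntegral_congr_fun measurableSet_Ioi fun x _ => ?_
  simp

theorem integrable_eval_mul_exp_neg_sq {n : ℕ} (p : MvPolynomial (Fin n) ℝ) :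
    Integrable fun y : EuclideanSpace ℝ (Fin n) => eval y.ofLp p * exp (-‖y‖ ^ 2) := by
  induction p using MvPolynomial.induction_on' with
  | add p q hp hq =>
    simp only [map_add, add_mul]
    exact hp.add hq
  | monomial a c =>
    have h1 : Integrable (fun y : Fin n → ℝ => ∏ i, (y i ^ a i * exp (-y i ^ 2))) := by
      refine Integrable.fintype_prod (f := fun i t => t ^ a i * exp (-t ^ 2)) fun i => ?_
      have := integrable_rpow_mul_exp_neg_mul_sq (b := 1) one_pos (s := a i)
        (by have : (0 : ℝ) ≤ a i := (a i).cast_nonneg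
            linarith)
      simpa using this
    have h2 := ((EuclideanSpace.volume_preserving_symm_measurableEquiv_toLp
      (Fin n)).integrable_comp_emb (MeasurableEquiv.measurableEmbedding _)).2 h1
    refine (h2.const_mul c).congr (Filter.Eventually.of_forall fun y => ?_)
    simp only [Function.comp_apply, eval_monomial]
    rw [Finsupp.prod_fintype _ _ (by simp), Finset.prod_mul_distrib, ← Real.exp_sum,
      Finset.sum_neg_distrib, EuclideanSpace.norm_sq_eq]
    simp [mul_assoc]

theorem hasFDerivAt_eval {n : ℕ} (p : MvPolynomial (Fin n) ℝ) (y : EuclideanSpace ℝ (Fin n)) :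
    HasFDerivAt (fun y : EuclideanSpace ℝ (Fin n) => eval y.ofLp p)
      (∑ i, eval y.ofLp (pderiv i p) • (EuclideanSpace.proj i : EuclideanSpace ℝ (Fin n) →L[ℝ] ℝ))
      y := by
  induction p using MvPolynomial.induction_on with
  | C a => simpa using hasFDerivAt_const a y
  | add p q hp hq =>
    simpa [add_smul, Finset.sum_add_distrib] using hp.fun_add hq
  | mul_X p j hp =>
    have hX : HasFDerivAt (fun y : EuclideanSpace ℝ (Fin n) => y.ofLp j)
        (EuclideanSpace.proj j : EuclideanSpace ℝ (Fin n) →L[ℝ] ℝ) y :=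
      (EuclideanSpace.proj j : EuclideanSpace ℝ (Fin n) →L[ℝ] ℝ).hasFDerivAt
    simp only [map_mul, eval_X]
    refine (hp.fun_mul hX).congr_fderiv ?_
    ext v
    simp [pderiv_X, Finset.sum_add_distrib, add_mul, Pi.single_apply, Finset.mul_sum, mul_ite,
      apply_ite (eval y.ofLp), ite_mul]
    refine Finset.sum_congr rfl fun i _ => ?_
    ring

theorem fderiv_eval_single {n : ℕ} (p : MvPolynomial (Fin n) ℝ) (y : EuclideanSpace ℝ (Fin n))
    (i : Fin n) :
    fderiv ℝ (fun y : EuclideanSpace ℝ (Fin n) => eval y.ofLp p) y (EuclideanSpace.single i 1) =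
      eval y.ofLp (pderiv i p) := by
  rw [(hasFDerivAt_eval p y).fderiv]
  simp

/-- The i-th derivative of the Gaussian is -2 y_i times the Gaussian, and integrability of all
products leaves no boundary term. -/
theorem integral_gaussian_pderiv {n : ℕ} (p : MvPolynomial (Fin n) ℝ) (i : Fin n) :
    ∫ y : EuclideanSpace ℝ (Fin n), eval y.ofLp (pderiv i p) * exp (-‖y‖ ^ 2) =
      2 * ∫ y : EuclideanSpace ℝ (Fin n), eval y.ofLp (X i * p) * exp (-‖y‖ ^ 2) := by
  have hg : ∀ y : EuclideanSpace ℝ (Fin n), HasFDerivAt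
      (fun y : EuclideanSpace ℝ (Fin n) => exp (-‖y‖ ^ 2))
      (exp (-‖y‖ ^ 2) • -(2 • innerSL ℝ y : EuclideanSpace ℝ (Fin n) →L[ℝ] ℝ)) y := fun y =>
    (hasStrictFDerivAt_norm_sq y).hasFDerivAt.fun_neg.exp
  have hgd : ∀ y : EuclideanSpace ℝ (Fin n), fderiv ℝ
      (fun y : EuclideanSpace ℝ (Fin n) => exp (-‖y‖ ^ 2)) y (EuclideanSpace.single i 1) =
      -2 * (y i * exp (-‖y‖ ^ 2)) := by
    intro y
    rw [(hg y).fderiv]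
    simp [EuclideanSpace.inner_single_right]
    ring
  have h := integral_mul_fderiv_eq_neg_fderiv_mul_of_integrable (μ := volume)
    (f := fun y : EuclideanSpace ℝ (Fin n) => eval y.ofLp p)
    (g := fun y : EuclideanSpace ℝ (Fin n) => exp (-‖y‖ ^ 2))
    (v := EuclideanSpace.single i 1) ?_ ?_ ?_
    (fun y _ => (hasFDerivAt_eval p y).differentiableAt) (fun y _ => (hg y).differentiableAt)
  · simp only [hgd, fderiv_eval_single] at h
    rw [← neg_eq_iff_eq_neg] at h
    rw [← h, ← integral_neg, ← integral_const_mul]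
    refine integral_congr_ae (Filter.Eventually.of_forall fun y => ?_)
    simp
    ring
  · simp only [fderiv_eval_single]
    exact integrable_eval_mul_exp_neg_sq _
  · simp only [hgd]
    refine ((integrable_eval_mul_exp_neg_sq (X i * p)).const_mul (-2)).congr
      (Filter.Eventually.of_forall fun y => ?_)
    simp
    ring
  · exact integrable_eval_mul_exp_neg_sq _

/-- Integration by parts on the sphere. -/
theorem sphInt_pderiv {n : ℕ} (hn : 1 ≤ n) {m : ℕ} {p : MvPolynomial (Fin n) ℝ}
    (hp : p.IsHomogeneous m) (i : Fin n) :
    sphInt n (pderiv i p) = ((m : ℝ) + n - 1) * sphInt n (X i * p) := by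
  -- Both Gaussian integrals factor into a sphere integral and a Gamma value; the arguments differ
  -- by 1, which produces the factor (m + n - 1) / 2.
  have h := integral_gaussian_pderiv p i
  have hXp : (X i * p).IsHomogeneous (1 + m) := (isHomogeneous_X ℝ i).mul hp
  rw [integral_homogeneous_mul_radial hn hp.pderiv (fun r => exp (-r ^ 2)),
    integral_homogeneous_mul_radial hn hXp (fun r => exp (-r ^ 2)),
    integral_pow_mul_exp_neg_sq, integral_pow_mul_exp_neg_sq] at h
  -- For m = 0 the truncated degree m - 1 gives a wrong Gamma argument. There the derivative is
  -- zero, and the positive Gamma factor forces the other integral to vanish too.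
  rcases Nat.eq_zero_or_pos m with rfl | hm
  · have h0 : pderiv i p = 0 := by
      rw [← totalDegree_zero_iff_isHomogeneous, totalDegree_eq_zero_iff_eq_C] at hp
      rw [hp, pderiv_C]
    rw [h0] at h ⊢
    have hΓ : 0 < Gamma (((1 + 0 + n - 1 : ℕ) + 1 : ℝ) / 2) := Gamma_pos_of_pos (by positivity)
    simp only [map_zero, zero_mul] at h ⊢
    have : sphInt n (X i * p) = 0 := by
      by_contra hne
      have : 2 * (sphInt n (X i * p) * (1 / 2 * Gamma (((1 + 0 + n - 1 : ℕ) + 1 : ℝ) / 2))) ≠ 0 := by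
        positivity
      exact this h.symm
    rw [this, mul_zero]
  · have hpos : 0 < ((m : ℝ) + n - 1) / 2 := by
      have : (1 : ℝ) ≤ m := by exact_mod_cast hm
      have : (1 : ℝ) ≤ n := by exact_mod_cast hn
      linarith
    have e1 : ((m - 1 + n - 1 : ℕ) + 1 : ℝ) / 2 = ((m : ℝ) + n - 1) / 2 := by
      have : ((m - 1 + n - 1 : ℕ) : ℝ) = m + n - 2 := by
        rw [Nat.cast_sub (by omega), Nat.cast_add, Nat.cast_sub hm]; push_cast; ring
      rw [this]; ring
    have e2 : ((1 + m + n - 1 : ℕ) + 1 : ℝ) / 2 = ((m : ℝ) + n - 1) / 2 + 1 := by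
      have : ((1 + m + n - 1 : ℕ) : ℝ) = m + n := by
        rw [Nat.cast_sub (by omega)]; push_cast; ring
      rw [this]; ring
    rw [e1, e2, Gamma_add_one hpos.ne'] at h
    have hΓ : 0 < Gamma (((m : ℝ) + n - 1) / 2) := Gamma_pos_of_pos hpos
    have h' : sphInt n (pderiv i p) * (1 / 2 * Gamma (((m : ℝ) + n - 1) / 2)) =
        (((m : ℝ) + n - 1) * sphInt n (X i * p)) * (1 / 2 * Gamma (((m : ℝ) + n - 1) / 2)) := by
      rw [h]; ring
    exact mul_right_cancel₀ (by positivity) h'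

end MultiDot

end

/-! ### The Laplacian and harmonic homogeneous polynomials -/

noncomputable section

namespace MultiDot

open MvPolynomial

variable {n : ℕ}

/-- The commutator of two derivations is a derivation, and this one vanishes on the variables. -/
theorem pderiv_pderiv_comm (i j : Fin n) (p : MvPolynomial (Fin n) ℝ) :
    pderiv i (pderiv j p) = pderiv j (pderiv i p) := by
  have h : ⁅(pderiv i : Derivation ℝ (MvPolynomial (Fin n) ℝ) (MvPolynomial (Fin n) ℝ)),
      (pderiv j : Derivation ℝ (MvPolynomial (Fin n) ℝ) (MvPolynomial (Fin n) ℝ))⁆ = 0 := by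
    refine MvPolynomial.derivation_ext fun k => ?_
    rw [Derivation.commutator_apply]
    have hc : ∀ a b : Fin n, pderiv a (pderiv b (X k : MvPolynomial (Fin n) ℝ)) = 0 := fun a b => by
      rw [pderiv_X, Pi.single_apply]
      split_ifs <;> simp
    rw [hc, hc, sub_zero, Derivation.zero_apply]
  have := congrArg (fun D => D p) h
  simpa [Derivation.commutator_apply, sub_eq_zero] using this

theorem polyLaplacian_apply (p : MvPolynomial (Fin n) ℝ) :
    polyLaplacian n p = ∑ i, pderiv i (pderiv i p) := by
  simp [polyLaplacian, LinearMap.sum_apply]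

theorem polyLaplacian_mul (p q : MvPolynomial (Fin n) ℝ) :
    polyLaplacian n (p * q) =
      p * polyLaplacian n q + 2 * ∑ i, pderiv i p * pderiv i q + q * polyLaplacian n p := by
  simp only [polyLaplacian_apply, pderiv_mul, map_add, Finset.mul_sum, ← Finset.sum_add_distrib]
  refine Finset.sum_congr rfl fun i _ => ?_
  ring

theorem polyLaplacian_pderiv (i : Fin n) (p : MvPolynomial (Fin n) ℝ) :
    polyLaplacian n (pderiv i p) = pderiv i (polyLaplacian n p) := by
  simp only [polyLaplacian_apply, map_sum]
  refine Finset.sum_congr rfl fun j _ => ?_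
  rw [pderiv_pderiv_comm j i, pderiv_pderiv_comm j i]

/-- Harmonic homogeneous polynomials of degree `k`. -/
def IsSolid (k : ℕ) (h : MvPolynomial (Fin n) ℝ) : Prop :=
  h.IsHomogeneous k ∧ polyLaplacian n h = 0

theorem IsSolid.pderiv {k : ℕ} {h : MvPolynomial (Fin n) ℝ} (hh : IsSolid k h) (i : Fin n) :
    IsSolid (k - 1) (pderiv i h) :=
  ⟨hh.1.pderiv, by rw [polyLaplacian_pderiv, hh.2, map_zero]⟩

theorem mem_sphHarm {k : ℕ} {f : Sph n → ℝ} :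
    f ∈ sphHarm n k ↔ ∃ h, IsSolid k h ∧ restrictSph n h = f := by
  simp [sphHarm, IsSolid]

/-- The linear form `⟨x, ·⟩`. -/
def linForm (x : Fin n → ℝ) : MvPolynomial (Fin n) ℝ := ∑ i, C (x i) * X i

/-- The polynomial `|z|²`. -/
def normSqPoly (n : ℕ) : MvPolynomial (Fin n) ℝ := ∑ i, X i ^ 2

/-- The directional derivative along `x`. -/
def dirDeriv (x : Fin n → ℝ) : Derivation ℝ (MvPolynomial (Fin n) ℝ) (MvPolynomial (Fin n) ℝ) :=
  ∑ i, x i • pderiv i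

theorem dirDeriv_apply (x : Fin n → ℝ) (p : MvPolynomial (Fin n) ℝ) :
    dirDeriv x p = ∑ i, C (x i) * pderiv i p := by
  have h : ∀ s : Finset (Fin n), (∑ i ∈ s, x i • pderiv i :
      Derivation ℝ (MvPolynomial (Fin n) ℝ) (MvPolynomial (Fin n) ℝ)) p =
      ∑ i ∈ s, C (x i) * pderiv i p := by
    intro s
    induction s using Finset.cons_induction with
    | empty => simp
    | cons a s ha ih =>
      rw [Finset.sum_cons, Finset.sum_cons, Derivation.add_apply, ih, Derivation.smul_apply,
        smul_eq_C_mul]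
  exact h _

theorem isHomogeneous_linForm (x : Fin n → ℝ) : (linForm x).IsHomogeneous 1 :=
  IsHomogeneous.sum _ _ _ fun _ _ => isHomogeneous_C_mul_X _ _

theorem isHomogeneous_normSqPoly : (normSqPoly n).IsHomogeneous 2 :=
  IsHomogeneous.sum _ _ _ fun _ _ => isHomogeneous_X_pow _ _

theorem pderiv_linForm (x : Fin n → ℝ) (i : Fin n) : pderiv i (linForm x) = C (x i) := by
  simp [linForm, pderiv_X, Pi.single_apply]

theorem pderiv_normSqPoly (i : Fin n) : pderiv i (normSqPoly n) = 2 * X i := by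
  simp [normSqPoly, pderiv_X, Pi.single_apply]

theorem polyLaplacian_linForm_mul (x : Fin n → ℝ) (p : MvPolynomial (Fin n) ℝ) :
    polyLaplacian n (linForm x * p) = linForm x * polyLaplacian n p + 2 * dirDeriv x p := by
  rw [polyLaplacian_mul, dirDeriv_apply]
  simp [pderiv_linForm, polyLaplacian_apply (linForm x)]

/-- The Laplacian of |z|² is 2n, and by Euler's identity the cross term 2 ∑ 2 X_i ∂_i p equals 4k p.
-/
theorem polyLaplacian_normSqPoly_mul {k : ℕ} {p : MvPolynomial (Fin n) ℝ}
    (hp : p.IsHomogeneous k) :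
    polyLaplacian n (normSqPoly n * p) =
      normSqPoly n * polyLaplacian n p + C (2 * n + 4 * k : ℝ) * p := by
  have h2 : ∀ i : Fin n, pderiv i (2 * X i : MvPolynomial (Fin n) ℝ) = 2 := fun i => by
    have : (2 : MvPolynomial (Fin n) ℝ) = C 2 := rfl
    rw [this, pderiv_C_mul]; simp
  rw [polyLaplacian_mul, polyLaplacian_apply (normSqPoly n)]
  simp only [pderiv_normSqPoly, h2, mul_assoc, ← Finset.mul_sum, hp.sum_X_mul_pderiv]
  simp only [Finset.sum_const, Finset.card_univ, Fintype.card_fin, nsmul_eq_mul, map_add, map_mul,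
    map_natCast, map_ofNat]
  ring

theorem dirDeriv_linForm (x : Fin n → ℝ) : dirDeriv x (linForm x) = C (∑ i, x i ^ 2) := by
  simp [dirDeriv_apply, pderiv_linForm, sq]

theorem dirDeriv_normSqPoly (x : Fin n → ℝ) : dirDeriv x (normSqPoly n) = 2 * linForm x := by
  simp only [dirDeriv_apply, pderiv_normSqPoly, linForm, Finset.mul_sum]
  exact Finset.sum_congr rfl fun i _ => by ring

theorem IsSolid.dirDeriv {k : ℕ} {h : MvPolynomial (Fin n) ℝ} (hh : IsSolid k h)
    (x : Fin n → ℝ) : IsSolid (k - 1) (dirDeriv x h) := by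
  rw [dirDeriv_apply]
  refine ⟨IsHomogeneous.sum _ _ _ fun i _ => (hh.pderiv i).1.C_mul _, ?_⟩
  rw [map_sum]
  refine Finset.sum_eq_zero fun i _ => ?_
  rw [← smul_eq_C_mul, map_smul, (hh.pderiv i).2, smul_zero]

theorem eval_dirDeriv_self {k : ℕ} {h : MvPolynomial (Fin n) ℝ} (hh : h.IsHomogeneous k)
    (x : Fin n → ℝ) : eval x (dirDeriv x h) = k * eval x h := by
  have := congrArg (eval x) hh.sum_X_mul_pderiv
  simpa [dirDeriv_apply] using this

theorem sum_sq_sph (x : Sph n) : ∑ i, (x : EuclideanSpace ℝ (Fin n)).ofLp i ^ 2 = 1 := by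
  have h : ‖(x : EuclideanSpace ℝ (Fin n))‖ = 1 := by simp
  have := EuclideanSpace.norm_sq_eq (x : EuclideanSpace ℝ (Fin n))
  rw [h] at this
  simpa using this.symm

theorem restrictSph_normSqPoly_mul (p : MvPolynomial (Fin n) ℝ) :
    restrictSph n (normSqPoly n * p) = restrictSph n p := by
  ext x
  simp [restrictSph_apply, normSqPoly, sum_sq_sph]

theorem eval_linForm (x z : EuclideanSpace ℝ (Fin n)) :
    eval z.ofLp (linForm x.ofLp) = inner ℝ x z := by
  simp [linForm, PiLp.inner_apply, mul_comm]

/-! ### Integrals of harmonic polynomials -/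

/-- Integrating Δh = ∑ ∂_i ∂_i h by parts and applying Euler's identity gives 0 = (k + n - 2) k ∫ h,
where both factors are nonzero. -/
theorem sphInt_solid (hn : 2 ≤ n) {k : ℕ} (hk : 1 ≤ k) {h : MvPolynomial (Fin n) ℝ}
    (hh : IsSolid k h) : sphInt n h = 0 := by
  have h1 := congrArg (sphInt n) hh.1.sum_X_mul_pderiv
  have h2 : ∀ i, sphInt n (pderiv i (pderiv i h)) =
      (((k - 1 : ℕ) : ℝ) + n - 1) * sphInt n (X i * pderiv i h) := fun i =>
    sphInt_pderiv (by omega) hh.1.pderiv i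
  have h3 := congrArg (sphInt n) hh.2
  rw [polyLaplacian_apply, map_sum, map_zero, Finset.sum_congr rfl fun i _ => h2 i,
    ← Finset.mul_sum, ← map_sum, h1] at h3
  have hn' : (2 : ℝ) ≤ n := by exact_mod_cast hn
  have hk' : (1 : ℝ) ≤ k := by exact_mod_cast hk
  rw [Nat.cast_sub hk] at h3
  rcases mul_eq_zero.1 h3 with h4 | h4
  · push_cast at h4; linarith
  · rw [map_nsmul, nsmul_eq_mul] at h4
    rcases mul_eq_zero.1 h4 with h5 | h5
    · linarith
    · exact h5

/-- A harmonic homogeneous polynomial is orthogonal on the sphere to all homogeneous polynomials of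
smaller degree. -/
theorem sphInt_mul_solid_of_lt (hn : 2 ≤ n) {m k : ℕ} (hmk : m < k)
    {p h : MvPolynomial (Fin n) ℝ} (hp : p.IsHomogeneous m) (hh : IsSolid k h) :
    sphInt n (p * h) = 0 := by
  induction m using Nat.strong_induction_on generalizing k p h with
  | _ m ih =>
    rcases Nat.eq_zero_or_pos m with rfl | hm
    · rw [← totalDegree_zero_iff_isHomogeneous, totalDegree_eq_zero_iff_eq_C] at hp
      rw [hp, ← smul_eq_C_mul, map_smul, sphInt_solid hn hmk hh, smul_zero]
    · have h1 := congrArg (fun q => sphInt n (q * h)) hp.sum_X_mul_pderiv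
      simp only [Finset.sum_mul, map_sum] at h1
      have h2 : ∀ i, sphInt n (X i * pderiv i p * h) = 0 := by
        intro i
        -- By Euler, m p is the sum of the X_i ∂_i p, so it suffices to treat one summand. The
        -- derivative of ∂_i p · h pairs degrees m - 2 with k and m - 1 with k - 1; both gaps stay
        -- strict, so the induction hypothesis removes both terms.
        have h3 := sphInt_pderiv (by omega) ((hp.pderiv (i := i)).mul hh.1) i
        rw [pderiv_mul, map_add, ih (m - 1 - 1) (by omega) (by omega) hp.pderiv.pderiv hh,
          ih (m - 1) (by omega) (by omega) hp.pderiv (hh.pderiv i), add_zero] at h3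
        have hn' : (2 : ℝ) ≤ n := by exact_mod_cast hn
        have hpos : (0 : ℝ) ≤ ((m - 1 + k : ℕ) : ℝ) := Nat.cast_nonneg _
        rw [mul_assoc]
        rcases mul_eq_zero.1 h3.symm with h4 | h4
        · linarith
        · exact h4
      rw [Finset.sum_eq_zero fun i _ => h2 i, nsmul_eq_mul, mul_assoc,
        ← nsmul_eq_mul, map_nsmul, nsmul_eq_mul] at h1
      rcases mul_eq_zero.1 h1.symm with h4 | h4
      · have : (m : ℝ) ≠ 0 := by positivity
        exact absurd h4 this
      · exact h4

theorem sphInt_solid_mul_solid (hn : 2 ≤ n) {k l : ℕ} (hkl : k ≠ l)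
    {p h : MvPolynomial (Fin n) ℝ} (hp : IsSolid k p) (hh : IsSolid l h) :
    sphInt n (p * h) = 0 := by
  rcases lt_or_gt_of_ne hkl with h1 | h1
  · exact sphInt_mul_solid_of_lt hn h1 hp.1 hh
  · rw [mul_comm]
    exact sphInt_mul_solid_of_lt hn h1 hh.1 hp

/-- The Funk–Hecke formula for powers. -/
theorem exists_sphInt_linForm_pow_mul (hn : 2 ≤ n) (m k : ℕ) :
    ∃ A : ℝ, ∀ h : MvPolynomial (Fin n) ℝ, IsSolid k h → ∀ x : Sph n,
      sphInt n (linForm (x : EuclideanSpace ℝ (Fin n)).ofLp ^ m * h) = A * restrictSph n h x := by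
  induction m using Nat.strong_induction_on generalizing k with
  | _ m ih =>
    rcases m with _ | m
    · rcases k with _ | k
      · refine ⟨area n, fun h hh x => ?_⟩
        have hp := hh.1
        rw [← totalDegree_zero_iff_isHomogeneous, totalDegree_eq_zero_iff_eq_C] at hp
        rw [hp, pow_zero, one_mul]
        simp [sphInt_apply, restrictSph_apply, area]
      · refine ⟨0, fun h hh x => ?_⟩
        rw [pow_zero, one_mul, sphInt_solid hn (by omega) hh, zero_mul]
    -- The integral of the derivative of ⟨x,·⟩^m h along x is computed twice. Integration by parts
    -- gives (m + k + n - 1) times the wanted integral. The product rule, with |x| = 1, gives m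
    -- ⟨x,·⟩^(m-1) h plus ⟨x,·⟩^m D_x h, where D_x h has degree k - 1 and takes the value k h(x) at
    -- x. The factors m and k absorb the truncated subtractions.
    · obtain ⟨A₁, hA₁⟩ := ih (m - 1) (by omega) k
      obtain ⟨A₂, hA₂⟩ := ih m (by omega) (k - 1)
      refine ⟨(m * A₁ + k * A₂) / ((m + k : ℕ) + n - 1), fun h hh x => ?_⟩
      set y := (x : EuclideanSpace ℝ (Fin n)).ofLp with hy
      have hpos : (0 : ℝ) < (m + k : ℕ) + n - 1 := by
        have hn' : (2 : ℝ) ≤ n := by exact_mod_cast hn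
        have : (0 : ℝ) ≤ ((m + k : ℕ) : ℝ) := Nat.cast_nonneg _
        linarith
      have hom : (linForm y ^ m * h).IsHomogeneous (m + k) := by
        simpa using ((isHomogeneous_linForm y).pow m).mul hh.1
      have h1 : sphInt n (dirDeriv y (linForm y ^ m * h)) =
          ((m + k : ℕ) + n - 1) * sphInt n (linForm y ^ (m + 1) * h) := by
        rw [dirDeriv_apply, map_sum, pow_succ', mul_assoc]
        nth_rewrite 2 [linForm]
        rw [Finset.sum_mul, map_sum, Finset.mul_sum]
        refine Finset.sum_congr rfl fun i _ => ?_
        rw [← smul_eq_C_mul, map_smul, sphInt_pderiv (by omega) hom, mul_assoc, ← smul_eq_C_mul,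
          map_smul, smul_eq_mul, smul_eq_mul]
        ring
      have h2 : sphInt n (dirDeriv y (linForm y ^ m * h)) =
          (m * A₁ + k * A₂) * restrictSph n h x := by
        rw [Derivation.leibniz, Derivation.leibniz_pow, dirDeriv_linForm, hy, sum_sq_sph x, ← hy]
        simp only [smul_eq_mul, map_one, mul_one, map_add]
        rw [hA₂ _ (hh.dirDeriv y) x, restrictSph_apply (dirDeriv y h), eval_dirDeriv_self hh.1,
          mul_smul_comm, map_nsmul, mul_comm h, hA₁ h hh x, ← restrictSph_apply, nsmul_eq_mul]
        ring
      rw [h2] at h1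
      field_simp
      linarith

/-- The Funk–Hecke formula for polynomials. -/
theorem exists_sphInt_aeval_linForm_mul (hn : 2 ≤ n) (φ : Polynomial ℝ) (k : ℕ) :
    ∃ A : ℝ, ∀ h : MvPolynomial (Fin n) ℝ, IsSolid k h → ∀ x : Sph n,
      sphInt n (Polynomial.aeval (linForm (x : EuclideanSpace ℝ (Fin n)).ofLp) φ * h) =
        A * restrictSph n h x := by
  induction φ using Polynomial.induction_on' with
  | add p q hp hq =>
    obtain ⟨A, hA⟩ := hp
    obtain ⟨B, hB⟩ := hq
    refine ⟨A + B, fun h hh x => ?_⟩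
    rw [map_add, add_mul, map_add, hA h hh, hB h hh, add_mul]
  | monomial m c =>
    obtain ⟨A, hA⟩ := exists_sphInt_linForm_pow_mul hn m k
    refine ⟨c * A, fun h hh x => ?_⟩
    rw [Polynomial.aeval_monomial, mul_assoc, algebraMap_eq, ← smul_eq_C_mul, map_smul, hA h hh,
      smul_eq_mul, mul_assoc]

/-! ### Zonal harmonics -/

/-- The zonal solid harmonic with pole `x`, by the Gegenbauer recurrence. -/
def zonal (x : Fin n → ℝ) : ℕ → MvPolynomial (Fin n) ℝ
  | 0 => 1
  | 1 => linForm x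
  | k + 2 =>
      C (((k : ℝ) + n - 1)⁻¹) *
        (C (2 * (k : ℝ) + n) * linForm x * zonal x (k + 1)
          - C ((k : ℝ) + 1) * normSqPoly n * zonal x k)

/-- On the sphere |z|² = 1, so the homogenized recurrence collapses to the Gegenbauer one. -/
theorem restrictSph_zonal (x z : Sph n) (k : ℕ) :
    restrictSph n (zonal (x : EuclideanSpace ℝ (Fin n)).ofLp k) z =
      (gegenbauer n k).eval
        (inner ℝ (x : EuclideanSpace ℝ (Fin n)) (z : EuclideanSpace ℝ (Fin n))) := by
  induction k using Nat.twoStepInduction with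
  | zero => simp [restrictSph_apply, zonal, gegenbauer]
  | one => simp [restrictSph_apply, zonal, gegenbauer, eval_linForm]
  | more k h1 h2 =>
    rw [restrictSph_apply] at h1 h2
    have h3 : eval (z : EuclideanSpace ℝ (Fin n)).ofLp (normSqPoly n) = 1 := by
      simp [normSqPoly, sum_sq_sph]
    simp [restrictSph_apply, zonal, gegenbauer, h1, h2, h3, eval_linForm]

theorem isHomogeneous_zonal (x : Fin n → ℝ) (k : ℕ) : (zonal x k).IsHomogeneous k := by
  induction k using Nat.twoStepInduction with
  | zero => exact isHomogeneous_one _ _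
  | one => exact isHomogeneous_linForm x
  | more k h1 h2 =>
    rw [zonal]
    refine IsHomogeneous.C_mul (IsHomogeneous.sub ?_ ?_) _
    · have := ((isHomogeneous_linForm x).C_mul (2 * (k : ℝ) + n)).mul h2
      rwa [show 1 + (k + 1) = k + 2 by ring] at this
    · have := ((isHomogeneous_normSqPoly (n := n)).C_mul ((k : ℝ) + 1)).mul h1
      rwa [show 2 + k = k + 2 by ring] at this

theorem zonal_recurrence (hn : 2 ≤ n) (x : Fin n → ℝ) (k : ℕ) :
    C ((k : ℝ) + n - 1) * zonal x (k + 2) = C (2 * (k : ℝ) + n) * linForm x * zonal x (k + 1)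
          - C ((k : ℝ) + 1) * normSqPoly n * zonal x k := by
  have hpos : (k : ℝ) + n - 1 ≠ 0 := by
    have hn' : (2 : ℝ) ≤ n := by exact_mod_cast hn
    have : (0 : ℝ) ≤ k := k.cast_nonneg
    linarith
  rw [zonal, ← mul_assoc, ← C_mul, mul_inv_cancel₀ hpos, C_1, one_mul]

theorem C_mul_cancel {c : ℝ} (hc : c ≠ 0) {p q : MvPolynomial (Fin n) ℝ}
    (h : C c * p = C c * q) : p = q :=
  mul_left_cancel₀ (by simpa using hc) h

/-- Differentiating the recurrence along the pole and inserting the two previous cases leaves a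
multiple of the recurrence itself. This identity is what evaluates the cross term in the Laplacian
of the zonal polynomials. -/
theorem dirDeriv_zonal (hn : 2 ≤ n) {x : Fin n → ℝ} (hx : ∑ i, x i ^ 2 = 1) (k : ℕ) :
    dirDeriv x (zonal x (k + 1)) = C ((k : ℝ) + 1) * zonal x k := by
  have hpos : ∀ k : ℕ, (k : ℝ) + n - 1 ≠ 0 := fun k => by
    have hn' : (2 : ℝ) ≤ n := by exact_mod_cast hn
    have : (0 : ℝ) ≤ k := k.cast_nonneg
    linarith
  have hC : ∀ (c : ℝ) (p : MvPolynomial (Fin n) ℝ), dirDeriv x (C c * p) = C c * dirDeriv x p := by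
    intro c p
    rw [← smul_eq_C_mul, Derivation.map_smul, smul_eq_C_mul]
  induction k using Nat.strong_induction_on with
  | _ k ih =>
    rcases k with _ | k
    · simp [zonal, dirDeriv_linForm, hx]
    · refine C_mul_cancel (hpos k) ?_
      rw [← hC, zonal_recurrence hn, map_sub, mul_assoc, mul_assoc, hC, hC, Derivation.leibniz,
        Derivation.leibniz, dirDeriv_linForm, dirDeriv_normSqPoly, hx, ih k (by omega)]
      rcases k with _ | k
      · simp only [zonal, smul_eq_mul, Derivation.map_one_eq_zero]
        simp
        ring
      · rw [ih k (by omega)]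
        have h := zonal_recurrence hn x k
        simp only [smul_eq_mul, map_add, map_sub, map_mul, map_one, map_natCast, Nat.cast_add,
          Nat.cast_one, map_ofNat] at h ⊢
        linear_combination -((k : MvPolynomial (Fin n) ℝ) + 2) * h

/-- In the Laplacian of the recurrence, ⟨x,·⟩ Z_{k+1} contributes 2(k+1) Z_k and |z|² Z_k
contributes (2n + 4k) Z_k. With the coefficients 2k + n and -(k + 1) these cancel. -/
theorem isSolid_zonal (hn : 2 ≤ n) {x : Fin n → ℝ} (hx : ∑ i, x i ^ 2 = 1) (k : ℕ) :
    IsSolid k (zonal x k) := by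
  refine ⟨isHomogeneous_zonal x k, ?_⟩
  have hpos : ∀ k : ℕ, (k : ℝ) + n - 1 ≠ 0 := fun k => by
    have hn' : (2 : ℝ) ≤ n := by exact_mod_cast hn
    have : (0 : ℝ) ≤ k := k.cast_nonneg
    linarith
  have hC : ∀ (c : ℝ) (p : MvPolynomial (Fin n) ℝ),
      polyLaplacian n (C c * p) = C c * polyLaplacian n p := by
    intro c p
    rw [← smul_eq_C_mul, map_smul, smul_eq_C_mul]
  induction k using Nat.twoStepInduction with
  | zero => simp [zonal, polyLaplacian_apply]
  | one => simp [zonal, polyLaplacian_apply, pderiv_linForm]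
  | more k h1 h2 =>
    refine C_mul_cancel (hpos k) ?_
    rw [← hC, zonal_recurrence hn, map_sub, mul_assoc, mul_assoc, hC, hC,
      polyLaplacian_linForm_mul, polyLaplacian_normSqPoly_mul (isHomogeneous_zonal x k), h1, h2,
      dirDeriv_zonal hn hx]
    simp only [map_add, map_mul, map_one, map_natCast, map_ofNat]
    ring

end MultiDot

end

/-! ### The law of the dot products on the cube, and Gegenbauer polynomials -/

noncomputable section

namespace MultiDot

open Set

/-- The density of the distribution of a coordinate on the sphere. -/
def lineDens (n : ℕ) : ℝ → ℝ :=
  (Icc (-1 : ℝ) 1).indicator fun t => area (n - 1) * weight n t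

/-- The distribution of a coordinate on the sphere. -/
def lineMeas (n : ℕ) : Measure ℝ := volume.withDensity fun t => ENNReal.ofReal (lineDens n t)

theorem measurable_weight (n : ℕ) : Measurable (weight n) := by
  unfold weight; fun_prop

theorem measurable_lineDens (n : ℕ) : Measurable (lineDens n) :=
  ((measurable_weight n).const_mul _).indicator measurableSet_Icc

theorem area_nonneg (n : ℕ) : 0 ≤ area n := measureReal_nonneg

theorem weight_nonneg (n : ℕ) {t : ℝ} (ht : t ∈ Icc (-1 : ℝ) 1) : 0 ≤ weight n t :=
  Real.rpow_nonneg (by nlinarith [ht.1, ht.2]) _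

theorem lineDens_nonneg (n : ℕ) (t : ℝ) : 0 ≤ lineDens n t :=
  indicator_nonneg (fun _ ht => mul_nonneg (area_nonneg _) (weight_nonneg n ht)) t

theorem lintegral_lineMeas (n : ℕ) {φ : ℝ → ENNReal} (hφ : Measurable φ) :
    ∫⁻ t, φ t ∂(lineMeas n) = ENNReal.ofReal (area (n - 1)) *
      ∫⁻ t in Icc (-1 : ℝ) 1, ENNReal.ofReal (weight n t) * φ t := by
  rw [lineMeas, lintegral_withDensity_eq_lintegral_mul _ (measurable_lineDens n).ennreal_ofReal hφ,
    ← lintegral_indicator measurableSet_Icc, ← lintegral_const_mul' _ _ ENNReal.ofReal_ne_top]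
  refine lintegral_congr fun t => ?_
  by_cases ht : t ∈ Icc (-1 : ℝ) 1
  · simp only [Pi.mul_apply, lineDens, indicator_of_mem ht]
    rw [ENNReal.ofReal_mul (area_nonneg _), mul_assoc]
  · simp only [Pi.mul_apply, lineDens, indicator_of_notMem ht]
    simp

theorem nonempty_sph {n : ℕ} (hn : 1 ≤ n) : Nonempty (Sph n) := by
  have : Nonempty (Fin n) := ⟨⟨0, hn⟩⟩
  exact (NormedSpace.sphere_nonempty.2 zero_le_one).to_subtype

theorem measurable_inner_sph {n : ℕ} (x : Sph n) : Measurable fun z : Sph n =>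
    inner ℝ (x : EuclideanSpace ℝ (Fin n)) (z : EuclideanSpace ℝ (Fin n)) := by
  fun_prop

theorem map_inner_surf {n : ℕ} (hn : 2 ≤ n) (x : Sph n) :
    (surf n).map (fun z : Sph n =>
      inner ℝ (x : EuclideanSpace ℝ (Fin n)) (z : EuclideanSpace ℝ (Fin n))) = lineMeas n := by
  obtain ⟨m, rfl⟩ : ∃ m, n = m + 1 := ⟨n - 1, by omega⟩
  refine Measure.ext_of_lintegral _ fun φ hφ => ?_
  rw [lintegral_map hφ (measurable_inner_sph x), lintegral_comp_inner_sphere (by omega) x hφ,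
    lintegral_lineMeas _ hφ, Nat.add_sub_cancel]

/-- As the image of a finite measure it is finite, so the endpoint singularity of the weight
(present for n = 2) needs no estimate. -/
theorem isFiniteMeasure_lineMeas {n : ℕ} (hn : 2 ≤ n) : IsFiniteMeasure (lineMeas n) := by
  obtain ⟨x⟩ := nonempty_sph (n := n) (by omega)
  rw [← map_inner_surf hn x]
  infer_instance

theorem integrable_lineDens {n : ℕ} (hn : 2 ≤ n) : Integrable (lineDens n) := by
  refine ⟨(measurable_lineDens n).aestronglyMeasurable, ?_⟩
  rw [hasFiniteIntegral_iff_ofReal (.of_forall (lineDens_nonneg n))]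
  have := isFiniteMeasure_lineMeas hn
  have h := measure_lt_top (lineMeas n) univ
  rwa [lineMeas, withDensity_apply _ .univ, setLIntegral_univ] at h

/-- It suffices to compare the measures on boxes, where Fubini factors the integral of the product
density. -/
theorem pi_withDensity_ofReal {ι : Type*} [Fintype ι] {q : ι → ℝ → ℝ}
    (hq : ∀ i, Integrable (q i)) (hq0 : ∀ i t, 0 ≤ q i t) :
    Measure.pi (fun i => (volume : Measure ℝ).withDensity fun t => ENNReal.ofReal (q i t)) =
      (volume : Measure (ι → ℝ)).withDensity fun t => ENNReal.ofReal (∏ i, q i (t i)) := by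
  have : ∀ i, IsFiniteMeasure ((volume : Measure ℝ).withDensity fun t => ENNReal.ofReal (q i t)) :=
    fun i => isFiniteMeasure_withDensity_ofReal (hq i).2
  refine Measure.pi_eq fun s hs => ?_
  have hI : ∀ i, Integrable ((s i).indicator (q i)) := fun i => (hq i).indicator (hs i)
  have hI0 : ∀ i t, 0 ≤ (s i).indicator (q i) t := fun i t =>
    indicator_nonneg (fun t _ => hq0 i t) t
  have hbox : MeasurableSet (univ.pi s) := MeasurableSet.univ_pi hs
  have hind : ∀ t : ι → ℝ, (univ.pi s).indicator (fun t => ENNReal.ofReal (∏ i, q i (t i))) t =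
      ENNReal.ofReal (∏ i, (s i).indicator (q i) (t i)) := by
    intro t
    by_cases ht : t ∈ univ.pi s
    · rw [indicator_of_mem ht]
      congr 1
      exact Finset.prod_congr rfl fun i _ => (indicator_of_mem (ht i (mem_univ i)) _).symm
    · rw [indicator_of_notMem ht]
      have : ∃ i, t i ∉ s i := by simpa [Set.mem_pi] using ht
      obtain ⟨i, hi⟩ := this
      rw [Finset.prod_eq_zero (Finset.mem_univ i) (indicator_of_notMem hi _), ENNReal.ofReal_zero]
  rw [withDensity_apply _ hbox, ← lintegral_indicator hbox, lintegral_congr hind,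
    ← ofReal_integral_eq_lintegral_ofReal (show Integrable (fun t : ι → ℝ => _) volume from
      Integrable.fintype_prod hI)
      (.of_forall fun t => Finset.prod_nonneg fun i _ => hI0 i _),
    integral_fintype_prod_volume_eq_prod,
    ENNReal.ofReal_prod_of_nonneg fun i _ => integral_nonneg (hI0 i)]
  refine Finset.prod_congr rfl fun i _ => ?_
  rw [withDensity_apply _ (hs i), ← lintegral_indicator (hs i),
    ofReal_integral_eq_lintegral_ofReal (hI i) (.of_forall (hI0 i))]
  refine lintegral_congr fun t => ?_
  by_cases ht : t ∈ s i <;> simp [ht]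

/-- The distribution of the vector of dot products. -/
def boxMeas (n d : ℕ) : Measure (Fin d → ℝ) := Measure.pi fun _ => lineMeas n

theorem boxMeas_eq {n : ℕ} (hn : 2 ≤ n) (d : ℕ) :
    boxMeas n d = volume.withDensity fun t => ENNReal.ofReal (∏ i, lineDens n (t i)) :=
  pi_withDensity_ofReal (fun _ => integrable_lineDens hn) (fun _ => lineDens_nonneg n)

theorem isFiniteMeasure_boxMeas {n : ℕ} (hn : 2 ≤ n) (d : ℕ) : IsFiniteMeasure (boxMeas n d) := by
  have := isFiniteMeasure_lineMeas hn
  exact inferInstanceAs (IsFiniteMeasure (Measure.pi fun _ : Fin d => lineMeas n))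

theorem mem_cube {d : ℕ} {t : Fin d → ℝ} : t ∈ cube d ↔ ∀ i, t i ∈ Icc (-1 : ℝ) 1 := by
  simp [cube, Set.mem_Icc, Pi.le_def, forall_and]

theorem measurableSet_cube (d : ℕ) : MeasurableSet (cube d) := measurableSet_Icc

theorem isCompact_cube (d : ℕ) : IsCompact (cube d) := isCompact_Icc

theorem prod_lineDens (n : ℕ) {d : ℕ} (t : Fin d → ℝ) :
    ∏ i, lineDens n (t i) =
      (cube d).indicator (fun t => area (n - 1) ^ d * ∏ i, weight n (t i)) t := by
  by_cases ht : t ∈ cube d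
  · rw [indicator_of_mem ht]
    rw [mem_cube] at ht
    simp only [lineDens, indicator_of_mem (ht _)]
    rw [Finset.prod_mul_distrib]
    simp
  · rw [indicator_of_notMem ht]
    rw [mem_cube] at ht
    push Not at ht
    obtain ⟨i, hi⟩ := ht
    exact Finset.prod_eq_zero (Finset.mem_univ i) (indicator_of_notMem hi _)

theorem measurable_prod_lineDens (n d : ℕ) :
    Measurable fun t : Fin d → ℝ => ∏ i, lineDens n (t i) :=
  Finset.measurable_prod _ fun i _ => (measurable_lineDens n).comp (measurable_pi_apply i)

theorem integral_boxMeas {n : ℕ} (hn : 2 ≤ n) {d : ℕ} (g : (Fin d → ℝ) → ℝ) :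
    ∫ t, g t ∂(boxMeas n d) =
      area (n - 1) ^ d * ∫ t in cube d, g t * ∏ i, weight n (t i) := by
  rw [boxMeas_eq hn, integral_withDensity_eq_integral_toReal_smul
    (measurable_prod_lineDens n d).ennreal_ofReal (.of_forall fun _ => ENNReal.ofReal_lt_top),
    ← integral_const_mul, ← integral_indicator (measurableSet_cube d)]
  congr 1
  ext t
  rw [ENNReal.toReal_ofReal (Finset.prod_nonneg fun i _ => lineDens_nonneg n _), prod_lineDens]
  by_cases ht : t ∈ cube d
  · simp only [indicator_of_mem ht, smul_eq_mul]; ring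
  · simp only [indicator_of_notMem ht, smul_eq_mul, zero_mul]

theorem integrable_boxMeas {n : ℕ} (hn : 2 ≤ n) {d : ℕ} {g : (Fin d → ℝ) → ℝ} :
    Integrable g (boxMeas n d) ↔ IntegrableOn (fun t => g t * ∏ i, weight n (t i)) (cube d) := by
  have ha : area (n - 1) ^ d ≠ 0 := (pow_pos (area_pos (by omega)) _).ne'
  rw [boxMeas_eq hn, integrable_withDensity_iff_integrable_smul'
    (measurable_prod_lineDens n d).ennreal_ofReal (.of_forall fun _ => ENNReal.ofReal_lt_top),
    ← integrable_indicator_iff (measurableSet_cube d),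
    ← integrable_const_mul_iff (isUnit_iff_ne_zero.2 ha) ((cube d).indicator _)]
  refine integrable_congr (.of_forall fun t => ?_)
  beta_reduce
  rw [ENNReal.toReal_ofReal (Finset.prod_nonneg fun i _ => lineDens_nonneg n _), prod_lineDens]
  by_cases ht : t ∈ cube d
  · simp only [indicator_of_mem ht, smul_eq_mul]; ring
  · simp only [indicator_of_notMem ht, smul_eq_mul, zero_mul, mul_zero]

theorem ae_mem_cube {n : ℕ} (hn : 2 ≤ n) (d : ℕ) : ∀ᵐ t ∂(boxMeas n d), t ∈ cube d := by
  rw [boxMeas_eq hn, ae_withDensity_iff (measurable_prod_lineDens n d).ennreal_ofReal]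
  refine .of_forall fun t h => ?_
  by_contra ht
  rw [prod_lineDens, indicator_of_notMem ht] at h
  simp at h

theorem integral_lineMeas {n : ℕ} (g : ℝ → ℝ) :
    ∫ t, g t ∂(lineMeas n) = area (n - 1) * ∫ t in Icc (-1 : ℝ) 1, g t * weight n t := by
  rw [lineMeas, integral_withDensity_eq_integral_toReal_smul
    (measurable_lineDens n).ennreal_ofReal (.of_forall fun _ => ENNReal.ofReal_lt_top),
    ← integral_const_mul, ← integral_indicator measurableSet_Icc]
  congr 1
  ext t
  rw [ENNReal.toReal_ofReal (lineDens_nonneg n _), lineDens]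
  by_cases ht : t ∈ Icc (-1 : ℝ) 1
  · simp only [indicator_of_mem ht, smul_eq_mul]; ring
  · simp only [indicator_of_notMem ht, smul_eq_mul, zero_mul]

theorem integrable_lineMeas {n : ℕ} (hn : 2 ≤ n) {g : ℝ → ℝ} :
    Integrable g (lineMeas n) ↔ IntegrableOn (fun t => g t * weight n t) (Icc (-1 : ℝ) 1) := by
  have ha : area (n - 1) ≠ 0 := (area_pos (by omega)).ne'
  rw [lineMeas, integrable_withDensity_iff_integrable_smul'
    (measurable_lineDens n).ennreal_ofReal (.of_forall fun _ => ENNReal.ofReal_lt_top),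
    ← integrable_indicator_iff measurableSet_Icc,
    ← integrable_const_mul_iff (isUnit_iff_ne_zero.2 ha) ((Icc _ _).indicator _)]
  refine integrable_congr (.of_forall fun t => ?_)
  beta_reduce
  rw [ENNReal.toReal_ofReal (lineDens_nonneg n _), lineDens]
  by_cases ht : t ∈ Icc (-1 : ℝ) 1
  · simp only [indicator_of_mem ht, smul_eq_mul]; ring
  · simp only [indicator_of_notMem ht, smul_eq_mul, zero_mul, mul_zero]

theorem measurable_dots {ζ d : ℕ} (x : MS ζ d) : Measurable (dots x) :=
  measurable_pi_lambda _ fun i => (measurable_inner_sph (x i)).comp (measurable_pi_apply i)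

theorem continuous_dots {ζ d : ℕ} : Continuous fun w : MS ζ d × MS ζ d => dots w.1 w.2 := by
  unfold dots
  fun_prop

theorem dots_mem_cube {ζ d : ℕ} (x z : MS ζ d) : dots x z ∈ cube d := by
  rw [mem_cube]
  intro i
  have h := abs_real_inner_le_norm (x i : EuclideanSpace ℝ (Fin ζ)) (z i)
  rw [norm_eq_of_mem_sphere, norm_eq_of_mem_sphere, one_mul] at h
  exact abs_le.1 h

theorem dots_comm {ζ d : ℕ} (x z : MS ζ d) : dots x z = dots z x := by
  ext i
  exact real_inner_comm _ _

/-- The i-th dot product depends on the i-th factor only, so the image of the product measure is the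
product of the images. Independence of x is what makes all later bounds uniform in x. -/
theorem map_dots_unif {ζ : ℕ} (hζ : 2 ≤ ζ) {d : ℕ} (x : MS ζ d) :
    (unif ζ d).map (dots x) = boxMeas ζ d := by
  have := isFiniteMeasure_lineMeas hζ
  have h : ∀ i : Fin d, (surf ζ).map (fun z : Sph ζ =>
      inner ℝ (x i : EuclideanSpace ℝ (Fin ζ)) (z : EuclideanSpace ℝ (Fin ζ))) = lineMeas ζ :=
    fun i => map_inner_surf hζ (x i)
  rw [unif_eq_pi, boxMeas]
  have h2 := Measure.pi_map_pi (μ := fun _ : Fin d => surf ζ) (f := fun i (z : Sph ζ) =>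
      (inner ℝ (x i : EuclideanSpace ℝ (Fin ζ)) (z : EuclideanSpace ℝ (Fin ζ)) : ℝ))
      (hμ := fun i => by rw [h i]; infer_instance)
      (fun i => (measurable_inner_sph (x i)).aemeasurable)
  simp only [h] at h2
  exact h2

/-! ### Gegenbauer polynomials -/

theorem gegenbauer_denom_pos {n : ℕ} (hn : 2 ≤ n) (k : ℕ) : 0 < (k : ℝ) + n - 1 := by
  have hn' : (2 : ℝ) ≤ n := by exact_mod_cast hn
  have : (0 : ℝ) ≤ k := k.cast_nonneg
  linarith

/-- Both facts are proved together: the degree bound keeps Q_k out of the top coefficient of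
Q_{k+2}, which is then (2k + n) / (k + n - 1) times that of Q_{k+1}. -/
theorem gegenbauer_natDegree_le_and_coeff_pos {n : ℕ} (hn : 2 ≤ n) (k : ℕ) :
    (gegenbauer n k).natDegree ≤ k ∧ 0 < (gegenbauer n k).coeff k := by
  induction k using Nat.twoStepInduction with
  | zero => simp [gegenbauer]
  | one => simp [gegenbauer]
  | more k h1 h2 =>
    constructor
    · rw [gegenbauer]
      refine (Polynomial.natDegree_C_mul_le _ _).trans
        ((Polynomial.natDegree_sub_le _ _).trans (max_le ?_ ?_))
      · rw [mul_assoc]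
        refine (Polynomial.natDegree_C_mul_le _ _).trans (Polynomial.natDegree_mul_le.trans ?_)
        have := Polynomial.natDegree_X_le (R := ℝ)
        omega
      · refine (Polynomial.natDegree_C_mul_le _ _).trans ?_
        omega
    · rw [gegenbauer, Polynomial.coeff_C_mul, Polynomial.coeff_sub, mul_assoc,
        Polynomial.coeff_C_mul, Polynomial.coeff_C_mul, Polynomial.coeff_X_mul,
        Polynomial.coeff_eq_zero_of_natDegree_lt (p := gegenbauer n k) (by omega), mul_zero,
        sub_zero]
      have := gegenbauer_denom_pos hn k
      have h3 : 0 < 2 * (k : ℝ) + n := by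
        have : (0 : ℝ) ≤ k := k.cast_nonneg
        have hn' : (2 : ℝ) ≤ n := by exact_mod_cast hn
        linarith
      have h4 := h2.2
      positivity

theorem gegenbauer_natDegree {n : ℕ} (hn : 2 ≤ n) (k : ℕ) : (gegenbauer n k).natDegree = k :=
  Polynomial.natDegree_eq_of_le_of_coeff_ne_zero (gegenbauer_natDegree_le_and_coeff_pos hn k).1
    (gegenbauer_natDegree_le_and_coeff_pos hn k).2.ne'

theorem gegenbauer_eval_one {n : ℕ} (hn : 2 ≤ n) (k : ℕ) : (gegenbauer n k).eval 1 = 1 := by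
  induction k using Nat.twoStepInduction with
  | zero => simp [gegenbauer]
  | one => simp [gegenbauer]
  | more k h1 h2 =>
    have := gegenbauer_denom_pos hn k
    simp only [gegenbauer, Polynomial.eval_mul, Polynomial.eval_sub, Polynomial.eval_C,
      Polynomial.eval_X, h1, h2]
    field_simp
    ring

theorem integral_comp_inner {n : ℕ} (hn : 2 ≤ n) (x : Sph n) {φ : ℝ → ℝ} (hφ : Continuous φ) :
    ∫ z, φ (inner ℝ (x : EuclideanSpace ℝ (Fin n)) (z : EuclideanSpace ℝ (Fin n))) ∂(surf n) =
      ∫ t, φ t ∂(lineMeas n) := by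
  rw [← map_inner_surf hn x, integral_map (measurable_inner_sph x).aemeasurable
    hφ.aestronglyMeasurable]

theorem integrable_lineMeas_of_continuous {n : ℕ} (hn : 2 ≤ n) {φ : ℝ → ℝ} (hφ : Continuous φ) :
    Integrable φ (lineMeas n) := by
  obtain ⟨x⟩ := nonempty_sph (n := n) (by omega)
  rw [← map_inner_surf hn x, integrable_map_measure hφ.aestronglyMeasurable
    (measurable_inner_sph x).aemeasurable]
  exact integrable_of_continuous_sph (hφ.comp (by fun_prop))

/-- Lifted to the sphere, this is the orthogonality of two zonal harmonics of different frequencies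
with a common pole. -/
theorem integral_gegenbauer_mul_gegenbauer {n : ℕ} (hn : 2 ≤ n) {k l : ℕ} (hkl : k ≠ l) :
    ∫ t, (gegenbauer n k).eval t * (gegenbauer n l).eval t ∂(lineMeas n) = 0 := by
  obtain ⟨x⟩ := nonempty_sph (n := n) (by omega)
  rw [← integral_comp_inner hn x (φ := fun t => (gegenbauer n k).eval t * (gegenbauer n l).eval t)
      ((Polynomial.continuous _).mul (Polynomial.continuous _)),
    ← sphInt_solid_mul_solid hn hkl (isSolid_zonal hn (sum_sq_sph x) k)
      (isSolid_zonal hn (sum_sq_sph x) l), sphInt_apply]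
  congr 1
  ext z
  rw [← restrictSph_zonal, ← restrictSph_zonal]
  simp [restrictSph_apply]

/-- The Funk–Hecke formula for polynomials, with the constant identified. -/
theorem integral_polynomial_inner_mul {n : ℕ} (hn : 2 ≤ n) (φ : Polynomial ℝ) {k : ℕ}
    {Y : Sph n → ℝ} (hY : Y ∈ sphHarm n k) (x : Sph n) :
    ∫ z, φ.eval (inner ℝ (x : EuclideanSpace ℝ (Fin n)) (z : EuclideanSpace ℝ (Fin n))) * Y z
      ∂(surf n) = (∫ t, φ.eval t * (gegenbauer n k).eval t ∂(lineMeas n)) * Y x := by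
  obtain ⟨h, hh, rfl⟩ := mem_sphHarm.1 hY
  obtain ⟨A, hA⟩ := exists_sphInt_aeval_linForm_mul hn φ k
  have key : ∀ h : MvPolynomial (Fin n) ℝ, IsSolid k h →
      ∫ z, φ.eval (inner ℝ (x : EuclideanSpace ℝ (Fin n)) (z : EuclideanSpace ℝ (Fin n))) *
        restrictSph n h z ∂(surf n) = A * restrictSph n h x := by
    intro h hh
    rw [← hA h hh x, sphInt_apply]
    congr 1
    ext z
    rw [restrictSph_apply, restrictSph_apply, map_mul, ← eval_linForm]
    congr 1
    rw [← Polynomial.eval₂_id, ← MvPolynomial.coe_aeval_eq_eval, RingHom.coe_coe,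
      ← Polynomial.aeval_algHom_apply]
    simp [Polynomial.aeval_def]
  -- The constant `A` is read off from the zonal harmonic with pole x, whose value at x is Q_k(1) =
  -- 1.
  have h2 := key _ (isSolid_zonal hn (sum_sq_sph x) k)
  rw [key h hh]
  simp only [restrictSph_zonal] at h2
  rw [integral_comp_inner hn x (φ := fun t => φ.eval t * (gegenbauer n k).eval t)
    ((Polynomial.continuous _).mul (Polynomial.continuous _))] at h2
  rw [h2]
  simp [gegenbauer_eval_one hn]

end MultiDot

end

/-! ### Completeness of the harmonics and the addition theorem -/

noncomputable section

namespace MultiDot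

open MvPolynomial

variable {n : ℕ}

theorem isHomogeneous_polyLaplacian {m : ℕ} {p : MvPolynomial (Fin n) ℝ} (hp : p.IsHomogeneous m) :
    (polyLaplacian n p).IsHomogeneous (m - 2) := by
  rw [polyLaplacian_apply]
  exact IsHomogeneous.sum _ _ _ fun i _ => hp.pderiv.pderiv

theorem pderiv_of_isHomogeneous_zero {p : MvPolynomial (Fin n) ℝ} (hp : p.IsHomogeneous 0)
    (i : Fin n) : pderiv i p = 0 := by
  rw [← totalDegree_zero_iff_isHomogeneous, totalDegree_eq_zero_iff_eq_C] at hp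
  rw [hp, pderiv_C]

theorem eq_zero_of_restrictSph_eq_zero (hn : 1 ≤ n) {m : ℕ} {q : MvPolynomial (Fin n) ℝ}
    (hq : q.IsHomogeneous m) (h : restrictSph n q = 0) : q = 0 := by
  refine hq.eq_zero_of_forall_eval_eq_zero fun y => ?_
  have hσ : ∃ (r : ℝ) (σ : Sph n), y = r • (σ : EuclideanSpace ℝ (Fin n)).ofLp := by
    by_cases hy : WithLp.toLp 2 y = 0
    · obtain ⟨σ⟩ := nonempty_sph hn
      refine ⟨0, σ, ?_⟩
      simpa using hy
    · have h0 : ‖WithLp.toLp 2 y‖ ≠ 0 := norm_ne_zero_iff.2 hy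
      refine ⟨‖WithLp.toLp 2 y‖, ⟨‖WithLp.toLp 2 y‖⁻¹ • WithLp.toLp 2 y, ?_⟩, ?_⟩
      · simp [norm_smul, h0]
      · ext i
        simp [h0]
  obtain ⟨r, σ, rfl⟩ := hσ
  rw [eval_smul_of_isHomogeneous hq, ← restrictSph_apply, h, Pi.zero_apply, mul_zero]

theorem restrictSph_eq_zero_of_sphInt_mul_self {q : MvPolynomial (Fin n) ℝ}
    (h : sphInt n (q * q) = 0) : restrictSph n q = 0 := by
  rw [sphInt_apply, integral_eq_zero_iff_of_nonneg (fun x => ?_) (integrable_restrictSph _)] at h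
  · have h2 := (continuous_restrictSph (q * q)).ae_eq_iff_eq (surf n) continuous_zero |>.1 h
    ext x
    have h3 := congrFun h2 x
    simpa [restrictSph_apply] using h3
  · simp only [restrictSph_apply, map_mul, Pi.zero_apply]
    exact mul_self_nonneg _

/-- Every homogeneous polynomial is a harmonic one plus a multiple of `|z|²`. -/
theorem exists_isSolid_add_normSqPoly_mul (hn : 2 ≤ n) {m : ℕ} {p : MvPolynomial (Fin n) ℝ}
    (hp : p.IsHomogeneous (m + 2)) :
    ∃ h q, IsSolid (m + 2) h ∧ q.IsHomogeneous m ∧ p = h + normSqPoly n * q := by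
  let V := homogeneousSubmodule (Fin n) ℝ m
  have : Module.Finite ℝ V := Module.Finite.iff_fg.2 (homogeneousSubmodule_fg _ _ m)
  have hmul : ∀ q ∈ V, (normSqPoly n * q).IsHomogeneous (m + 2) := fun q hq => by
    have := (isHomogeneous_normSqPoly (n := n)).mul hq
    rwa [add_comm] at this
  have hmaps : ∀ q ∈ V, (polyLaplacian n ∘ₗ LinearMap.mulLeft ℝ (normSqPoly n)) q ∈ V :=
    fun q hq => isHomogeneous_polyLaplacian (hmul q hq)
  -- The map q ↦ Δ(|z|² q) acts on a finite-dimensional space, so injectivity gives surjectivity. If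
  -- |z|² q is harmonic, it is orthogonal to q, which has smaller degree; on the sphere this says ∫
  -- q² = 0.
  have hinj : Function.Injective
      ((polyLaplacian n ∘ₗ LinearMap.mulLeft ℝ (normSqPoly n)).restrict hmaps) := by
    rw [injective_iff_map_eq_zero]
    rintro ⟨q, hq⟩ h0
    have hs : IsSolid (m + 2) (normSqPoly n * q) := ⟨hmul q hq, congrArg Subtype.val h0⟩
    have h1 := sphInt_mul_solid_of_lt hn (by omega) hq hs
    have h2 : sphInt n (q * q) = 0 := by
      rw [← h1, sphInt_apply, sphInt_apply,
        show q * (normSqPoly n * q) = normSqPoly n * (q * q) by ring, restrictSph_normSqPoly_mul]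
    exact Subtype.ext (eq_zero_of_restrictSph_eq_zero (by omega) hq
      (restrictSph_eq_zero_of_sphInt_mul_self h2))
  obtain ⟨⟨q, hq⟩, hq2⟩ := LinearMap.injective_iff_surjective.1 hinj
    ⟨polyLaplacian n p, isHomogeneous_polyLaplacian hp⟩
  have hq3 : polyLaplacian n (normSqPoly n * q) = polyLaplacian n p := congrArg Subtype.val hq2
  refine ⟨p - normSqPoly n * q, q, ⟨hp.sub (hmul q hq), ?_⟩, hq, by ring⟩
  rw [map_sub, hq3, sub_self]

/-- Splitting off the harmonic part leaves |z|² q, which equals q on the sphere and has degree two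
less; degrees 0 and 1 are harmonic already. -/
theorem restrictSph_mem_iSup_sphHarm (hn : 2 ≤ n) (p : MvPolynomial (Fin n) ℝ) :
    restrictSph n p ∈ ⨆ k, sphHarm n k := by
  have key : ∀ m (p : MvPolynomial (Fin n) ℝ), p.IsHomogeneous m →
      restrictSph n p ∈ ⨆ k, sphHarm n k := by
    intro m
    induction m using Nat.twoStepInduction with
    | zero =>
      intro p hp
      refine Submodule.mem_iSup_of_mem 0 (mem_sphHarm.2 ⟨p, ⟨hp, ?_⟩, rfl⟩)
      simp [polyLaplacian_apply, pderiv_of_isHomogeneous_zero hp]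
    | one =>
      intro p hp
      refine Submodule.mem_iSup_of_mem 1 (mem_sphHarm.2 ⟨p, ⟨hp, ?_⟩, rfl⟩)
      rw [polyLaplacian_apply]
      exact Finset.sum_eq_zero fun i _ => pderiv_of_isHomogeneous_zero hp.pderiv i
    | more m ih _ =>
      intro p hp
      obtain ⟨h, q, hh, hq, rfl⟩ := exists_isSolid_add_normSqPoly_mul hn hp
      rw [map_add, restrictSph_normSqPoly_mul]
      exact Submodule.add_mem _ (Submodule.mem_iSup_of_mem (m + 2) (mem_sphHarm.2 ⟨h, hh, rfl⟩))
        (ih q hq)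
  rw [← sum_homogeneousComponent p, map_sum]
  exact Submodule.sum_mem _ fun i _ => key i _ (homogeneousComponent_isHomogeneous i p)

theorem continuous_of_mem_sphHarm {k : ℕ} {f : Sph n → ℝ} (hf : f ∈ sphHarm n k) :
    Continuous f := by
  obtain ⟨h, _, rfl⟩ := mem_sphHarm.1 hf
  exact continuous_restrictSph h

theorem integral_mul_eq_zero_of_ne (hn : 2 ≤ n) {k l : ℕ} (hkl : k ≠ l) {f g : Sph n → ℝ}
    (hf : f ∈ sphHarm n k) (hg : g ∈ sphHarm n l) : ∫ x, f x * g x ∂(surf n) = 0 := by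
  obtain ⟨p, hp, rfl⟩ := mem_sphHarm.1 hf
  obtain ⟨q, hq, rfl⟩ := mem_sphHarm.1 hg
  rw [← sphInt_solid_mul_solid hn hkl hp hq, sphInt_apply]
  simp [restrictSph_apply]

instance finite_sphHarm (k : ℕ) : Module.Finite ℝ (sphHarm n k) := by
  have : Module.Finite ℝ (homogeneousSubmodule (Fin n) ℝ k) :=
    Module.Finite.iff_fg.2 (homogeneousSubmodule_fg _ _ k)
  have : Module.Finite ℝ (homogeneousSubmodule (Fin n) ℝ k ⊓ LinearMap.ker (polyLaplacian n) :
      Submodule ℝ _) := Submodule.finiteDimensional_inf_left _ _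
  exact Module.Finite.map _ _

section Basis

variable {Y : (k : ℕ) → Fin (numHarm n k) → Sph n → ℝ}

theorem IsSHBasis.continuous (hY : IsSHBasis n Y) (k : ℕ) (j : Fin (numHarm n k)) :
    Continuous (Y k j) :=
  continuous_of_mem_sphHarm (hY.mem k j)

theorem IsSHBasis.integral_sum_mul (hY : IsSHBasis n Y) (k : ℕ) (c : Fin (numHarm n k) → ℝ)
    (i : Fin (numHarm n k)) : ∫ x, (∑ j, c j * Y k j x) * Y k i x ∂(surf n) = c i := by
  simp only [Finset.sum_mul, mul_assoc]
  rw [integral_finsetSum]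
  · simp [integral_const_mul, hY.orthonormal]
  · intro j _
    exact (integrable_of_continuous_sph ((hY.continuous k j).mul (hY.continuous k i))).const_mul _

/-- Orthonormal functions are linearly independent, and their number is the dimension. -/
theorem IsSHBasis.span_eq (hY : IsSHBasis n Y) (k : ℕ) :
    Submodule.span ℝ (Set.range (Y k)) = sphHarm n k := by
  have hli : LinearIndependent ℝ (Y k) := by
    rw [Fintype.linearIndependent_iff]
    intro c hc i
    rw [← hY.integral_sum_mul k c i]
    have : ∀ x, ∑ j, c j * Y k j x = 0 := fun x => by
      have := congrFun hc x
      simpa using this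
    simp [this]
  refine Submodule.eq_of_le_of_finrank_eq
    (Submodule.span_le.2 (Set.range_subset_iff.2 (hY.mem k))) ?_
  rw [finrank_span_eq_card hli, Fintype.card_fin, numHarm]

theorem IsSHBasis.eq_sum (hY : IsSHBasis n Y) {k : ℕ} {f : Sph n → ℝ} (hf : f ∈ sphHarm n k)
    (x : Sph n) : f x = ∑ j, (∫ z, f z * Y k j z ∂(surf n)) * Y k j x := by
  rw [← hY.span_eq k, Submodule.mem_span_range_iff_exists_fun] at hf
  obtain ⟨c, rfl⟩ := hf
  have : ∀ j, ∫ z, (∑ i, c i • Y k i) z * Y k j z ∂(surf n) = c j := fun j => by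
    rw [← hY.integral_sum_mul k c j]
    simp
  simp only [this]
  simp

/-- The squared norm of the Gegenbauer polynomial. -/
def gegNorm (n k : ℕ) : ℝ :=
  ∫ t, (gegenbauer n k).eval t * (gegenbauer n k).eval t ∂(lineMeas n)

/-- The addition theorem. -/
theorem IsSHBasis.addition (hn : 2 ≤ n) (hY : IsSHBasis n Y) (k : ℕ) (x z : Sph n) :
    gegNorm n k * ∑ j, Y k j x * Y k j z = (gegenbauer n k).eval
        (inner ℝ (x : EuclideanSpace ℝ (Fin n)) (z : EuclideanSpace ℝ (Fin n))) := by
  have hz := mem_sphHarm.2 ⟨_, isSolid_zonal hn (sum_sq_sph x) k, rfl⟩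
  -- The zonal harmonic is expanded in the basis; by Funk–Hecke with φ = Q_k its coefficients are
  -- `gegNorm n k` times Y_kj(x).
  rw [← restrictSph_zonal, hY.eq_sum hz z, Finset.mul_sum]
  refine Finset.sum_congr rfl fun j _ => ?_
  simp only [restrictSph_zonal]
  rw [integral_polynomial_inner_mul hn _ (hY.mem k j), ← mul_assoc]
  rfl

theorem IsSHBasis.gegNorm_mul_sum_sq (hn : 2 ≤ n) (hY : IsSHBasis n Y) (k : ℕ) (x : Sph n) :
    gegNorm n k * ∑ j, Y k j x ^ 2 = 1 := by
  have := hY.addition hn k x x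
  simpa [sq, gegenbauer_eval_one hn] using this

/-- It is the integral of a square, and it cannot vanish because the addition theorem at z = x makes
it a factor of 1. -/
theorem IsSHBasis.gegNorm_pos (hn : 2 ≤ n) (hY : IsSHBasis n Y) (k : ℕ) : 0 < gegNorm n k := by
  obtain ⟨x⟩ := nonempty_sph (n := n) (by omega)
  refine lt_of_le_of_ne (integral_nonneg fun t => mul_self_nonneg _) fun h => ?_
  have h2 := hY.gegNorm_mul_sum_sq hn k x
  rw [← h, zero_mul] at h2
  exact zero_ne_one h2

theorem IsSHBasis.sum_sq (hn : 2 ≤ n) (hY : IsSHBasis n Y) (k : ℕ) (x : Sph n) :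
    ∑ j, Y k j x ^ 2 = (gegNorm n k)⁻¹ :=
  eq_inv_of_mul_eq_one_right (hY.gegNorm_mul_sum_sq hn k x)

theorem IsSHBasis.integral_mul (hn : 2 ≤ n) (hY : IsSHBasis n Y)
    (a b : (k : ℕ) × Fin (numHarm n k)) :
    ∫ x, Y a.1 a.2 x * Y b.1 b.2 x ∂(surf n) = if a = b then 1 else 0 := by
  obtain ⟨k, i⟩ := a
  obtain ⟨l, j⟩ := b
  by_cases hkl : k = l
  · subst hkl
    simp [hY.orthonormal]
  · rw [integral_mul_eq_zero_of_ne hn hkl (hY.mem _ _) (hY.mem _ _), if_neg]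
    intro h
    exact hkl (congrArg Sigma.fst h)

theorem IsSHBasis.restrictSph_mem_span (hn : 2 ≤ n) (hY : IsSHBasis n Y)
    (p : MvPolynomial (Fin n) ℝ) : restrictSph n p ∈ Submodule.span ℝ
      (Set.range fun a : (k : ℕ) × Fin (numHarm n k) => Y a.1 a.2) := by
  refine (iSup_le fun k => ?_ : (⨆ k, sphHarm n k) ≤ _) (restrictSph_mem_iSup_sphHarm hn p)
  rw [← hY.span_eq k]
  refine Submodule.span_mono ?_
  rintro _ ⟨j, rfl⟩
  exact ⟨⟨k, j⟩, rfl⟩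

end Basis

/-! ### SH-products -/

section Products

variable {d : ℕ} {Y : (k : ℕ) → Fin (numHarm n k) → Sph n → ℝ}

theorem IsSHBasis.continuous_shProd (hY : IsSHBasis n Y) (p : SHIndex n d) :
    Continuous (shProd Y p) :=
  continuous_finsetProd _ fun i _ => (hY.continuous _ _).comp (continuous_apply i)

theorem integrable_of_continuous_ms {f : MS n d → ℝ} (hf : Continuous f) :
    Integrable f (unif n d) :=
  hf.integrable_of_hasCompactSupport (HasCompactSupport.of_compactSpace f)

open Classical in
theorem IsSHBasis.integral_shProd_mul (hn : 2 ≤ n) (hY : IsSHBasis n Y) (p q : SHIndex n d) :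
    ∫ x, shProd Y p x * shProd Y q x ∂(unif n d) = if p = q then 1 else 0 := by
  simp only [shProd, ← Finset.prod_mul_distrib, unif_eq_pi]
  rw [integral_fintype_prod_eq_prod (fun i x => Y (p.1 i) (p.2 i) x * Y (q.1 i) (q.2 i) x)]
  have h : ∀ i, ∫ x, Y (p.1 i) (p.2 i) x * Y (q.1 i) (q.2 i) x ∂(surf n) =
      if (⟨p.1 i, p.2 i⟩ : (k : ℕ) × Fin (numHarm n k)) = ⟨q.1 i, q.2 i⟩ then 1 else 0 := fun i => by
    rw [← hY.integral_mul hn]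
  rw [Finset.prod_congr rfl fun i _ => h i]
  by_cases hpq : p = q
  · subst hpq
    simp
  · rw [if_neg hpq]
    have : ∃ i, (⟨p.1 i, p.2 i⟩ : (k : ℕ) × Fin (numHarm n k)) ≠ ⟨q.1 i, q.2 i⟩ := by
      by_contra! hall
      refine hpq ?_
      obtain ⟨k, j⟩ := p
      obtain ⟨l, j'⟩ := q
      obtain rfl : k = l := funext fun i => congrArg Sigma.fst (hall i)
      have : j = j' := funext fun i => by simpa using hall i
      rw [this]
    obtain ⟨i, hi⟩ := this
    exact Finset.prod_eq_zero (Finset.mem_univ i) (if_neg hi)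

/-- SH-products as continuous maps. -/
def IsSHBasis.shCM (hY : IsSHBasis n Y) (p : SHIndex n d) : C(MS n d, ℝ) :=
  ⟨shProd Y p, hY.continuous_shProd p⟩

theorem IsSHBasis.prod_restrictSph_mem_span (hn : 2 ≤ n) (hY : IsSHBasis n Y)
    (p : Fin d → MvPolynomial (Fin n) ℝ) {F : C(MS n d, ℝ)}
    (hF : ∀ x, F x = ∏ i, restrictSph n (p i) (x i)) :
    F ∈ Submodule.span ℝ (Set.range (hY.shCM (d := d))) := by
  have h := fun i => Finsupp.mem_span_range_iff_exists_finsupp.1 (hY.restrictSph_mem_span hn (p i))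
  choose c hc using h
  have : F = ∑ a ∈ Fintype.piFinset (fun i => (c i).support), (∏ i, c i (a i)) •
      hY.shCM ⟨fun i => (a i).1, fun i => (a i).2⟩ := by
    ext x
    rw [hF, ContinuousMap.coe_sum, Finset.sum_apply]
    have : ∀ i, restrictSph n (p i) (x i) =
        ∑ a ∈ (c i).support, c i a * Y a.1 a.2 (x i) := fun i => by
      rw [← hc i, Finsupp.sum, Finset.sum_apply]
      simp
    rw [Finset.prod_congr rfl fun i _ => this i, Finset.prod_univ_sum]
    refine Finset.sum_congr rfl fun a _ => ?_
    rw [Finset.prod_mul_distrib]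
    rfl
  rw [this]
  exact Submodule.sum_mem _ fun a _ => Submodule.smul_mem _ _ (Submodule.subset_span ⟨_, rfl⟩)

/-- The coordinate functions on the multisphere. -/
def coordCM (i : Fin d) (a : Fin n) : C(MS n d, ℝ) :=
  ⟨fun x => (x i : EuclideanSpace ℝ (Fin n)).ofLp a, by fun_prop⟩

/-- By Stone–Weierstrass the algebra generated by the coordinates is dense. Each of its monomials is
a product of polynomials in the separate factors, and each of those is a combination of harmonics.
-/
theorem IsSHBasis.closure_span_shCM (hn : 2 ≤ n) (hY : IsSHBasis n Y) :
    (Submodule.span ℝ (Set.range (hY.shCM (d := d)))).topologicalClosure = ⊤ := by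
  set S : Set C(MS n d, ℝ) := Set.range fun ia : Fin d × Fin n => coordCM ia.1 ia.2
  set A := Algebra.adjoin ℝ S
  have hsep : A.SeparatesPoints := by
    intro x y hxy
    obtain ⟨i, hi⟩ := Function.ne_iff.1 hxy
    have : ∃ a, (x i : EuclideanSpace ℝ (Fin n)).ofLp a ≠ (y i : EuclideanSpace ℝ (Fin n)).ofLp a := by
      by_contra! hall
      exact hi (Subtype.ext (PiLp.ext hall))
    obtain ⟨a, ha⟩ := this
    exact ⟨_, ⟨coordCM i a, Algebra.subset_adjoin ⟨(i, a), rfl⟩, rfl⟩, ha⟩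
  have hA := ContinuousMap.subalgebra_topologicalClosure_eq_top_of_separatesPoints A hsep
  have hB : ∀ F ∈ Submonoid.closure S, ∃ p : Fin d → MvPolynomial (Fin n) ℝ,
      ∀ x, F x = ∏ i, restrictSph n (p i) (x i) := by
    intro F hF
    induction hF using Submonoid.closure_induction with
    | mem F hF =>
      obtain ⟨⟨i, a⟩, rfl⟩ := hF
      refine ⟨Pi.mulSingle i (X a), fun x => ?_⟩
      rw [Finset.prod_eq_single i]
      · simp [restrictSph_apply, coordCM]
      · intro j _ hj
        simp [hj, restrictSph_apply]
      · simp
    | one => exact ⟨1, fun x => by simp [restrictSph_apply]⟩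
    | mul F G _ _ hF hG =>
      obtain ⟨p, hp⟩ := hF
      obtain ⟨q, hq⟩ := hG
      refine ⟨p * q, fun x => ?_⟩
      simp [hp, hq, restrictSph_apply, Finset.prod_mul_distrib]
  have hle : Subalgebra.toSubmodule A ≤ Submodule.span ℝ (Set.range (hY.shCM (d := d))) := by
    rw [Algebra.adjoin_eq_span, Submodule.span_le]
    intro F hF
    obtain ⟨p, hp⟩ := hB F hF
    exact hY.prod_restrictSph_mem_span hn p hp
  rw [eq_top_iff]
  intro F _
  have hFA : F ∈ A.topologicalClosure := by rw [hA]; trivial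
  have : (A : Set C(MS n d, ℝ)) ⊆ Submodule.span ℝ (Set.range (hY.shCM (d := d))) := hle
  exact closure_mono this hFA

/-- The SH-products as elements of `L²`. -/
def IsSHBasis.shLp (hY : IsSHBasis n Y) (p : SHIndex n d) : Lp ℝ 2 (unif n d) :=
  ContinuousMap.toLp 2 (unif n d) ℝ (hY.shCM p)

theorem IsSHBasis.coeFn_shLp (hY : IsSHBasis n Y) (p : SHIndex n d) :
    hY.shLp p =ᵐ[unif n d] shProd Y p :=
  ContinuousMap.coeFn_toLp _ _

theorem IsSHBasis.inner_shLp (hY : IsSHBasis n Y) (p : SHIndex n d) (f : Lp ℝ 2 (unif n d)) :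
    inner ℝ (hY.shLp p) f = ∫ x, f x * shProd Y p x ∂(unif n d) := by
  rw [L2.inner_def]
  refine integral_congr_ae ?_
  filter_upwards [hY.coeFn_shLp p] with x hx
  rw [hx]
  simp

theorem IsSHBasis.orthonormal_shLp (hn : 2 ≤ n) (hY : IsSHBasis n Y) :
    Orthonormal ℝ (hY.shLp (d := d)) := by
  classical
  rw [orthonormal_iff_ite]
  intro p q
  rw [hY.inner_shLp, eq_comm]
  have := hY.integral_shProd_mul hn q p
  simp only [eq_comm (a := q)] at this
  rw [← this]
  refine integral_congr_ae ?_
  filter_upwards [hY.coeFn_shLp q] with x hx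
  rw [hx]

/-- The functional ⟨f,·⟩ vanishes on the SH-products, hence on all continuous functions by uniform
density, and these are dense in L². -/
theorem IsSHBasis.span_shLp_orthogonal (hn : 2 ≤ n) (hY : IsSHBasis n Y) :
    (Submodule.span ℝ (Set.range (hY.shLp (d := d))))ᗮ = ⊥ := by
  rw [Submodule.eq_bot_iff]
  intro f hf
  have hp : ∀ p, inner ℝ (hY.shLp p) f = 0 := fun p =>
    (Submodule.mem_orthogonal _ _).1 hf _ (Submodule.subset_span ⟨p, rfl⟩)
  let Z : Submodule ℝ C(MS n d, ℝ) :=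
    LinearMap.ker ((innerSL ℝ f).comp (ContinuousMap.toLp 2 (unif n d) ℝ)).toLinearMap
  have hZc : IsClosed (Z : Set C(MS n d, ℝ)) :=
    ((innerSL ℝ f).comp (ContinuousMap.toLp 2 (unif n d) ℝ)).isClosed_ker
  have hZ : Z = ⊤ := by
    rw [eq_top_iff, ← hY.closure_span_shCM hn]
    refine Submodule.topologicalClosure_minimal _ (Submodule.span_le.2 ?_) hZc
    rintro _ ⟨p, rfl⟩
    have := hp p
    rw [real_inner_comm] at this
    exact this
  refine (ContinuousMap.toLp_denseRange ℝ (unif n d) ℝ (p := 2)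
    (by norm_num)).eq_zero_of_inner_left (𝕜 := ℝ) ?_
  intro g
  have : g ∈ Z := hZ ▸ Submodule.mem_top
  exact this

/-- The Hilbert basis of SH-products. -/
def IsSHBasis.hilbertBasis (hn : 2 ≤ n) (hY : IsSHBasis n Y) :
    HilbertBasis (SHIndex n d) ℝ (Lp ℝ 2 (unif n d)) :=
  HilbertBasis.mkOfOrthogonalEqBot (hY.orthonormal_shLp hn) (hY.span_shLp_orthogonal hn)

theorem IsSHBasis.coe_hilbertBasis (hn : 2 ≤ n) (hY : IsSHBasis n Y) :
    ⇑(hY.hilbertBasis (d := d) hn) = hY.shLp :=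
  HilbertBasis.coe_mkOfOrthogonalEqBot _ _

theorem IsSHBasis.ae_eq_zero (hn : 2 ≤ n) (hY : IsSHBasis n Y) {f : MS n d → ℝ}
    (hf : MemLp f 2 (unif n d)) (h : ∀ p : SHIndex n d, ∫ x, f x * shProd Y p x ∂(unif n d) = 0) :
    f =ᵐ[unif n d] 0 := by
  have h0 : hf.toLp f = 0 := by
    have hmem : hf.toLp f ∈ (Submodule.span ℝ (Set.range (hY.shLp (d := d))))ᗮ := by
      rw [Submodule.mem_orthogonal]
      intro u hu
      induction hu using Submodule.span_induction with
      | mem u hu =>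
        obtain ⟨p, rfl⟩ := hu
        rw [hY.inner_shLp, ← h p]
        refine integral_congr_ae ?_
        filter_upwards [hf.coeFn_toLp] with x hx
        rw [hx]
      | zero => simp
      | add u v _ _ hu hv => rw [inner_add_left, hu, hv, add_zero]
      | smul c u _ hu => rw [inner_smul_left, hu, mul_zero]
    rw [hY.span_shLp_orthogonal hn] at hmem
    exact (Submodule.mem_bot ℝ).1 hmem
  exact (MemLp.toLp_eq_toLp_iff hf MemLp.zero).1 (by rw [h0]; rfl)

end Products

end MultiDot

end

/-! ### The Funk–Hecke formula on the multisphere -/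

noncomputable section

namespace MultiDot

open MvPolynomial

variable {n d : ℕ} {Y : (k : ℕ) → Fin (numHarm n k) → Sph n → ℝ}

theorem measurePreserving_dots (hn : 2 ≤ n) (x : MS n d) :
    MeasurePreserving (dots x) (unif n d) (boxMeas n d) :=
  ⟨measurable_dots x, map_dots_unif hn x⟩

/-- The product of Gegenbauer polynomials. -/
def gegProd (n : ℕ) (k : Fin d → ℕ) (t : Fin d → ℝ) : ℝ := ∏ i, (gegenbauer n (k i)).eval (t i)

theorem continuous_gegProd (k : Fin d → ℕ) : Continuous (gegProd n k) :=
  continuous_finsetProd _ fun i _ => (Polynomial.continuous _).comp (continuous_apply i)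

theorem eigval_eq_integral (hn : 2 ≤ n) (κ : (Fin d → ℝ) → ℝ) (k : Fin d → ℕ) :
    eigval n κ k = ∫ t, κ t * gegProd n k t ∂(boxMeas n d) := by
  rw [integral_boxMeas hn, eigval]
  simp only [gegProd, Finset.prod_mul_distrib, mul_assoc]

theorem integrable_boxMeas_of_continuousOn (hn : 2 ≤ n) {g : (Fin d → ℝ) → ℝ}
    (hg : ContinuousOn g (cube d)) : Integrable g (boxMeas n d) := by
  have := isFiniteMeasure_boxMeas hn d
  have h : IntegrableOn g (cube d) (boxMeas n d) := hg.integrableOn_compact (isCompact_cube d)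
  rwa [IntegrableOn, Measure.restrict_eq_self_of_ae_mem (ae_mem_cube hn d)] at h

theorem integrable_boxMeas_mul (hn : 2 ≤ n) {g h : (Fin d → ℝ) → ℝ}
    (hg : Integrable g (boxMeas n d)) (hh : Continuous h) :
    Integrable (fun t => g t * h t) (boxMeas n d) := by
  obtain ⟨M, hM⟩ := (isCompact_cube d).exists_bound_of_continuousOn hh.continuousOn
  refine hg.mul_bdd (c := M) hh.aestronglyMeasurable ?_
  filter_upwards [ae_mem_cube hn d] with t ht using hM t ht

/-- The Funk–Hecke formula for polynomials in several variables. -/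
theorem IsSHBasis.integral_eval_dots_mul (hn : 2 ≤ n) (hY : IsSHBasis n Y)
    (φ : MvPolynomial (Fin d) ℝ) (p : SHIndex n d) (x : MS n d) :
    ∫ z, eval (dots x z) φ * shProd Y p z ∂(unif n d) =
      (∫ t, eval t φ * gegProd n p.1 t ∂(boxMeas n d)) * shProd Y p x := by
  have hc : ∀ φ : MvPolynomial (Fin d) ℝ, Continuous fun z : MS n d => eval (dots x z) φ :=
    fun φ => (MvPolynomial.continuous_eval φ).comp
      (continuous_dots.comp (Continuous.prodMk_right x))
  induction φ using MvPolynomial.induction_on' with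
  | add φ ψ hφ hψ =>
    simp only [map_add, add_mul]
    rw [integral_add (integrable_of_continuous_ms ((hc φ).fun_mul (hY.continuous_shProd p)))
      (integrable_of_continuous_ms ((hc ψ).fun_mul (hY.continuous_shProd p))), integral_add, add_mul,
      hφ, hψ]
    · exact integrable_boxMeas_of_continuousOn hn
        ((MvPolynomial.continuous_eval φ).mul (continuous_gegProd _)).continuousOn
    · exact integrable_boxMeas_of_continuousOn hn
        ((MvPolynomial.continuous_eval ψ).mul (continuous_gegProd _)).continuousOn
  -- For a monomial both sides factor over the spheres, and each factor is the one-sphere formula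
  -- for t^(a i).
  | monomial a c =>
    have := isFiniteMeasure_lineMeas hn
    have hmon : ∀ t : Fin d → ℝ, eval t (monomial a c) = c * ∏ i, t i ^ a i := fun t => by
      rw [eval_monomial, Finsupp.prod_fintype _ _ (by simp)]
    simp only [hmon, shProd, gegProd, mul_assoc, ← Finset.prod_mul_distrib, integral_const_mul]
    rw [unif_eq_pi, boxMeas]
    have h1 := integral_fintype_prod_eq_prod (μ := fun _ : Fin d => surf n)
      (fun i (z : Sph n) => (inner ℝ (x i : EuclideanSpace ℝ (Fin n)) (z : EuclideanSpace ℝ (Fin n))) ^ a i *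
        Y (p.1 i) (p.2 i) z)
    have h2 := integral_fintype_prod_eq_prod (μ := fun _ : Fin d => lineMeas n)
      (fun i t => t ^ a i * (gegenbauer n (p.1 i)).eval t)
    simp only [dots]
    rw [h1, h2, ← Finset.prod_mul_distrib]
    congr 1
    refine Finset.prod_congr rfl fun i _ => ?_
    have := integral_polynomial_inner_mul hn (Polynomial.X ^ a i) (hY.mem (p.1 i) (p.2 i)) (x i)
    simpa using this

/-- Polynomials are dense in `L¹` of the distribution of the dot products. -/
theorem exists_mvPolynomial_integral_sub_le (hn : 2 ≤ n) {g : (Fin d → ℝ) → ℝ}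
    (hg : Integrable g (boxMeas n d)) {ε : ℝ} (hε : 0 < ε) :
    ∃ φ : MvPolynomial (Fin d) ℝ, ∫ t, |g t - eval t φ| ∂(boxMeas n d) ≤ ε := by
  have := isFiniteMeasure_boxMeas hn d
  obtain ⟨g₀, hg₀, hg₀i⟩ := hg.exists_boundedContinuous_integral_sub_le (half_pos hε)
  have : CompactSpace (cube d) := isCompact_iff_compactSpace.1 (isCompact_cube d)
  let Φ : MvPolynomial (Fin d) ℝ →ₐ[ℝ] C(cube d, ℝ) :=
    MvPolynomial.aeval fun i => ⟨fun t => (t : Fin d → ℝ) i, (continuous_apply i).comp continuous_subtype_val⟩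
  have hΦ : ∀ φ (t : cube d), Φ φ t = eval (t : Fin d → ℝ) φ := by
    intro φ t
    induction φ using MvPolynomial.induction_on with
    | C a => simp [Φ]
    | add p q hp hq => simp [hp, hq]
    | mul_X p i hp => simp [hp, Φ]
  have hsep : Φ.range.SeparatesPoints := by
    intro s t hst
    obtain ⟨i, hi⟩ := Function.ne_iff.1 (fun h => hst (Subtype.ext h))
    refine ⟨_, ⟨Φ (X i), ⟨X i, rfl⟩, rfl⟩, ?_⟩
    simpa [hΦ] using hi
  set M := (boxMeas n d).real Set.univ
  have hM : 0 ≤ M := measureReal_nonneg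
  -- Integrated over total mass `M`, a uniform error ε / 2 / (M + 1) costs at most ε / 2; the 1
  -- guards against division by zero.
  obtain ⟨⟨_, φ, rfl⟩, hφ⟩ := ContinuousMap.exists_mem_subalgebra_near_continuousMap_of_separatesPoints
    Φ.range hsep (g₀.toContinuousMap.restrict (cube d)) (ε / 2 / (M + 1)) (by positivity)
  refine ⟨φ, ?_⟩
  have hφi : Integrable (fun t => eval t φ) (boxMeas n d) :=
    integrable_boxMeas_of_continuousOn hn (MvPolynomial.continuous_eval φ).continuousOn
  have h2 : ∫ t, |g₀ t - eval t φ| ∂(boxMeas n d) ≤ ε / 2 := by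
    have h3 : ∀ᵐ t ∂(boxMeas n d), |g₀ t - eval t φ| ≤ ε / 2 / (M + 1) := by
      filter_upwards [ae_mem_cube hn d] with t ht
      have := (ContinuousMap.norm_coe_le_norm _ (⟨t, ht⟩ : cube d)).trans hφ.le
      rw [abs_sub_comm]
      simpa [hΦ] using this
    calc ∫ t, |g₀ t - eval t φ| ∂(boxMeas n d) ≤ ∫ t, ε / 2 / (M + 1) ∂(boxMeas n d) :=
          integral_mono_ae (hg₀i.sub hφi).abs (integrable_const _) h3
      _ = M * (ε / 2 / (M + 1)) := by rw [integral_const, smul_eq_mul]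
      _ ≤ ε / 2 := by
          rw [mul_div_left_comm]
          refine mul_le_of_le_one_right (by positivity) ?_
          rw [div_le_one (by positivity)]
          linarith
  calc ∫ t, |g t - eval t φ| ∂(boxMeas n d)
      ≤ ∫ t, (|g t - g₀ t| + |g₀ t - eval t φ|) ∂(boxMeas n d) :=
        integral_mono (hg.sub hφi).abs ((hg.sub hg₀i).abs.add (hg₀i.sub hφi).abs)
          fun t => abs_sub_le _ _ _
    _ = (∫ t, |g t - g₀ t| ∂(boxMeas n d)) + ∫ t, |g₀ t - eval t φ| ∂(boxMeas n d) :=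
        integral_add (hg.sub hg₀i).abs (hg₀i.sub hφi).abs
    _ ≤ ε / 2 + ε / 2 := add_le_add hg₀ h2
    _ = ε := by ring

theorem IsSHBasis.exists_shProd_bound (hY : IsSHBasis n Y) (p : SHIndex n d) :
    ∃ M, 0 ≤ M ∧ ∀ x, |shProd Y p x| ≤ M := by
  obtain ⟨M, hM⟩ := isCompact_univ.exists_bound_of_continuousOn
    (hY.continuous_shProd p).continuousOn
  exact ⟨max M 0, le_max_right _ _, fun x => (hM x trivial).trans (le_max_left _ _)⟩

theorem integrable_comp_dots (hn : 2 ≤ n) {g : (Fin d → ℝ) → ℝ} (hg : Integrable g (boxMeas n d))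
    (x : MS n d) : Integrable (fun z => g (dots x z)) (unif n d) :=
  (measurePreserving_dots hn x).integrable_comp_of_integrable hg

theorem integral_comp_dots (hn : 2 ≤ n) {g : (Fin d → ℝ) → ℝ}
    (hg : AEStronglyMeasurable g (boxMeas n d)) (x : MS n d) :
    ∫ z, g (dots x z) ∂(unif n d) = ∫ t, g t ∂(boxMeas n d) := by
  rw [← map_dots_unif hn x] at hg ⊢
  exact (integral_map (measurable_dots x).aemeasurable hg).symm

theorem IsSHBasis.integrable_comp_dots_mul (hn : 2 ≤ n) (hY : IsSHBasis n Y)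
    {g : (Fin d → ℝ) → ℝ} (hg : Integrable g (boxMeas n d)) (p : SHIndex n d) (x : MS n d) :
    Integrable (fun z => g (dots x z) * shProd Y p z) (unif n d) := by
  obtain ⟨M, _, hM⟩ := hY.exists_shProd_bound p
  exact (integrable_comp_dots hn hg x).mul_bdd (c := M)
    (hY.continuous_shProd p).aestronglyMeasurable (.of_forall hM)

/-- The Funk–Hecke formula on the multisphere. -/
theorem IsSHBasis.integral_comp_dots_mul (hn : 2 ≤ n) (hY : IsSHBasis n Y)
    {g : (Fin d → ℝ) → ℝ} (hg : Integrable g (boxMeas n d)) (p : SHIndex n d) (x : MS n d) :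
    ∫ z, g (dots x z) * shProd Y p z ∂(unif n d) = eigval n g p.1 * shProd Y p x := by
  rw [eigval_eq_integral hn]
  obtain ⟨M, hM0, hM⟩ := hY.exists_shProd_bound p
  obtain ⟨N, hN⟩ := (isCompact_cube d).exists_bound_of_continuousOn
    (continuous_gegProd (n := n) p.1).continuousOn
  have hN0 : 0 ≤ N := (norm_nonneg _).trans (hN 0 (by simp [mem_cube]))
  rw [← sub_eq_zero]
  by_contra hne
  -- The defect `D` vanishes for polynomials, so it is controlled by the L¹ distance from g to any
  -- polynomial.
  set D := ∫ z, g (dots x z) * shProd Y p z ∂(unif n d) -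
    (∫ t, g t * gegProd n p.1 t ∂(boxMeas n d)) * shProd Y p x with hD
  have hpos : 0 < |D| := abs_pos.2 hne
  -- |D| is at most (M + N M) times the L¹ error: `M` bounds the SH-product and `N` the Gegenbauer
  -- product. The added 1 makes `B` positive, and an error of |D| / (2B) forces |D| ≤ |D| / 2.
  set B := M + N * M + 1 with hB
  have hB0 : 0 < B := by positivity
  obtain ⟨φ, hφ⟩ := exists_mvPolynomial_integral_sub_le hn hg (ε := |D| / (2 * B)) (by positivity)
  have hφi : Integrable (fun t => eval t φ) (boxMeas n d) :=
    integrable_boxMeas_of_continuousOn hn (MvPolynomial.continuous_eval φ).continuousOn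
  have hgφ : Integrable (fun t => g t - eval t φ) (boxMeas n d) := hg.sub hφi
  have e1 : ∫ z, g (dots x z) * shProd Y p z ∂(unif n d) -
      ∫ z, eval (dots x z) φ * shProd Y p z ∂(unif n d) =
      ∫ z, (g (dots x z) - eval (dots x z) φ) * shProd Y p z ∂(unif n d) := by
    rw [← integral_sub (hY.integrable_comp_dots_mul hn hg p x)
      (hY.integrable_comp_dots_mul hn hφi p x)]
    simp only [sub_mul]
  have e2 : ∫ t, g t * gegProd n p.1 t ∂(boxMeas n d) -
      ∫ t, eval t φ * gegProd n p.1 t ∂(boxMeas n d) =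
      ∫ t, (g t - eval t φ) * gegProd n p.1 t ∂(boxMeas n d) := by
    rw [← integral_sub (integrable_boxMeas_mul hn hg (continuous_gegProd _))
      (integrable_boxMeas_mul hn hφi (continuous_gegProd _))]
    simp only [sub_mul]
  have b1 : |∫ z, (g (dots x z) - eval (dots x z) φ) * shProd Y p z ∂(unif n d)| ≤
      M * ∫ t, |g t - eval t φ| ∂(boxMeas n d) := by
    rw [← integral_comp_dots hn (g := fun t => |g t - eval t φ|) hgφ.abs.aestronglyMeasurable x, ← integral_const_mul]
    refine abs_integral_le_integral_abs.trans (integral_mono_of_nonneg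
      (.of_forall fun z => abs_nonneg _) ((integrable_comp_dots hn hgφ.abs x).const_mul M)
      (.of_forall fun z => ?_))
    simp only [abs_mul]
    rw [mul_comm]
    exact mul_le_mul_of_nonneg_right (hM z) (abs_nonneg _)
  have b2 : |∫ t, (g t - eval t φ) * gegProd n p.1 t ∂(boxMeas n d)| ≤
      N * ∫ t, |g t - eval t φ| ∂(boxMeas n d) := by
    rw [← integral_const_mul]
    refine abs_integral_le_integral_abs.trans (integral_mono_of_nonneg
      (.of_forall fun z => abs_nonneg _) (hgφ.abs.const_mul N) ?_)
    filter_upwards [ae_mem_cube hn d] with t ht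
    simp only [abs_mul]
    rw [mul_comm]
    exact mul_le_mul_of_nonneg_right (hN t ht) (abs_nonneg _)
  have hDeq : D = ∫ z, (g (dots x z) - eval (dots x z) φ) * shProd Y p z ∂(unif n d) -
      (∫ t, (g t - eval t φ) * gegProd n p.1 t ∂(boxMeas n d)) * shProd Y p x := by
    rw [← e1, ← e2, hY.integral_eval_dots_mul hn φ p x, hD]
    ring
  have hI0 : 0 ≤ ∫ t, |g t - eval t φ| ∂(boxMeas n d) := integral_nonneg fun _ => abs_nonneg _
  have hfin : |D| ≤ |D| / 2 := by
    calc |D| ≤ |∫ z, (g (dots x z) - eval (dots x z) φ) * shProd Y p z ∂(unif n d)| +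
          |∫ t, (g t - eval t φ) * gegProd n p.1 t ∂(boxMeas n d)| * |shProd Y p x| := by
          rw [← abs_mul, hDeq]
          exact abs_sub _ _
      _ ≤ M * (∫ t, |g t - eval t φ| ∂(boxMeas n d)) +
          N * (∫ t, |g t - eval t φ| ∂(boxMeas n d)) * M :=
          add_le_add b1 (mul_le_mul b2 (hM x) (abs_nonneg _) (by positivity))
      _ = (M + N * M) * ∫ t, |g t - eval t φ| ∂(boxMeas n d) := by ring
      _ ≤ B * (|D| / (2 * B)) := mul_le_mul (by linarith) hφ hI0 hB0.le
      _ = |D| / 2 := by field_simp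
  linarith

end MultiDot

end

/-! ### The integral operator and the expansion in L² -/

noncomputable section

namespace MultiDot

open Filter Topology

variable {n d : ℕ} {Y : (k : ℕ) → Fin (numHarm n k) → Sph n → ℝ}

/-- Every section in the second variable has law `boxMeas`, so null sets pull back to null sets.
This carries the almost everywhere measurability of κ over to K. -/
theorem quasiMeasurePreserving_dots (hn : 2 ≤ n) :
    Measure.QuasiMeasurePreserving (fun w : MS n d × MS n d => dots w.1 w.2)
      ((unif n d).prod (unif n d)) (boxMeas n d) := by
  refine ⟨continuous_dots.measurable, Measure.AbsolutelyContinuous.mk fun s hs h0 => ?_⟩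
  rw [Measure.map_apply continuous_dots.measurable hs,
    Measure.measure_prod_null (continuous_dots.measurable hs)]
  refine .of_forall fun x => ?_
  change unif n d (dots x ⁻¹' s) = 0
  rw [(measurePreserving_dots hn x).measure_preimage hs.nullMeasurableSet, h0]

theorem aestronglyMeasurable_comp_dots (hn : 2 ≤ n) {g : (Fin d → ℝ) → ℝ}
    (hg : AEStronglyMeasurable g (boxMeas n d)) :
    AEStronglyMeasurable (fun w : MS n d × MS n d => g (dots w.1 w.2))
      ((unif n d).prod (unif n d)) :=
  hg.comp_quasiMeasurePreserving (quasiMeasurePreserving_dots hn)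

/-- By symmetry of the dot products the integral of |g| over x does not depend on z, so Tonelli
needs only g and f in L¹. -/
theorem integrable_prod_comp_dots_mul (hn : 2 ≤ n) {g : (Fin d → ℝ) → ℝ}
    (hg : Integrable g (boxMeas n d)) {f : MS n d → ℝ} (hf : Integrable f (unif n d)) :
    Integrable (fun w : MS n d × MS n d => g (dots w.1 w.2) * f w.2)
      ((unif n d).prod (unif n d)) := by
  rw [integrable_prod_iff' ((aestronglyMeasurable_comp_dots hn hg.aestronglyMeasurable).fun_mul
    hf.aestronglyMeasurable.comp_snd)]
  constructor
  · refine .of_forall fun z => ?_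
    simp only [fun x : MS n d => dots_comm x z]
    exact (integrable_comp_dots hn hg z).mul_const _
  · simp only [fun x z : MS n d => dots_comm x z, norm_mul, integral_mul_const]
    have : ∀ z : MS n d, ∫ x, ‖g (dots z x)‖ ∂(unif n d) = ∫ t, ‖g t‖ ∂(boxMeas n d) := fun z =>
      integral_comp_dots hn hg.norm.aestronglyMeasurable z
    simp only [this]
    exact hf.norm.const_mul _

/-- Fubini and the symmetry of the kernel move the operator onto the SH-product. This computes the
coefficients of Tf and so excludes further eigenvalues. -/
theorem IsSHBasis.integral_integral_comp_dots_mul (hn : 2 ≤ n) (hY : IsSHBasis n Y)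
    {g : (Fin d → ℝ) → ℝ} (hg : Integrable g (boxMeas n d)) {f : MS n d → ℝ}
    (hf : Integrable f (unif n d)) (p : SHIndex n d) :
    ∫ x, (∫ z, g (dots x z) * f z ∂(unif n d)) * shProd Y p x ∂(unif n d) =
      eigval n g p.1 * ∫ z, f z * shProd Y p z ∂(unif n d) := by
  obtain ⟨M, _, hM⟩ := hY.exists_shProd_bound p
  have hi : Integrable (fun w : MS n d × MS n d => g (dots w.1 w.2) * f w.2 * shProd Y p w.1)
      ((unif n d).prod (unif n d)) :=
    (integrable_prod_comp_dots_mul hn hg hf).mul_bdd (c := M)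
      ((hY.continuous_shProd p).comp continuous_fst).aestronglyMeasurable
      (.of_forall fun w => hM w.1)
  simp only [← integral_mul_const, ← integral_const_mul]
  rw [integral_integral_swap hi]
  refine integral_congr_ae (.of_forall fun z => ?_)
  beta_reduce
  have h := hY.integral_comp_dots_mul hn hg p z
  rw [mul_left_comm, ← h, ← integral_const_mul]
  refine integral_congr_ae (.of_forall fun x => ?_)
  beta_reduce
  rw [dots_comm x z]
  ring

theorem IsSHBasis.exists_shProd_ne_zero (hn : 2 ≤ n) (hY : IsSHBasis n Y) (p : SHIndex n d) :
    shProd Y p ≠ 0 := by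
  intro h
  have := hY.integral_shProd_mul hn p p
  simp [h] at this

/-! ### Norms in `L²` -/

theorem norm_sq_toLp {f : MS n d → ℝ} (hf : MemLp f 2 (unif n d)) :
    ‖hf.toLp f‖ ^ 2 = ∫ x, f x ^ 2 ∂(unif n d) := by
  rw [← real_inner_self_eq_norm_sq, L2.inner_def]
  refine integral_congr_ae ?_
  filter_upwards [hf.coeFn_toLp] with x hx
  rw [hx]
  simp [sq]

theorem memLp_of_continuous {f : MS n d → ℝ} (hf : Continuous f) : MemLp f 2 (unif n d) :=
  hf.memLp_of_hasCompactSupport (HasCompactSupport.of_compactSpace f)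

theorem IsSHBasis.inner_shLp_toLp (hY : IsSHBasis n Y) (p : SHIndex n d) {f : MS n d → ℝ}
    (hf : MemLp f 2 (unif n d)) :
    inner ℝ (hY.shLp p) (hf.toLp f) = ∫ x, f x * shProd Y p x ∂(unif n d) := by
  rw [hY.inner_shLp]
  refine integral_congr_ae ?_
  filter_upwards [hf.coeFn_toLp] with x hx
  rw [hx]

/-- The Parseval identity. -/
theorem IsSHBasis.hasSum_sq (hn : 2 ≤ n) (hY : IsSHBasis n Y) {f : MS n d → ℝ}
    (hf : MemLp f 2 (unif n d)) :
    HasSum (fun p : SHIndex n d => (∫ x, f x * shProd Y p x ∂(unif n d)) ^ 2)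
      (∫ x, f x ^ 2 ∂(unif n d)) := by
  have h := (hY.hilbertBasis hn).hasSum_inner_mul_inner (hf.toLp f) (hf.toLp f)
  rw [real_inner_self_eq_norm_sq, norm_sq_toLp, hY.coe_hilbertBasis hn] at h
  refine h.congr_fun fun p => ?_
  rw [real_inner_comm, hY.inner_shLp_toLp p hf, sq]

/-- Pythagoras for the orthogonal projection onto finitely many SH-products. -/
theorem IsSHBasis.integral_sub_sum_sq (hn : 2 ≤ n) (hY : IsSHBasis n Y) {f : MS n d → ℝ}
    (hf : MemLp f 2 (unif n d)) (s : Finset (SHIndex n d)) :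
    ∫ x, (f x - ∑ p ∈ s, (∫ z, f z * shProd Y p z ∂(unif n d)) * shProd Y p x) ^ 2 ∂(unif n d) =
      ∫ x, f x ^ 2 ∂(unif n d) - ∑ p ∈ s, (∫ z, f z * shProd Y p z ∂(unif n d)) ^ 2 := by
  set c : SHIndex n d → ℝ := fun p => ∫ z, f z * shProd Y p z ∂(unif n d) with hc
  have hS : MemLp (fun x => ∑ p ∈ s, c p * shProd Y p x) 2 (unif n d) :=
    memLp_of_continuous (continuous_finsetSum _ fun p _ =>
      continuous_const.mul (hY.continuous_shProd p))
  have hSe : hS.toLp _ = ∑ p ∈ s, c p • hY.shLp p := by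
    have : ∑ p ∈ s, c p • hY.shLp p =
        ContinuousMap.toLp 2 (unif n d) ℝ (∑ p ∈ s, c p • hY.shCM p) := by
      rw [map_sum]
      simp only [map_smul]
      rfl
    rw [this]
    refine Lp.ext ?_
    filter_upwards [hS.coeFn_toLp, ContinuousMap.coeFn_toLp (p := 2) (𝕜 := ℝ) (unif n d)
      (∑ p ∈ s, c p • hY.shCM p)] with x h1 h2
    rw [h1, h2, ContinuousMap.coe_sum, Finset.sum_apply]
    rfl
  have hin : ∀ p, inner ℝ (hY.shLp p) (hf.toLp f) = c p := fun p => hY.inner_shLp_toLp p hf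
  have hsub := norm_sq_toLp (hf.sub hS)
  simp only [Pi.sub_apply] at hsub
  rw [← norm_sq_toLp hf, ← hsub, MemLp.toLp_sub hf hS, hSe,
    norm_sub_sq_real, ← real_inner_self_eq_norm_sq (∑ p ∈ s, c p • hY.shLp p),
    (hY.orthonormal_shLp hn).inner_sum, inner_sum]
  simp only [inner_smul_right, real_inner_comm (hY.shLp _) (hf.toLp f), hin]
  simp only [conj_trivial, ← sq]
  ring

/-! ### The Mercer decomposition in `L²` -/

theorem memLp_comp_dots (hn : 2 ≤ n) {g : (Fin d → ℝ) → ℝ}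
    (hg : AEStronglyMeasurable g (boxMeas n d)) (hg2 : Integrable (fun t => g t ^ 2) (boxMeas n d))
    (x : MS n d) : MemLp (fun z => g (dots x z)) 2 (unif n d) := by
  rw [memLp_two_iff_integrable_sq]
  · exact integrable_comp_dots hn hg2 x
  · exact hg.comp_measurePreserving (measurePreserving_dots hn x)

theorem memLp_prod_comp_dots (hn : 2 ≤ n) {g : (Fin d → ℝ) → ℝ}
    (hg : AEStronglyMeasurable g (boxMeas n d))
    (hg2 : Integrable (fun t => g t ^ 2) (boxMeas n d)) :
    MemLp (fun w : MS n d × MS n d => g (dots w.1 w.2)) 2 ((unif n d).prod (unif n d)) := by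
  rw [memLp_two_iff_integrable_sq (aestronglyMeasurable_comp_dots hn hg)]
  have := integrable_prod_comp_dots_mul hn hg2 (integrable_const (μ := unif n d) (1 : ℝ))
  simpa using this

/-- By Funk–Hecke the section K(x,·) has coefficients λ Y(x), and its squared norm `C` is the same
for all x. Parseval is then integrated over x, using ∫ Y² = 1. -/
theorem IsSHBasis.hasSum_eigval_sq (hn : 2 ≤ n) (hY : IsSHBasis n Y) {g : (Fin d → ℝ) → ℝ}
    (hg : Integrable g (boxMeas n d)) (hg2 : Integrable (fun t => g t ^ 2) (boxMeas n d)) :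
    HasSum (fun p : SHIndex n d => eigval n g p.1 ^ 2)
      (∫ _ : MS n d, (∫ t, g t ^ 2 ∂(boxMeas n d)) ∂(unif n d)) := by
  set C := ∫ t, g t ^ 2 ∂(boxMeas n d)
  have hx : ∀ x : MS n d, HasSum (fun p : SHIndex n d => (eigval n g p.1 * shProd Y p x) ^ 2) C := by
    intro x
    have h := hY.hasSum_sq hn (memLp_comp_dots hn hg.aestronglyMeasurable hg2 x)
    rw [integral_comp_dots hn hg2.aestronglyMeasurable x] at h
    simpa only [hY.integral_comp_dots_mul hn hg] using h
  have hintg : ∀ p : SHIndex n d, ∫ x, (eigval n g p.1 * shProd Y p x) ^ 2 ∂(unif n d) =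
      eigval n g p.1 ^ 2 := by
    intro p
    have := hY.integral_shProd_mul hn p p
    simp only [mul_pow, integral_const_mul]
    simp only [if_true, ← sq] at this
    rw [this, mul_one]
  have hInt : ∀ p : SHIndex n d,
      Integrable (fun x => (eigval n g p.1 * shProd Y p x) ^ 2) (unif n d) := fun p =>
    integrable_of_continuous_ms ((continuous_const.mul (hY.continuous_shProd p)).pow 2)
  -- Summability comes first, from the bound on finite partial sums; it justifies exchanging sum and
  -- integral.
  have hsum : Summable fun p : SHIndex n d => eigval n g p.1 ^ 2 := by
    refine summable_of_sum_le (c := ∫ _ : MS n d, C ∂(unif n d)) (fun p => sq_nonneg _) fun s => ?_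
    rw [← Finset.sum_congr rfl fun p _ => hintg p, ← integral_finsetSum _ fun p _ => hInt p]
    exact integral_mono (integrable_finsetSum _ fun p _ => hInt p) (integrable_const C)
      fun x => sum_le_hasSum s (fun p _ => sq_nonneg _) (hx x)
  have h := hasSum_integral_of_summable_integral_norm hInt (by
    simpa only [Real.norm_of_nonneg (sq_nonneg _), hintg] using hsum)
  simp only [hintg, (hx _).tsum_eq] at h
  exact h

/-- Pythagoras on each section, integrated over x, shows that the squared error is the total sum of
the λ² minus its partial sum. -/
theorem IsSHBasis.tendsto_eLpNorm_sub_sum (hn : 2 ≤ n) (hY : IsSHBasis n Y)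
    {g : (Fin d → ℝ) → ℝ} (hg : Integrable g (boxMeas n d))
    (hg2 : Integrable (fun t => g t ^ 2) (boxMeas n d)) :
    Tendsto (fun s : Finset (SHIndex n d) => eLpNorm
          (fun w : MS n d × MS n d => g (dots w.1 w.2) -
            ∑ p ∈ s, eigval n g p.1 * shProd Y p w.1 * shProd Y p w.2) 2
          ((unif n d).prod (unif n d))) atTop (𝓝 0) := by
  set C := ∫ t, g t ^ 2 ∂(boxMeas n d)
  have hD : ∀ s : Finset (SHIndex n d), MemLp (fun w : MS n d × MS n d => g (dots w.1 w.2) -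
            ∑ p ∈ s, eigval n g p.1 * shProd Y p w.1 * shProd Y p w.2) 2
          ((unif n d).prod (unif n d)) := fun s => by
    refine (memLp_prod_comp_dots hn hg.aestronglyMeasurable hg2).sub ?_
    have hc : Continuous fun w : MS n d × MS n d =>
        ∑ p ∈ s, eigval n g p.1 * shProd Y p w.1 * shProd Y p w.2 :=
      continuous_finsetSum _ fun p _ => (continuous_const.mul
        ((hY.continuous_shProd p).comp continuous_fst)).mul
        ((hY.continuous_shProd p).comp continuous_snd)
    exact hc.memLp_of_hasCompactSupport (HasCompactSupport.of_compactSpace _)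
  have hintg : ∀ s : Finset (SHIndex n d), ∫ w : MS n d × MS n d, (g (dots w.1 w.2) -
            ∑ p ∈ s, eigval n g p.1 * shProd Y p w.1 * shProd Y p w.2) ^ 2
          ∂((unif n d).prod (unif n d)) =
      (∫ _ : MS n d, C ∂(unif n d)) - ∑ p ∈ s, eigval n g p.1 ^ 2 := by
    intro s
    rw [integral_prod _ (hD s).integrable_sq]
    have h1 : ∀ x : MS n d, ∫ z, (g (dots x z) -
        ∑ p ∈ s, eigval n g p.1 * shProd Y p x * shProd Y p z) ^ 2 ∂(unif n d) =
        C - ∑ p ∈ s, eigval n g p.1 ^ 2 * shProd Y p x ^ 2 := by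
      intro x
      have h := hY.integral_sub_sum_sq hn (memLp_comp_dots hn hg.aestronglyMeasurable hg2 x) s
      rw [integral_comp_dots hn hg2.aestronglyMeasurable x] at h
      simpa only [hY.integral_comp_dots_mul hn hg, mul_pow] using h
    have hInt : ∀ p : SHIndex n d,
        Integrable (fun x => eigval n g p.1 ^ 2 * shProd Y p x ^ 2) (unif n d) := fun p =>
      integrable_of_continuous_ms (continuous_const.mul ((hY.continuous_shProd p).pow 2))
    simp only [h1]
    rw [integral_sub (integrable_const _) (integrable_finsetSum _ fun p _ => hInt p),
      integral_finsetSum _ fun p _ => hInt p]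
    congr 1
    refine Finset.sum_congr rfl fun p _ => ?_
    have := hY.integral_shProd_mul hn p p
    simp only [if_true, ← sq] at this
    rw [integral_const_mul, this, mul_one]
  have hlim : Tendsto (fun s : Finset (SHIndex n d) =>
      (∫ _ : MS n d, C ∂(unif n d)) - ∑ p ∈ s, eigval n g p.1 ^ 2) atTop (𝓝 0) := by
    have := (hY.hasSum_eigval_sq hn hg hg2).const_sub (∫ _ : MS n d, C ∂(unif n d))
    rwa [sub_self] at this
  have hfin : Tendsto (fun s : Finset (SHIndex n d) => ENNReal.ofReal
      (((∫ _ : MS n d, C ∂(unif n d)) - ∑ p ∈ s, eigval n g p.1 ^ 2) ^ ((2 : ℝ)⁻¹)))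
      atTop (𝓝 0) := by
    have h := ENNReal.tendsto_ofReal (hlim.rpow_const (p := (2 : ℝ)⁻¹) (Or.inr (by norm_num)))
    rwa [Real.zero_rpow (by norm_num), ENNReal.ofReal_zero] at h
  refine hfin.congr fun s => ?_
  rw [(hD s).eLpNorm_eq_integral_rpow_norm (by norm_num) (by norm_num), ← hintg s]
  simp

end MultiDot

end

/-! ### Uniform convergence and Mercer's argument -/

noncomputable section

namespace MultiDot

open Filter Topology

variable {n d : ℕ} {Y : (k : ℕ) → Fin (numHarm n k) → Sph n → ℝ}

/-! ### A criterion for uniform convergence -/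

/-- The value of `∑ j, Y_{k,j}(x)²`, which does not depend on `x`. -/
def sumSq (n : ℕ) (k : Fin d → ℕ) : ℝ := ∏ i, (gegNorm n (k i))⁻¹

theorem IsSHBasis.sumSq_pos (hn : 2 ≤ n) (hY : IsSHBasis n Y) (k : Fin d → ℕ) : 0 < sumSq n k :=
  Finset.prod_pos fun _ _ => inv_pos.2 (hY.gegNorm_pos hn _)

theorem IsSHBasis.sum_shProd_sq (hn : 2 ≤ n) (hY : IsSHBasis n Y) (k : Fin d → ℕ) (x : MS n d) :
    ∑ j : (i : Fin d) → Fin (numHarm n (k i)), shProd Y ⟨k, j⟩ x ^ 2 = sumSq n k := by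
  simp only [sumSq, shProd, ← Finset.prod_pow]
  rw [← Finset.prod_congr rfl fun i _ => hY.sum_sq hn (k i) (x i), Finset.prod_univ_sum,
    Fintype.piFinset_univ]

/-- Adding the missing phases of every frequency vector that occurs only increases the sum and makes
it independent of x. -/
theorem IsSHBasis.sum_abs_mul_sq_le (hn : 2 ≤ n) (hY : IsSHBasis n Y) (c : (Fin d → ℕ) → ℝ)
    (t : Finset (SHIndex n d)) (x : MS n d) :
    ∑ p ∈ t, |c p.1| * shProd Y p x ^ 2 ≤ ∑ k ∈ t.image Sigma.fst, |c k| * sumSq n k := by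
  classical
  calc ∑ p ∈ t, |c p.1| * shProd Y p x ^ 2
      ≤ ∑ p ∈ (t.image Sigma.fst).sigma fun _ => Finset.univ, |c p.1| * shProd Y p x ^ 2 := by
        refine Finset.sum_le_sum_of_subset_of_nonneg (fun p hp => ?_) fun p _ _ => by positivity
        exact Finset.mem_sigma.2 ⟨Finset.mem_image_of_mem _ hp, Finset.mem_univ _⟩
    _ = _ := by
        rw [Finset.sum_sigma]
        refine Finset.sum_congr rfl fun k _ => ?_
        dsimp only
        rw [← Finset.mul_sum, hY.sum_shProd_sq hn k x]

/-- The terms of the decomposition as continuous maps. -/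
def IsSHBasis.termCM (hY : IsSHBasis n Y) (c : (Fin d → ℕ) → ℝ) (p : SHIndex n d) :
    C(MS n d × MS n d, ℝ) where
  toFun w := c p.1 * shProd Y p w.1 * shProd Y p w.2
  continuous_toFun := (continuous_const.mul
        ((hY.continuous_shProd p).comp continuous_fst)).mul
        ((hY.continuous_shProd p).comp continuous_snd)

/-- Sup norms of single terms are not summed; the Cauchy criterion is checked on whole blocks, where
2|ab| ≤ a² + b² reduces the sum to the diagonal at each of the two points. -/
theorem IsSHBasis.summable_termCM (hn : 2 ≤ n) (hY : IsSHBasis n Y) {c : (Fin d → ℕ) → ℝ}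
    (hc : Summable fun k => |c k| * sumSq n k) : Summable (hY.termCM c) := by
  classical
  rw [summable_iff_vanishing_norm] at hc ⊢
  intro ε hε
  obtain ⟨F, hF⟩ := hc ε hε
  -- All phases over `F` are included, so a disjoint finite set involves only frequency vectors
  -- outside `F`.
  refine ⟨F.sigma fun _ => Finset.univ, fun t ht => ?_⟩
  have hdisj : Disjoint (t.image Sigma.fst) F := by
    rw [Finset.disjoint_left]
    intro k hk hkF
    obtain ⟨p, hp, rfl⟩ := Finset.mem_image.1 hk
    exact Finset.disjoint_left.1 ht hp (Finset.mem_sigma.2 ⟨hkF, Finset.mem_univ _⟩)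
  have hlt := (le_abs_self _).trans_lt (hF _ hdisj)
  rw [ContinuousMap.norm_lt_iff _ hε]
  intro w
  rw [ContinuousMap.coe_sum, Finset.sum_apply]
  refine lt_of_le_of_lt ?_ hlt
  have h1 := hY.sum_abs_mul_sq_le hn c t w.1
  have h2 := hY.sum_abs_mul_sq_le hn c t w.2
  have h3 : ‖∑ p ∈ t, hY.termCM c p w‖ ≤
      ∑ p ∈ t, (|c p.1| * shProd Y p w.1 ^ 2 + |c p.1| * shProd Y p w.2 ^ 2) / 2 := by
    refine (norm_sum_le _ _).trans (Finset.sum_le_sum fun p _ => ?_)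
    change |c p.1 * shProd Y p w.1 * shProd Y p w.2| ≤ _
    rw [mul_assoc, abs_mul, ← mul_add, mul_div_assoc]
    refine mul_le_mul_of_nonneg_left ?_ (abs_nonneg _)
    rw [abs_le]
    constructor <;> nlinarith [sq_nonneg (shProd Y p w.1 - shProd Y p w.2),
      sq_nonneg (shProd Y p w.1 + shProd Y p w.2)]
  rw [← Finset.sum_div, Finset.sum_add_distrib] at h3
  linarith

/-- The profile of a continuous multi-dot product kernel, as a continuous map. -/
def kernelCM (n : ℕ) {g : (Fin d → ℝ) → ℝ} (hg : ContinuousOn g (cube d)) :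
    C(MS n d × MS n d, ℝ) where
  toFun w := g (dots w.1 w.2)
  continuous_toFun := hg.comp_continuous continuous_dots fun w => dots_mem_cube w.1 w.2

/-- The series has some uniform limit G, hence the same limit in L², where the limit is already
known to be K. Both are continuous and the measure charges open sets, so they agree everywhere. -/
theorem IsSHBasis.tendstoUniformly (hn : 2 ≤ n) (hY : IsSHBasis n Y) {g : (Fin d → ℝ) → ℝ}
    (hg : ContinuousOn g (cube d)) (hs : Summable fun k => |eigval n g k| * sumSq n k) :
    TendstoUniformly
      (fun (s : Finset (SHIndex n d)) (w : MS n d × MS n d) =>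
        ∑ p ∈ s, eigval n g p.1 * shProd Y p w.1 * shProd Y p w.2)
      (fun w => g (dots w.1 w.2)) atTop := by
  have hgi : Integrable g (boxMeas n d) := integrable_boxMeas_of_continuousOn hn hg
  have hg2 : Integrable (fun t => g t ^ 2) (boxMeas n d) :=
    integrable_boxMeas_of_continuousOn hn (hg.pow 2)
  obtain ⟨G, hG⟩ := hY.summable_termCM hn hs
  set T : C(MS n d × MS n d, ℝ) →L[ℝ] Lp ℝ 2 ((unif n d).prod (unif n d)) :=
    ContinuousMap.toLp 2 ((unif n d).prod (unif n d)) ℝ with hT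
  have h1 : Tendsto (fun s : Finset (SHIndex n d) => T (∑ p ∈ s, hY.termCM (eigval n g) p)) atTop
      (𝓝 (T G)) := (T.continuous.tendsto G).comp hG
  have h2 : Tendsto (fun s : Finset (SHIndex n d) => T (∑ p ∈ s, hY.termCM (eigval n g) p)) atTop
      (𝓝 (T (kernelCM n hg))) := by
    rw [tendsto_iff_edist_tendsto_0]
    refine (hY.tendsto_eLpNorm_sub_sum hn hgi hg2).congr fun s => ?_
    rw [edist_comm, Lp.edist_def]
    refine eLpNorm_congr_ae ?_
    filter_upwards [ContinuousMap.coeFn_toLp (p := 2) (𝕜 := ℝ) ((unif n d).prod (unif n d))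
      (kernelCM n hg), ContinuousMap.coeFn_toLp (p := 2) (𝕜 := ℝ) ((unif n d).prod (unif n d))
      (∑ p ∈ s, hY.termCM (eigval n g) p)] with w e1 e2
    rw [Pi.sub_apply, e1, e2, ContinuousMap.coe_sum, Finset.sum_apply]
    rfl
  have hEq : G = kernelCM n hg :=
    ContinuousMap.toLp_injective ((unif n d).prod (unif n d)) (tendsto_nhds_unique h1 h2)
  have hlim : Tendsto (fun s : Finset (SHIndex n d) => ∑ p ∈ s, hY.termCM (eigval n g) p) atTop
      (𝓝 (kernelCM n hg)) := hEq ▸ hG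
  have hunif := ContinuousMap.tendsto_iff_tendstoUniformly.1 hlim
  simp only [ContinuousMap.coe_sum, Finset.sum_apply] at hunif
  exact hunif

/-! ### Positive semidefinite kernels -/

/-- After rounding the points to finitely many values the double integral is a finite quadratic form
of K, with the integrals of f over the fibres of π as weights. -/
theorem integral_simpleFunc_nonneg {X : Type*} [MeasurableSpace X] {μ : Measure X}
    [IsFiniteMeasure μ] {K : X → X → ℝ} (hK : (Matrix.of K).PosSemidef) {f : X → ℝ}
    (hf : Integrable f μ) (π : SimpleFunc X X) (hπ : ∀ a, MeasurableSet (π ⁻¹' {a})) :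
    0 ≤ ∫ w, K (π w.1) (π w.2) * (f w.1 * f w.2) ∂(μ.prod μ) := by
  classical
  set φ : X → X → ℝ := fun a => (π ⁻¹' {a}).indicator f with hφ
  have hφi : ∀ a, Integrable (φ a) μ := fun a => hf.indicator (hπ a)
  have hpt : ∀ w : X × X, K (π w.1) (π w.2) * (f w.1 * f w.2) =
      ∑ a ∈ π.range, ∑ b ∈ π.range, K a b * (φ a w.1 * φ b w.2) := by
    intro w
    rw [Finset.sum_eq_single (π w.1), Finset.sum_eq_single (π w.2)]
    · simp [hφ]
    · intro b _ hb
      have : φ b w.2 = 0 := Set.indicator_of_notMem (fun h => hb h.symm) _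
      rw [this, mul_zero, mul_zero]
    · exact fun h => (h (π.mem_range_self _)).elim
    · intro a _ ha
      have : φ a w.1 = 0 := Set.indicator_of_notMem (fun h => ha h.symm) _
      simp [this]
    · exact fun h => (h (π.mem_range_self _)).elim
  have hI : ∀ a b, Integrable (fun w : X × X => K a b * (φ a w.1 * φ b w.2)) (μ.prod μ) :=
    fun a b => ((hφi a).mul_prod (hφi b)).const_mul _
  simp only [hpt]
  rw [integral_finsetSum _ fun a _ => integrable_finsetSum _ fun b _ => hI a b]
  simp only [integral_finsetSum _ fun b _ => hI _ b, integral_const_mul]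
  have hm : ∀ a b, ∫ w : X × X, φ a w.1 * φ b w.2 ∂(μ.prod μ) =
      (∫ x, φ a x ∂μ) * ∫ x, φ b x ∂μ := fun a b => integral_prod_mul _ _
  simp only [hm]
  have hzero : ∀ a, ∫ x, φ a x ∂μ ≠ 0 → a ∈ π.range := by
    intro a ha
    by_contra hna
    refine ha ?_
    have : φ a = 0 := by
      ext x
      refine Set.indicator_of_notMem (fun h => hna ?_) _
      have h' : π x = a := h
      exact h' ▸ π.mem_range_self x
    simp [this]
  have h := hK.2 (Finsupp.onFinset π.range (fun a => ∫ x, φ a x ∂μ) hzero)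
  rw [Finsupp.onFinset_sum _ (by simp)] at h
  refine h.trans_eq (Finset.sum_congr rfl fun a _ => ?_)
  rw [Finsupp.onFinset_sum _ (by simp)]
  refine Finset.sum_congr rfl fun b _ => ?_
  simp only [star_trivial, Matrix.of_apply]
  ring

/-- Simple functions converge pointwise to the identity map of the multisphere; dominated
convergence passes to the limit because K is continuous and bounded. -/
theorem integral_posSemidef_nonneg {K : MS n d → MS n d → ℝ} (hn : 2 ≤ n)
    (hK : (Matrix.of K).PosSemidef) (hKc : Continuous fun w : MS n d × MS n d => K w.1 w.2)
    {f : MS n d → ℝ} (hf : Continuous f) :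
    0 ≤ ∫ w : MS n d × MS n d, K w.1 w.2 * (f w.1 * f w.2) ∂((unif n d).prod (unif n d)) := by
  obtain ⟨σ⟩ := nonempty_sph (n := n) (by omega)
  let x₀ : MS n d := fun _ => σ
  let π : ℕ → SimpleFunc (MS n d) (MS n d) := fun N =>
    SimpleFunc.approxOn id measurable_id Set.univ x₀ trivial N
  have hπ : ∀ x, Tendsto (fun N => π N x) atTop (𝓝 x) := fun x =>
    SimpleFunc.tendsto_approxOn measurable_id (Set.mem_univ x₀) (by simp)
  obtain ⟨B, hB⟩ := isCompact_univ.exists_bound_of_continuousOn hKc.continuousOn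
  obtain ⟨C, hC⟩ := isCompact_univ.exists_bound_of_continuousOn hf.continuousOn
  have hB0 : 0 ≤ B := (norm_nonneg _).trans (hB (x₀, x₀) trivial)
  have hC0 : 0 ≤ C := (norm_nonneg _).trans (hC x₀ trivial)
  have hfw : Continuous fun w : MS n d × MS n d => f w.1 * f w.2 :=
    (hf.comp continuous_fst).mul (hf.comp continuous_snd)
  refine ge_of_tendsto' (tendsto_integral_of_dominated_convergence
    (F := fun N (w : MS n d × MS n d) => K (π N w.1) (π N w.2) * (f w.1 * f w.2))
    (fun _ => B * (C * C)) (fun N => ?_) (integrable_const _) (fun N => .of_forall fun w => ?_)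
    (.of_forall fun w => ?_))
    fun N => integral_simpleFunc_nonneg hK (integrable_of_continuous_ms hf) (π N)
      fun a => (π N).measurable (measurableSet_singleton a)
  · have hm : Measurable fun w : MS n d × MS n d => K (π N w.1) (π N w.2) :=
      hKc.measurable.comp (((π N).measurable.comp measurable_fst).prodMk
        ((π N).measurable.comp measurable_snd))
    exact (hm.mul hfw.measurable).aestronglyMeasurable
  · rw [norm_mul, norm_mul]
    exact mul_le_mul (hB (π N w.1, π N w.2) trivial)
      (mul_le_mul (hC _ trivial) (hC _ trivial) (norm_nonneg _) hC0) (by positivity) hB0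
  · refine Tendsto.mul_const _ ?_
    exact (hKc.tendsto w).comp ((hπ w.1).prodMk_nhds (hπ w.2))

/-- Tested on the SH-product itself, the quadratic form equals its eigenvalue. -/
theorem IsSHBasis.eigval_nonneg (hn : 2 ≤ n) (hY : IsSHBasis n Y) {g : (Fin d → ℝ) → ℝ}
    (hg : ContinuousOn g (cube d))
    (hpsd : (Matrix.of fun x z : MS n d => g (dots x z)).PosSemidef) (p : SHIndex n d) :
    0 ≤ eigval n g p.1 := by
  have hgi : Integrable g (boxMeas n d) := integrable_boxMeas_of_continuousOn hn hg
  have h := integral_posSemidef_nonneg hn hpsd (kernelCM n hg).continuous (hY.continuous_shProd p)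
  have hc : Continuous fun w : MS n d × MS n d =>
      g (dots w.1 w.2) * (shProd Y p w.1 * shProd Y p w.2) :=
    (kernelCM n hg).continuous.mul (((hY.continuous_shProd p).comp continuous_fst).mul
        ((hY.continuous_shProd p).comp continuous_snd))
  rw [integral_prod _ (hc.integrable_of_hasCompactSupport (HasCompactSupport.of_compactSpace _))]
    at h
  have h2 : ∀ x : MS n d, ∫ z, g (dots x z) * (shProd Y p x * shProd Y p z) ∂(unif n d) =
      eigval n g p.1 * (shProd Y p x * shProd Y p x) := by
    intro x
    rw [mul_left_comm, ← hY.integral_comp_dots_mul hn hgi p x, ← integral_const_mul]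
    refine integral_congr_ae (.of_forall fun z => ?_)
    beta_reduce
    ring
  simp only [h2] at h
  rw [integral_const_mul, hY.integral_shProd_mul hn p p, if_pos rfl, mul_one] at h
  exact h

theorem memLp_integral_comp_dots_mul {g : (Fin d → ℝ) → ℝ}
    (hg : ContinuousOn g (cube d)) {f : MS n d → ℝ} (hf : Integrable f (unif n d)) :
    MemLp (fun x => ∫ z, g (dots x z) * f z ∂(unif n d)) 2 (unif n d) := by
  refine memLp_of_continuous ?_
  obtain ⟨B, hB⟩ := isCompact_univ.exists_bound_of_continuousOn (kernelCM n hg).continuous.continuousOn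
  refine continuous_of_dominated (bound := fun z => B * ‖f z‖) (fun x => ?_)
    (fun x => .of_forall fun z => ?_) (hf.norm.const_mul _) (.of_forall fun z => ?_)
  · exact ((kernelCM n hg).continuous.comp (Continuous.prodMk_right x)).aestronglyMeasurable.mul
      hf.aestronglyMeasurable
  · rw [norm_mul]
    exact mul_le_mul_of_nonneg_right (hB (x, z) trivial) (norm_nonneg _)
  · exact ((kernelCM n hg).continuous.comp (Continuous.prodMk_left z)).mul continuous_const

/-- The Mercer identity for the quadratic form. -/
theorem IsSHBasis.hasSum_eigval_mul_sq (hn : 2 ≤ n) (hY : IsSHBasis n Y) {g : (Fin d → ℝ) → ℝ}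
    (hg : ContinuousOn g (cube d)) {f : MS n d → ℝ} (hf : MemLp f 2 (unif n d)) :
    HasSum (fun p : SHIndex n d => eigval n g p.1 * (∫ x, f x * shProd Y p x ∂(unif n d)) ^ 2)
      (∫ x, (∫ z, g (dots x z) * f z ∂(unif n d)) * f x ∂(unif n d)) := by
  have hgi : Integrable g (boxMeas n d) := integrable_boxMeas_of_continuousOn hn hg
  have hfi : Integrable f (unif n d) := hf.integrable (by norm_num)
  have hT := memLp_integral_comp_dots_mul hg hfi
  have h := (hY.hilbertBasis hn).hasSum_inner_mul_inner (hT.toLp _) (hf.toLp f)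
  rw [hY.coe_hilbertBasis hn] at h
  have hin : inner ℝ (hT.toLp _) (hf.toLp f) =
      ∫ x, (∫ z, g (dots x z) * f z ∂(unif n d)) * f x ∂(unif n d) := by
    rw [L2.inner_def]
    refine integral_congr_ae ?_
    filter_upwards [hT.coeFn_toLp, hf.coeFn_toLp] with x h1 h2
    rw [h1, h2]
    simp [mul_comm]
  rw [hin] at h
  refine h.congr_fun fun p => ?_
  rw [real_inner_comm, hY.inner_shLp_toLp p hT, hY.inner_shLp_toLp p hf,
    hY.integral_integral_comp_dots_mul hn hgi hfi]
  ring

/-- If the bound failed at x₀, the partial sum kernel would exceed some B' > B on a square U × U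
around (x₀, x₀). In the quadratic form at the indicator of U the discarded terms are nonnegative, so
B' vol(U)² would be at most the integral of g over U × U, hence at most B vol(U)². -/
theorem IsSHBasis.sum_eigval_mul_sq_le (hn : 2 ≤ n) (hY : IsSHBasis n Y) {g : (Fin d → ℝ) → ℝ}
    (hg : ContinuousOn g (cube d))
    (hpsd : (Matrix.of fun x z : MS n d => g (dots x z)).PosSemidef) {B : ℝ}
    (hB : ∀ t ∈ cube d, g t ≤ B) (s : Finset (SHIndex n d)) (x₀ : MS n d) :
    ∑ p ∈ s, eigval n g p.1 * shProd Y p x₀ ^ 2 ≤ B := by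
  by_contra! hlt
  obtain ⟨B', hB', hlt'⟩ := exists_between hlt
  set S : MS n d × MS n d → ℝ := fun w => ∑ p ∈ s, eigval n g p.1 * shProd Y p w.1 * shProd Y p w.2
    with hS
  have hSc : Continuous S := continuous_finsetSum _ fun p _ => (hY.termCM (eigval n g) p).continuous
  have hmem : {w | B' < S w} ∈ 𝓝 (x₀, x₀) := by
    refine (isOpen_lt continuous_const hSc).mem_nhds ?_
    simpa [hS, sq, mul_assoc] using hlt'
  rw [nhds_prod_eq, mem_prod_same_iff] at hmem
  obtain ⟨V, hV, hVS⟩ := hmem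
  obtain ⟨U, hUV, hUo, hxU⟩ := mem_nhds_iff.1 hV
  have hUm : MeasurableSet U := hUo.measurableSet
  set f : MS n d → ℝ := U.indicator 1 with hf
  have hfL : MemLp f 2 (unif n d) := memLp_indicator_const 2 hUm (1 : ℝ) (Or.inr (measure_ne_top _ _))
  have hU0 : 0 < (unif n d).real U :=
    ENNReal.toReal_pos (hUo.measure_pos _ ⟨x₀, hxU⟩).ne' (measure_ne_top _ _)
  have hc : ∀ h : MS n d → ℝ, ∫ x, h x * f x ∂(unif n d) = ∫ x in U, h x ∂(unif n d) := by
    intro h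
    rw [← integral_indicator hUm]
    refine integral_congr_ae (.of_forall fun x => ?_)
    by_cases hx : x ∈ U <;> simp [hf, hx]
  have h1 := sum_le_hasSum s (fun p _ => mul_nonneg (hY.eigval_nonneg hn hg hpsd p) (sq_nonneg _))
    (hY.hasSum_eigval_mul_sq hn hg hfL)
  simp only [hc] at h1
  have hgc : ∀ x : MS n d, Continuous fun z => g (dots x z) := fun x =>
    (kernelCM n hg).continuous.comp (Continuous.prodMk_right x)
  have hub : ∫ x in U, (∫ z in U, g (dots x z) ∂(unif n d)) ∂(unif n d) ≤
      (unif n d).real U * ((unif n d).real U * B) := by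
    have h2 : ∀ x, ∫ z in U, g (dots x z) ∂(unif n d) ≤ (unif n d).real U * B := by
      intro x
      calc ∫ z in U, g (dots x z) ∂(unif n d) ≤ ∫ z in U, B ∂(unif n d) :=
            integral_mono (integrable_of_continuous_ms (hgc x)).integrableOn (integrable_const _)
              fun z => hB _ (dots_mem_cube x z)
        _ = _ := by simp
    have h3 : Integrable (fun x => ∫ z in U, g (dots x z) ∂(unif n d)) (unif n d) := by
      have := (memLp_integral_comp_dots_mul hg (hfL.integrable (by norm_num))).integrable
        (by norm_num)
      simpa only [hc] using this
    calc ∫ x in U, (∫ z in U, g (dots x z) ∂(unif n d)) ∂(unif n d) ≤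
          ∫ x in U, (unif n d).real U * B ∂(unif n d) :=
          integral_mono h3.integrableOn (integrable_const _) h2
      _ = _ := by simp
  have hlb : (unif n d).real U * ((unif n d).real U * B') ≤
      ∑ p ∈ s, eigval n g p.1 * (∫ x in U, shProd Y p x ∂(unif n d)) ^ 2 := by
    have hYi : ∀ p : SHIndex n d, IntegrableOn (shProd Y p) U (unif n d) := fun p =>
      (integrable_of_continuous_ms (hY.continuous_shProd p)).integrableOn
    have h2 : ∀ x ∈ U, (unif n d).real U * B' ≤
        ∑ p ∈ s, eigval n g p.1 * shProd Y p x * ∫ z in U, shProd Y p z ∂(unif n d) := by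
      intro x hx
      have h4 := setIntegral_ge_of_const_le (μ := unif n d) (f := fun z => S (x, z)) (c := B') hUm
        (measure_ne_top _ _) (fun z hz => (hVS (Set.mk_mem_prod (hUV hx) (hUV hz))).le)
        (integrable_of_continuous_ms (hSc.comp (Continuous.prodMk_right x))).integrableOn
      simp only [hS] at h4
      rw [integral_finsetSum _ fun p _ => (hYi p).const_mul _] at h4
      simpa only [integral_const_mul, smul_eq_mul] using h4
    have hintg : Integrable (fun x => ∑ p ∈ s, eigval n g p.1 * shProd Y p x *
        ∫ z in U, shProd Y p z ∂(unif n d)) ((unif n d).restrict U) :=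
      integrable_finsetSum _ fun p _ => ((hYi p).const_mul _).mul_const _
    have h5 := setIntegral_ge_of_const_le hUm (measure_ne_top _ _) h2 hintg
    rw [integral_finsetSum _ fun p _ => ((hYi p).const_mul _).mul_const _] at h5
    refine h5.trans_eq (Finset.sum_congr rfl fun p _ => ?_)
    rw [integral_mul_const, integral_const_mul]
    ring
  have h6 : ∑ p ∈ s, eigval n g p.1 * (∫ x in U, shProd Y p x ∂(unif n d)) ^ 2 ≤
      ∫ x in U, (∫ z in U, g (dots x z) ∂(unif n d)) ∂(unif n d) := by
    simpa only [mul_comm (f _), hc] using h1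
  have h7 := (hlb.trans h6).trans hub
  have h8 := le_of_mul_le_mul_left (le_of_mul_le_mul_left h7 hU0) hU0
  linarith

theorem IsSHBasis.summable_of_posSemidef (hn : 2 ≤ n) (hY : IsSHBasis n Y)
    {g : (Fin d → ℝ) → ℝ} (hg : ContinuousOn g (cube d))
    (hpsd : (Matrix.of fun x z : MS n d => g (dots x z)).PosSemidef) :
    Summable fun k : Fin d → ℕ => |eigval n g k| * sumSq n k := by
  classical
  obtain ⟨σ⟩ := nonempty_sph (n := n) (by omega)
  let x₀ : MS n d := fun _ => σ
  obtain ⟨B, hB⟩ := (isCompact_cube d).exists_bound_of_continuousOn hg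
  refine summable_of_sum_le (c := B) (fun k => mul_nonneg (abs_nonneg _) (hY.sumSq_pos hn k).le)
    fun F => ?_
  have h := hY.sum_eigval_mul_sq_le hn hg hpsd (fun t ht => (le_abs_self _).trans (hB t ht))
    (F.sigma fun _ => Finset.univ) x₀
  rw [Finset.sum_sigma] at h
  refine le_trans (Finset.sum_le_sum fun k _ => ?_) h
  dsimp only
  rw [← Finset.mul_sum, hY.sum_shProd_sq hn k x₀]
  refine mul_le_mul_of_nonneg_right ?_ (hY.sumSq_pos hn k).le
  -- Nonnegativity of the eigenvalue is available only when some phase exists; without phases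
  -- `sumSq` would be an empty sum, contradicting its positivity.
  by_cases hne : Nonempty ((i : Fin d) → Fin (numHarm n (k i)))
  · obtain ⟨j⟩ := hne
    exact (abs_of_nonneg (hY.eigval_nonneg hn hg hpsd ⟨k, j⟩)).le
  · have := hY.sum_shProd_sq hn k x₀
    have hemp : IsEmpty ((i : Fin d) → Fin (numHarm n (k i))) := not_nonempty_iff.1 hne
    rw [Finset.univ_eq_empty, Finset.sum_empty] at this
    exact absurd this (hY.sumSq_pos hn k).ne

end MultiDot

end

noncomputable section

namespace MultiDot

open Filter Topology

variable {n d : ℕ} {Y : (k : ℕ) → Fin (numHarm n k) → Sph n → ℝ}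

/-! ### Power series -/

/-- The convex combinations of Gegenbauer polynomials. -/
def gegHull (n : ℕ) : Set (Polynomial ℝ) :=
  Finsupp.linearCombination ℝ (gegenbauer n) ''
    {a : ℕ →₀ ℝ | (∀ k, 0 ≤ a k) ∧ (a.sum fun _ c => c) = 1}

theorem convex_gegHull (n : ℕ) : Convex ℝ (gegHull n) := by
  refine Convex.linear_image ?_ _
  rintro a ⟨ha, ha1⟩ b ⟨hb, hb1⟩ s t hs ht hst
  refine ⟨fun k => ?_, ?_⟩
  · simpa using add_nonneg (mul_nonneg hs (ha k)) (mul_nonneg ht (hb k))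
  · rw [Finsupp.sum_add_index' (by simp) (by simp), Finsupp.sum_smul_index' (by simp),
      Finsupp.sum_smul_index' (by simp), ← Finsupp.smul_sum, ← Finsupp.smul_sum, ha1, hb1]
    simpa using hst

theorem gegenbauer_mem_gegHull (n k : ℕ) : gegenbauer n k ∈ gegHull n := by
  refine ⟨Finsupp.single k 1, ⟨fun l => ?_, by simp⟩, by simp⟩
  rw [Finsupp.single_apply]
  split_ifs <;> norm_num

/-- Solved for t Q_{k+1}, the recurrence has the weights (k + n - 1) / (2k + n) on Q_{k+2} and (k +
1) / (2k + n) on Q_k, which are positive and add up to 1. -/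
theorem X_mul_gegenbauer_mem_gegHull (hn : 2 ≤ n) (k : ℕ) :
    Polynomial.X * gegenbauer n k ∈ gegHull n := by
  rcases k with _ | k
  · have : (Polynomial.X : Polynomial ℝ) * gegenbauer n 0 = gegenbauer n 1 := by simp [gegenbauer]
    rw [this]
    exact gegenbauer_mem_gegHull n 1
  · have hpos := gegenbauer_denom_pos hn k
    have hk : (0 : ℝ) ≤ k := k.cast_nonneg
    have hpos2 : 0 < 2 * (k : ℝ) + n := by linarith
    have h := convex_gegHull n (gegenbauer_mem_gegHull n (k + 2)) (gegenbauer_mem_gegHull n k)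
      (a := ((k : ℝ) + n - 1) / (2 * k + n)) (b := ((k : ℝ) + 1) / (2 * k + n))
      (by positivity) (by positivity) (by field_simp; ring)
    convert h using 1
    rw [gegenbauer, Polynomial.smul_eq_C_mul, Polynomial.smul_eq_C_mul, ← mul_assoc,
      ← Polynomial.C_mul, mul_sub, ← mul_assoc, ← mul_assoc, ← Polynomial.C_mul, ← mul_assoc,
      ← Polynomial.C_mul]
    have e1 : ((k : ℝ) + n - 1) / (2 * k + n) * ((k : ℝ) + n - 1)⁻¹ * (2 * (k : ℝ) + n) = 1 := by
      field_simp
    have e2 : ((k : ℝ) + n - 1) / (2 * k + n) * ((k : ℝ) + n - 1)⁻¹ * ((k : ℝ) + 1) =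
        ((k : ℝ) + 1) / (2 * k + n) := by
      field_simp
    rw [e1, e2]
    simp

theorem X_pow_mem_gegHull (hn : 2 ≤ n) (m : ℕ) : (Polynomial.X ^ m : Polynomial ℝ) ∈ gegHull n := by
  induction m with
  | zero => simpa [gegenbauer] using gegenbauer_mem_gegHull n 0
  | succ m ih =>
    obtain ⟨a, ⟨ha, ha1⟩, hX⟩ := ih
    rw [pow_succ', ← hX, Finsupp.linearCombination_apply, Finsupp.sum, Finset.mul_sum]
    simp only [mul_smul_comm]
    exact (convex_gegHull n).sum_mem (fun k _ => ha k) ha1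
      fun k _ => X_mul_gegenbauer_mem_gegHull hn k

/-- The a k are the weights of t^m as a convex combination of Gegenbauer polynomials; orthogonality
isolates each of them. -/
theorem exists_integral_pow_mul_gegenbauer (hn : 2 ≤ n) (m : ℕ) :
    ∃ a : ℕ → ℝ, (∀ k, 0 ≤ a k) ∧ (∀ A : Finset ℕ, ∑ k ∈ A, a k ≤ 1) ∧
      ∀ k, ∫ t, t ^ m * (gegenbauer n k).eval t ∂(lineMeas n) = a k * gegNorm n k := by
  obtain ⟨a, ⟨ha, ha1⟩, hX⟩ := X_pow_mem_gegHull hn m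
  refine ⟨a, ha, fun A => ?_, fun k => ?_⟩
  · classical
    rw [← ha1, Finsupp.sum, ← Finset.sum_filter_add_sum_filter_not A (fun k => k ∈ a.support)]
    have h0 : ∑ k ∈ A with k ∉ a.support, a k = 0 :=
      Finset.sum_eq_zero fun k hk => Finsupp.notMem_support_iff.1 (Finset.mem_filter.1 hk).2
    rw [h0, add_zero]
    exact Finset.sum_le_sum_of_subset_of_nonneg (fun k hk => (Finset.mem_filter.1 hk).2)
      fun k _ _ => ha k
  · have hev : ∀ t : ℝ, t ^ m = ∑ l ∈ a.support, a l * (gegenbauer n l).eval t := fun t => by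
      have := congrArg (Polynomial.eval t) hX
      rw [Finsupp.linearCombination_apply, Finsupp.sum, Polynomial.eval_finsetSum] at this
      simpa using this.symm
    simp only [hev, Finset.sum_mul, mul_assoc]
    rw [integral_finsetSum]
    · simp only [integral_const_mul]
      rw [Finset.sum_eq_single k]
      · rfl
      · intro l _ hl
        rw [integral_gegenbauer_mul_gegenbauer hn hl, mul_zero]
      · intro hk
        rw [Finsupp.notMem_support_iff.1 hk, zero_mul]
    · intro l _
      exact (integrable_lineMeas_of_continuous hn
        ((Polynomial.continuous _).mul (Polynomial.continuous _))).const_mul _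

theorem abs_prod_pow_le_one {t : Fin d → ℝ} (ht : t ∈ cube d) (m : Fin d → ℕ) :
    |∏ i, t i ^ m i| ≤ 1 := by
  rw [Finset.abs_prod]
  refine Finset.prod_le_one (fun i _ => abs_nonneg _) fun i _ => ?_
  rw [abs_pow]
  exact pow_le_one₀ (abs_nonneg _) (abs_le.2 (mem_cube.1 ht i))

theorem continuous_prod_pow (m : Fin d → ℕ) : Continuous fun t : Fin d → ℝ => ∏ i, t i ^ m i :=
  continuous_finsetProd _ fun i _ => (continuous_apply i).pow _

section PowerSeries

variable {κ : (Fin d → ℝ) → ℝ} {b : (Fin d → ℕ) → ℝ}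

/-- At t = (1, …, 1) every monomial is 1, and unconditional convergence in ℝ is absolute. -/
theorem summable_abs_coeff (hb : ∀ t ∈ cube d, HasSum (fun m => b m * ∏ i, t i ^ m i) (κ t)) :
    Summable fun m => |b m| := by
  have h := (hb 1 (by simp [mem_cube])).summable.abs
  simpa using h

theorem continuousOn_of_hasSum (hb : ∀ t ∈ cube d, HasSum (fun m => b m * ∏ i, t i ^ m i) (κ t)) :
    ContinuousOn κ (cube d) := by
  have h : ContinuousOn (fun t => ∑' m, b m * ∏ i, t i ^ m i) (cube d) :=
    continuousOn_tsum (fun m => (continuous_const.mul (continuous_prod_pow m)).continuousOn)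
      (summable_abs_coeff hb) fun m t ht => by
        rw [Real.norm_eq_abs, abs_mul]
        exact mul_le_of_le_one_right (abs_nonneg _) (abs_prod_pow_le_one ht m)
  exact h.congr fun t ht => (hb t ht).tsum_eq.symm

theorem hasSum_eigval (hn : 2 ≤ n)
    (hb : ∀ t ∈ cube d, HasSum (fun m => b m * ∏ i, t i ^ m i) (κ t)) (k : Fin d → ℕ) :
    HasSum (fun m => b m * ∏ i, ∫ t, t ^ m i * (gegenbauer n (k i)).eval t ∂(lineMeas n))
      (eigval n κ k) := by
  have := isFiniteMeasure_boxMeas hn d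
  have := isFiniteMeasure_lineMeas hn
  rw [eigval_eq_integral hn]
  obtain ⟨N, hN⟩ := (isCompact_cube d).exists_bound_of_continuousOn
    (continuous_gegProd (n := n) k).continuousOn
  have hN0 : 0 ≤ N := (norm_nonneg _).trans (hN 0 (by simp [mem_cube]))
  set F : (Fin d → ℕ) → (Fin d → ℝ) → ℝ := fun m t => b m * (∏ i, t i ^ m i) * gegProd n k t
  have hFi : ∀ m, Integrable (F m) (boxMeas n d) := fun m =>
    integrable_boxMeas_of_continuousOn hn
      ((continuous_const.mul (continuous_prod_pow m)).mul (continuous_gegProd k)).continuousOn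
  have hbd : ∀ m, ∫ t, ‖F m t‖ ∂(boxMeas n d) ≤ |b m| * (N * (boxMeas n d).real Set.univ) := by
    intro m
    calc ∫ t, ‖F m t‖ ∂(boxMeas n d) ≤ ∫ _, |b m| * N ∂(boxMeas n d) := by
          refine integral_mono_ae (hFi m).norm (integrable_const _) ?_
          filter_upwards [ae_mem_cube hn d] with t ht
          rw [norm_mul, Real.norm_eq_abs, abs_mul, mul_assoc]
          refine mul_le_mul_of_nonneg_left ?_ (abs_nonneg _)
          calc |∏ i, t i ^ m i| * ‖gegProd n k t‖ ≤ 1 * N :=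
                mul_le_mul (abs_prod_pow_le_one ht m) (hN t ht) (norm_nonneg _) zero_le_one
            _ = N := one_mul N
      _ = _ := by rw [integral_const, smul_eq_mul]; ring
  have hs : Summable fun m => ∫ t, ‖F m t‖ ∂(boxMeas n d) :=
    Summable.of_nonneg_of_le (fun m => integral_nonneg fun t => norm_nonneg _) hbd
      ((summable_abs_coeff hb).mul_right _)
  have h := hasSum_integral_of_summable_integral_norm hFi hs
  have e1 : ∫ t, ∑' m, F m t ∂(boxMeas n d) = ∫ t, κ t * gegProd n k t ∂(boxMeas n d) := by
    refine integral_congr_ae ?_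
    filter_upwards [ae_mem_cube hn d] with t ht
    exact ((hb t ht).mul_right _).tsum_eq
  rw [e1] at h
  refine h.congr_fun fun m => ?_
  simp only [F, gegProd, mul_assoc, integral_const_mul, ← Finset.prod_mul_distrib]
  rw [boxMeas, integral_fintype_prod_eq_prod (μ := fun _ : Fin d => lineMeas n)
    (fun i t => t ^ m i * (gegenbauer n (k i)).eval t)]

/-- Since `sumSq` cancels the Gegenbauer norms, λ_k `sumSq` is the sum over m of b_m ∏ a(m_i, k_i).
For fixed m these nonnegative products add up to at most 1 over k, so the whole sum is at most ∑
|b_m|. -/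
theorem IsSHBasis.summable_of_hasSum (hn : 2 ≤ n) (hY : IsSHBasis n Y)
    (hb : ∀ t ∈ cube d, HasSum (fun m => b m * ∏ i, t i ^ m i) (κ t)) :
    Summable fun k : Fin d → ℕ => |eigval n κ k| * sumSq n k := by
  classical
  choose a ha ha1 haI using exists_integral_pow_mul_gegenbauer hn
  have hsb := summable_abs_coeff hb
  have hle : ∀ (A : Finset (Fin d → ℕ)) (m : Fin d → ℕ), ∑ k ∈ A, ∏ i, a (m i) (k i) ≤ 1 := by
    intro A m
    -- The set `A` lies in the box of its coordinate projections, over which the sum of products is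
    -- a product of sums.
    calc ∑ k ∈ A, ∏ i, a (m i) (k i)
        ≤ ∑ k ∈ Fintype.piFinset (fun i => A.image fun k => k i), ∏ i, a (m i) (k i) := by
          refine Finset.sum_le_sum_of_subset_of_nonneg (fun k hk => ?_)
            fun k _ _ => Finset.prod_nonneg fun i _ => ha _ _
          exact Fintype.mem_piFinset.2 fun i => Finset.mem_image_of_mem (fun k => k i) hk
      _ = ∏ i, ∑ l ∈ A.image (fun k => k i), a (m i) l := (Finset.prod_univ_sum _ _).symm
      _ ≤ 1 := Finset.prod_le_one (fun i _ => Finset.sum_nonneg fun l _ => ha _ _)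
          fun i _ => ha1 _ _
  have hp0 : ∀ (m k : Fin d → ℕ), 0 ≤ ∏ i, a (m i) (k i) := fun m k =>
    Finset.prod_nonneg fun i _ => ha _ _
  have hp1 : ∀ (m k : Fin d → ℕ), ∏ i, a (m i) (k i) ≤ 1 := fun m k => by
    simpa using hle {k} m
  have hsk : ∀ k : Fin d → ℕ, Summable fun m => |b m| * ∏ i, a (m i) (k i) := fun k =>
    Summable.of_nonneg_of_le (fun m => mul_nonneg (abs_nonneg _) (hp0 m k))
      (fun m => mul_le_of_le_one_right (abs_nonneg _) (hp1 m k)) hsb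
  have hev : ∀ k : Fin d → ℕ, |eigval n κ k| * sumSq n k ≤ ∑' m, |b m| * ∏ i, a (m i) (k i) := by
    intro k
    have h := (hasSum_eigval hn hb k).mul_right (sumSq n k)
    have hterm : ∀ m : Fin d → ℕ, b m * (∏ i, ∫ t, t ^ m i * (gegenbauer n (k i)).eval t
        ∂(lineMeas n)) * sumSq n k = b m * ∏ i, a (m i) (k i) := by
      intro m
      rw [mul_assoc, sumSq, ← Finset.prod_mul_distrib]
      congr 1
      refine Finset.prod_congr rfl fun i _ => ?_
      rw [haI, mul_assoc, mul_inv_cancel₀ (hY.gegNorm_pos hn _).ne', mul_one]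
    simp only [hterm] at h
    rw [← abs_of_pos (hY.sumSq_pos hn k), ← abs_mul, ← h.tsum_eq]
    have hn' : ∀ m : Fin d → ℕ, ‖b m * ∏ i, a (m i) (k i)‖ = |b m| * ∏ i, a (m i) (k i) := fun m => by
      rw [Real.norm_eq_abs, abs_mul, abs_of_nonneg (hp0 m k)]
    simpa only [hn', Real.norm_eq_abs] using norm_tsum_le_tsum_norm (f := fun m =>
      b m * ∏ i, a (m i) (k i)) (by simpa only [hn'] using hsk k)
  refine summable_of_sum_le (c := ∑' m, |b m|)
    (fun k => mul_nonneg (abs_nonneg _) (hY.sumSq_pos hn k).le) fun A => ?_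
  calc ∑ k ∈ A, |eigval n κ k| * sumSq n k
      ≤ ∑ k ∈ A, ∑' m, |b m| * ∏ i, a (m i) (k i) := Finset.sum_le_sum fun k _ => hev k
    _ = ∑' m, ∑ k ∈ A, |b m| * ∏ i, a (m i) (k i) :=
        (Summable.tsum_finsetSum fun k _ => hsk k).symm
    _ ≤ ∑' m, |b m| := by
        refine Summable.tsum_le_tsum (fun m => ?_) (summable_sum fun k _ => hsk k) hsb
        rw [← Finset.mul_sum]
        exact mul_le_of_le_one_right (abs_nonneg _) (hle A m)

end PowerSeries

end MultiDot

end

/-! ### Assembly of the theorem -/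

open MultiDot in
theorem mainTheorem5 (ζ d : ℕ) (hζ : 2 ≤ ζ)
    (Y : (k : ℕ) → Fin (numHarm ζ k) → Sph ζ → ℝ) (hY : IsSHBasis ζ Y)
    (K : MS ζ d → MS ζ d → ℝ) (κ : (Fin d → ℝ) → ℝ) (hK : IsMultiDot K κ)
    (hκ : MeasureTheory.IntegrableOn (fun t => κ t * ∏ i, weight ζ (t i)) (cube d)) :
    -- the `Q_k` are the orthogonal polynomials for the weight, with `deg Q_k = k`, `Q_k(1) = 1`
    (∀ k, (gegenbauer ζ k).natDegree = k ∧ (gegenbauer ζ k).eval 1 = 1) ∧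
    (∀ k l, MeasureTheory.IntegrableOn
        (fun t => (gegenbauer ζ k).eval t * (gegenbauer ζ l).eval t * weight ζ t)
        (Set.Icc (-1) 1) ∧
      (k ≠ l → ∫ t in Set.Icc (-1 : ℝ) 1,
        (gegenbauer ζ k).eval t * (gegenbauer ζ l).eval t * weight ζ t = 0)) ∧
    -- the SH-products are a complete orthonormal system of `L²` of the multisphere
    (∀ p q : SHIndex ζ d, ∫ x, shProd Y p x * shProd Y q x ∂(unif ζ d) =
      open Classical in if p = q then 1 else 0) ∧
    (∀ f : MS ζ d → ℝ, MeasureTheory.MemLp f 2 (unif ζ d) →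
      (∀ p : SHIndex ζ d, ∫ x, f x * shProd Y p x ∂(unif ζ d) = 0) →
      f =ᵐ[unif ζ d] 0) ∧
    -- they are eigenfunctions of the kernel, with eigenvalues depending only on the frequencies
    (∀ p : SHIndex ζ d, IsEigenfunction K (eigval ζ κ p.1) (shProd Y p)) ∧
    -- there are no other eigenvalues, and every eigenfunction is in the closed span of the
    -- SH-products with the same eigenvalue
    (∀ (μ : ℝ) (f : MS ζ d → ℝ), MeasureTheory.MemLp f 2 (unif ζ d) → ¬ f =ᵐ[unif ζ d] 0 →
      (∀ᵐ x ∂(unif ζ d), ∫ z, K x z * f z ∂(unif ζ d) = μ * f x) →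
      (∃ k : Fin d → ℕ, μ = eigval ζ κ k) ∧
      ∀ p : SHIndex ζ d, eigval ζ κ p.1 ≠ μ → ∫ x, f x * shProd Y p x ∂(unif ζ d) = 0) ∧
    -- Mercer's decomposition, in `L²`
    (MeasureTheory.IntegrableOn (fun t => κ t ^ 2 * ∏ i, weight ζ (t i)) (cube d) →
      MeasureTheory.MemLp (fun w : MS ζ d × MS ζ d => K w.1 w.2) 2
        ((unif ζ d).prod (unif ζ d)) ∧
      Filter.Tendsto
        (fun s : Finset (SHIndex ζ d) => MeasureTheory.eLpNorm
          (fun w : MS ζ d × MS ζ d => K w.1 w.2 -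
            ∑ p ∈ s, eigval ζ κ p.1 * shProd Y p w.1 * shProd Y p w.2) 2
          ((unif ζ d).prod (unif ζ d)))
        Filter.atTop (nhds 0)) ∧
    -- Mercer's decomposition, uniformly and hence pointwise
    ((ContinuousOn κ (cube d) ∧ (Matrix.of K).PosSemidef) ∨ IsPowerSeriesOnCube κ →
      TendstoUniformly
        (fun (s : Finset (SHIndex ζ d)) (w : MS ζ d × MS ζ d) =>
          ∑ p ∈ s, eigval ζ κ p.1 * shProd Y p w.1 * shProd Y p w.2)
        (fun w => K w.1 w.2) Filter.atTop) := by
  obtain rfl : K = fun x z => κ (dots x z) := by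
    funext x z
    exact hK x z
  have hκ' : Integrable κ (boxMeas ζ d) := (integrable_boxMeas hζ).2 hκ
  refine ⟨fun k => ⟨gegenbauer_natDegree hζ k, gegenbauer_eval_one hζ k⟩, fun k l => ⟨?_, ?_⟩,
    fun p q => hY.integral_shProd_mul hζ p q, fun f hf h => hY.ae_eq_zero hζ hf h,
    fun p => ⟨hY.exists_shProd_ne_zero hζ p, fun x =>
      ⟨hY.integrable_comp_dots_mul hζ hκ' p x, hY.integral_comp_dots_mul hζ hκ' p x⟩⟩,
    fun μ f hf hf0 hμ => ?_, fun hκ2 => ?_, fun h => ?_⟩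
  · exact (integrable_lineMeas hζ).1 (integrable_lineMeas_of_continuous hζ
      ((gegenbauer ζ k).continuous.mul (gegenbauer ζ l).continuous))
  · intro hkl
    have h := integral_gegenbauer_mul_gegenbauer hζ hkl
    rw [integral_lineMeas] at h
    exact (mul_eq_zero.1 h).resolve_left (area_pos (by omega)).ne'
  -- Pairing the eigenvalue equation with an SH-product gives λ c = μ c for the coefficient c of f.
  · have hcoef : ∀ p : SHIndex ζ d, eigval ζ κ p.1 ≠ μ →
        ∫ x, f x * shProd Y p x ∂(unif ζ d) = 0 := by
      intro p hp
      have h := hY.integral_integral_comp_dots_mul hζ hκ' (hf.integrable (by norm_num)) p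
      have h' : ∫ x, (∫ z, κ (dots x z) * f z ∂(unif ζ d)) * shProd Y p x ∂(unif ζ d) =
          μ * ∫ x, f x * shProd Y p x ∂(unif ζ d) := by
        rw [← integral_const_mul]
        refine integral_congr_ae (hμ.mono fun x hx => ?_)
        simp only [hx, mul_assoc]
      rw [h'] at h
      have h0 : (eigval ζ κ p.1 - μ) * ∫ x, f x * shProd Y p x ∂(unif ζ d) = 0 := by
        rw [sub_mul, h, sub_self]
      exact (mul_eq_zero.1 h0).resolve_left (sub_ne_zero.2 hp)
    refine ⟨?_, hcoef⟩
    -- If μ were none of the λ, every coefficient of f would vanish, and completeness would give f =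
    -- 0.
    by_contra! hne
    exact hf0 (hY.ae_eq_zero hζ hf fun p => hcoef p (hne p.1).symm)
  · have hκ2' : Integrable (fun t => κ t ^ 2) (boxMeas ζ d) := (integrable_boxMeas hζ).2 hκ2
    exact ⟨memLp_prod_comp_dots hζ hκ'.aestronglyMeasurable hκ2',
      hY.tendsto_eLpNorm_sub_sum hζ hκ' hκ2'⟩
  · rcases h with ⟨hc, hpsd⟩ | ⟨b, hb⟩
    · exact hY.tendstoUniformly hζ hc (hY.summable_of_posSemidef hζ hc hpsd)
    · exact hY.tendstoUniformly hζ (continuousOn_of_hasSum hb) (hY.summable_of_hasSum hζ hb)
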